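/- **Setting.** Fix $p$. For every $n$ let $(\mathbf x_i,y_i)=(\mathbf x_{n,i},y_{n,i})$, $i=1,\dots,n$, be independent observations in $\mathbb R^p\times\mathbb R$ with $\mathbb E|y_i|<\infty$; put $\mu_i=\mathbb E(y_i\mid\mathbf x_i)$, $e_i=y_i-\mu_i$, $\mathbf X=(\mathbf x_1,\dots,\mathbf x_n)^\top$, $\mathbf y=(y_1,\dots,y_n)^\top$, $\boldsymbol\mu=(\mu_1,\dots,\mu_n)^\top$. A forest of $M_n\ge 1$ trees is grown, where $M_n$ grows at most polynomially in $n$. Tree $m$ uses a bootstrap sample $\mathcal B_{(m)}$ ($n$ independent uniform draws with replacement from the $n$ observations) and a further random element $\Theta_{(m)}$; $(\mathcal B,\Theta)=(\mathcal B_{(m)},\Theta_{(m)})_{m\le M_n}$ is independent of $(\mathbf X,\mathbf y)$. The tree is a finite binary tree with splits of the form $[x_j<c]$ whose structure is a (measurable) function of $(\mathbf X,\mathcal B_{(m)},\Theta_{(m)})$ only, hence not of the responses (a split-unsupervised tree, SUT). Let $h_{(m),j}$ be the number of times observation $j$ occurs in $\mathcal B_{(m)}$, and $n_{(m),l}$ the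 number of elements of the bootstrap sample, with multiplicity, in leaf $l$ of tree $m$. The matrix $\mathbf P_{(m)}\in\mathbb R^{n\times n}$ has $(i,j)$ entry $h_{(m),j}/n_{(m),l}$ if $\mathbf x_i,\mathbf x_j$ lie in the same leaf $l$ of tree $m$, and $0$ otherwise. For $\mathbf w$ in the simplex $\mathcal H=\{\mathbf w\in[0,1]^{M_n}:\sum_m w_{(m)}=1\}$ put $\mathbf P(\mathbf w)=\sum_m w_{(m)}\mathbf P_{(m)}$, $\hat{\mathbf e}(\mathbf w)=\{\mathbf I-\mathbf P(\mathbf w)\}\mathbf y$, $$L_n(\mathbf w)=\|\mathbf P(\mathbf w)\mathbf y-\boldsymbol\mu\|^2,\qquad C_n'(\mathbf w)=\|\hat{\mathbf e}(\mathbf w)\|^2+2\sum_{i=1}^n\hat e_i(\mathbf w)^2P_{ii}(\mathbf w),$$ $R_n(\mathbf w)=\mathbb E\{L_n(\mathbf w)\mid\mathbf X,\mathcal B,\Theta\}$ (with respect to a regular conditional probability) and $\xi_n=\inf_{\mathbf w\in\mathcal H}R_n(\mathbf w)$. Let $\widehat{\mathbf w}$ be a (measurable) minimiser of $C_n'$ over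 $\mathcal H$. **Conditions.** 1. Almost surely, $\xi_n>0$ for all large $n$ and $\xi_n^{-1}M_n^2=o(1)$. 2. There is a constant $v>0$ with $\mathbb E(e_i^4\mid\mathbf x_i)\le v$ almost surely for all $n$ and $i\le n$. 3. Almost surely, $\{\min_{m\le M_n}\min_l n_{(m),l}\}^{-1}n^{1/2}=O(1)$, the minimum being over all leaves $l$ of tree $m$. **Theorem.** Under Conditions 1–3, as $n\to\infty$, $$\frac{L_n(\widehat{\mathbf w})}{\inf_{\mathbf w\in\mathcal H}L_n(\mathbf w)}\to 1\quad\text{in probability.}$$ If, in addition, there is a constant $C>0$ with $\{L_n(\widehat{\mathbf w})-\xi_n\}\xi_n^{-1}\le C$ almost surely for all $n$, then the risk of the estimator with the data-driven weights satisfies $$\frac{\mathbb E\{L_n(\widehat{\mathbf w})\mid\mathbf X,\mathcal B,\Theta\}}{\inf_{\mathbf w\in\mathcal H}R_n(\mathbf w)}\to 1\quad\text{almost surely,}$$ and the risk function evaluated at the data-driven weights satisfies $R_n(\mathbf w)|_{\mathbf w=\widehat{\mathbf w}}\big/\inf_{\mathbf w\in\mathcal H}R_n(\mathbf w)\to1$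 in probability. -/

import Mathlib

open MeasureTheory ProbabilityTheory Filter Topology

noncomputable section

namespace WRF

/-- A binary regression-tree structure on `ℝ^p`: each inner node carries a split `[x_j < c]`. -/
inductive SplitTree (p : ℕ) : Type
  | leaf : SplitTree p
  | node (j : Fin p) (c : ℝ) (left right : SplitTree p) : SplitTree p

namespace SplitTree

variable {p : ℕ}

open Classical in
/-- The leaf (as an address: the list of left/right turns) reached by dropping `x` down the tree. -/
def leafOf : SplitTree p → (Fin p → ℝ) → List Bool
  | leaf, _ => []
  | node j c l r, x => if x j < c then true :: l.leafOf x else false :: r.leafOf x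

/-- The addresses of all leaves of the tree. -/
def leaves : SplitTree p → Finset (List Bool)
  | leaf => {[]}
  | node _ _ l r => l.leaves.image (List.cons true) ∪ r.leaves.image (List.cons false)

end SplitTree

variable {p n M : ℕ}

/-- `h_j`: how often observation `j` occurs in the bootstrap sample `b 0, …, b (n-1)`. -/
def bootCount (b : Fin n → Fin n) (j : Fin n) : ℕ :=
  (Finset.univ.filter fun k => b k = j).card

/-- `n_l`: the number of observations of the bootstrap sample lying in the leaf `l`
(counted with multiplicity). -/
def leafSize (T : SplitTree p) (X : Fin n → Fin p → ℝ) (b : Fin n → Fin n) (l : List Bool) : ℕ :=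
  (Finset.univ.filter fun k => T.leafOf (X (b k)) = l).card

/-- The `n × n` matrix of a tree: row `i` holds the weights `h_j / n_l` on the observations `j`
in the leaf `l` of `x_i`, and zero elsewhere. -/
def treeMatrix (T : SplitTree p) (X : Fin n → Fin p → ℝ) (b : Fin n → Fin n) :
    Matrix (Fin n) (Fin n) ℝ :=
  Matrix.of fun i j =>
    if T.leafOf (X j) = T.leafOf (X i) then
      (bootCount b j : ℝ) / (leafSize T X b (T.leafOf (X i)) : ℝ)
    else 0

/-- `P(w) = ∑ₘ wₘ Pₘ`. -/
def weighted (P : Fin M → Matrix (Fin n) (Fin n) ℝ) (w : Fin M → ℝ) : Matrix (Fin n) (Fin n) ℝ :=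
  ∑ m, w m • P m

/-- `‖P(w) y - mu‖²` (Euclidean norm). -/
def sqLoss (P : Fin M → Matrix (Fin n) (Fin n) ℝ) (mu y : Fin n → ℝ) (w : Fin M → ℝ) : ℝ :=
  ∑ i, ((weighted P w).mulVec y i - mu i) ^ 2

/-- The residual vector `(I - P(w)) y`. -/
def residual (P : Fin M → Matrix (Fin n) (Fin n) ℝ) (y : Fin n → ℝ) (w : Fin M → ℝ) (i : Fin n) :
    ℝ :=
  y i - (weighted P w).mulVec y i

/-- The feasible Mallows-type criterion `C'(w)`. -/
def mallows (P : Fin M → Matrix (Fin n) (Fin n) ℝ) (y : Fin n → ℝ) (w : Fin M → ℝ) : ℝ :=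
  ∑ i, residual P y w i ^ 2 + 2 * ∑ i, residual P y w i ^ 2 * weighted P w i i

/-- The random objects behind a sequence of forests, the `n`-th being grown on `n` observations. -/
structure Forest (p : ℕ) (Ω Θ : Type*) where
  /-- number of trees -/
  M : ℕ → ℕ
  /-- predictors -/
  x : (n : ℕ) → Fin n → Ω → (Fin p → ℝ)
  /-- responses -/
  y : (n : ℕ) → Fin n → Ω → ℝ
  /-- bootstrap draws of each tree: the `k`-th drawn observation has index `b n m ω k` -/
  b : (n : ℕ) → Fin (M n) → Ω → (Fin n → Fin n)
  /-- splitting randomness of each tree -/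
  θ : (n : ℕ) → Fin (M n) → Ω → Θ
  /-- the rule that grows a tree; it sees the predictors, the bootstrap draws and the splitting
  randomness, but not the responses -/
  grow : (n : ℕ) → Fin (M n) → (Fin n → Fin p → ℝ) → (Fin n → Fin n) → Θ → SplitTree p

namespace Forest

variable {Ω Θ : Type*} (F : Forest p Ω Θ)

/-- The predictor matrix of the `n`-th sample. -/
def X (n : ℕ) (ω : Ω) : Fin n → Fin p → ℝ := fun i => F.x n i ω

/-- The response vector of the `n`-th sample. -/
def Y (n : ℕ) (ω : Ω) : Fin n → ℝ := fun i => F.y n i ω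

/-- The `m`-th tree. -/
def tree (n : ℕ) (m : Fin (F.M n)) (ω : Ω) : SplitTree p :=
  F.grow n m (F.X n ω) (F.b n m ω) (F.θ n m ω)

/-- The matrices of all trees of the `n`-th forest. -/
def mat (n : ℕ) (ω : Ω) (m : Fin (F.M n)) : Matrix (Fin n) (Fin n) ℝ :=
  treeMatrix (F.tree n m ω) (F.X n ω) (F.b n m ω)

variable [MeasurableSpace Ω] (μ : Measure Ω)

/-- `μ_i = E(y_i | x_i)`. -/
def mean (n : ℕ) (i : Fin n) : Ω → ℝ :=
  μ[F.y n i | MeasurableSpace.comap (F.x n i) inferInstance]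

/-- `e_i = y_i - μ_i`. -/
def err (n : ℕ) (i : Fin n) (ω : Ω) : ℝ := F.y n i ω - F.mean μ n i ω

/-- The loss `L_n(w)`. -/
def L (n : ℕ) (w : Fin (F.M n) → ℝ) (ω : Ω) : ℝ :=
  sqLoss (F.mat n ω) (fun i => F.mean μ n i ω) (F.Y n ω) w

/-- `inf_w L_n(w)` over the simplex. -/
def infL (n : ℕ) (ω : Ω) : ℝ := ⨅ w : stdSimplex ℝ (Fin (F.M n)), F.L μ n w ω

/-- The criterion `C'_n(w)`. -/
def C' (n : ℕ) (w : Fin (F.M n) → ℝ) (ω : Ω) : ℝ := mallows (F.mat n ω) (F.Y n ω) w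

variable [MeasurableSpace Θ]

/-- The σ-algebra generated by the predictors and the randomization of all trees. Given it, the
tree matrices are fixed and only the errors are random. -/
@[reducible] def info (n : ℕ) : MeasurableSpace Ω :=
  MeasurableSpace.comap (fun ω => (F.X n ω, (fun m => F.b n m ω), (fun m => F.θ n m ω)))
    inferInstance

variable [StandardBorelSpace Ω] [IsFiniteMeasure μ]

/-- The conditional expectation of `L_n(W)` given predictors and trees, for a possibly random
weight vector `W`. The regular conditional probability makes this simultaneously meaningful for
all (uncountably many) weights. -/
def condRisk (n : ℕ) (W : Ω → Fin (F.M n) → ℝ) (ω : Ω) : ℝ :=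
  ∫ ω', F.L μ n (W ω') ω' ∂(condExpKernel μ (F.info n) ω)

/-- The risk `R_n(w)` of a fixed weight vector. -/
def R (n : ℕ) (w : Fin (F.M n) → ℝ) (ω : Ω) : ℝ := F.condRisk μ n (fun _ => w) ω

/-- `ξ_n = inf_w R_n(w)` over the simplex. -/
def xi (n : ℕ) (ω : Ω) : ℝ := ⨅ w : stdSimplex ℝ (Fin (F.M n)), F.R μ n w ω

end Forest

/-- The sampling model: independent observations, a bootstrap sample for each tree, and trees whose
structure does not depend on the responses. -/
structure IsSUTForest {Ω Θ : Type*} [MeasurableSpace Ω] [MeasurableSpace Θ] (F : Forest p Ω Θ)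
    (μ : Measure Ω) : Prop where
  pos_M : ∀ n, 0 < F.M n
  meas_x : ∀ n i, Measurable (F.x n i)
  meas_y : ∀ n i, Measurable (F.y n i)
  meas_b : ∀ n m, Measurable (F.b n m)
  meas_θ : ∀ n m, Measurable (F.θ n m)
  /-- whether two observations share a leaf is a measurable event -/
  meas_grow : ∀ n m i j, MeasurableSet
    {z : (Fin n → Fin p → ℝ) × (Fin n → Fin n) × Θ |
      (F.grow n m z.1 z.2.1 z.2.2).leafOf (z.1 i) = (F.grow n m z.1 z.2.1 z.2.2).leafOf (z.1 j)}
  integrable_y : ∀ n i, Integrable (F.y n i) μ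
  /-- the observations `(x_i, y_i)`, `i < n`, are independent -/
  indep_obs : ∀ n, iIndepFun (fun i ω => (F.x n i ω, F.y n i ω)) μ
  /-- each bootstrap sample consists of `n` independent uniform draws from the `n` observations -/
  bootstrap : ∀ n m, μ.map (F.b n m) = uniformOn Set.univ
  /-- the randomization of the trees is independent of the data -/
  indep_rand : ∀ n, IndepFun (fun ω => ((fun m => F.b n m ω), (fun m => F.θ n m ω)))
    (fun ω => (F.X n ω, F.Y n ω)) μ

/-- `ξ_n⁻¹ M_n² = o(1)` almost surely. -/
def RiskCondition {Ω Θ : Type*} [MeasurableSpace Ω] [StandardBorelSpace Ω] [MeasurableSpace Θ]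
    (F : Forest p Ω Θ) (μ : Measure Ω) [IsFiniteMeasure μ] : Prop :=
  ∀ᵐ ω ∂μ, (∀ᶠ n in atTop, 0 < F.xi μ n ω) ∧
    Tendsto (fun n => (F.xi μ n ω)⁻¹ * (F.M n : ℝ) ^ 2) atTop (𝓝 0)

/-- `E(e_i⁴ | x_i) ≤ v` almost surely, with a common constant `v`. -/
def MomentCondition {Ω Θ : Type*} [MeasurableSpace Ω] (F : Forest p Ω Θ) (μ : Measure Ω) : Prop :=
  ∃ v : ℝ, 0 < v ∧ ∀ n i, Integrable (fun ω => F.err μ n i ω ^ 4) μ ∧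
    ∀ᵐ ω ∂μ,
      (μ[fun ω' => F.err μ n i ω' ^ 4 | MeasurableSpace.comap (F.x n i) inferInstance]) ω ≤ v

/-- `{min_m min_l n_{(m),l}}⁻¹ n^{1/2} = O(1)` almost surely. -/
def LeafCondition {Ω Θ : Type*} [MeasurableSpace Ω] (F : Forest p Ω Θ) (μ : Measure Ω) : Prop :=
  ∀ᵐ ω ∂μ, ∃ c : ℝ, ∀ᶠ n : ℕ in atTop, ∀ m, ∀ l ∈ (F.tree n m ω).leaves,
    √(n : ℝ) ≤ c * (leafSize (F.tree n m ω) (F.X n ω) (F.b n m ω) l : ℝ)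

end WRF

end

noncomputable section

namespace WRF

set_option linter.unusedSectionVars false

variable {p n M : ℕ}

/-! Fix the predictors and the randomization. The tree matrices, the means and the error variances
are then constants, and the errors are centred, with the mixed moments up to order four that
independence gives (`ae_errorMoments`, from `condExp_prod_of_indep`). With b(w) = μ − P(w)μ, the
loss differs from its bias-variance formula R(w) by −2⟨b(w), P(w)e⟩ and by ‖P(w)e‖² minus its mean.
The criterion differs from ‖e‖² + L(w) by 2⟨b(w), e⟩, the off-diagonal part of −2eᵀP(w)e, and two
terms weighted by the diagonal of P(w): the diagonal of −2eᵀP(w)e is cancelled by the penalty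
(`mallows_eq`). Since ‖e‖² does not depend on w, it suffices that all these remainders are small
relative to R(w), uniformly in w (`selection_ratio`).

Uniformity comes from bounds T(w)² ≤ R(w)·G, where G does not depend on w and has conditional mean
O(M²); the diagonal terms use such a G and a uniform bound on the diagonal entries
(`exists_uniform_bound`). Linear terms are tested on the span of M bias vectors, of dimension at
most M (`exists_span_bound`). For quadratic terms, nonnegativity of the weights and entries makes
the risk dominate w_m² times the variance of each tree (`sq_mul_treeVar_le_risk`), which absorbs the
second moment of the corresponding form. Markov's inequality for G then gives failure probability
O(M²/ξ), which tends to zero.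

The norms of the tree matrices must stay bounded and their diagonals must vanish
(`ae_eventually_matrixBounds`). This holds if every occupied leaf has at least order √n draws, not
too many observations per draw, and a controlled sum of fourth powers of the bootstrap counts. A
tree may depend on its own bootstrap sample, so regularity is proved for all boxes at once: cells of
trees are boxes, and boxes cut out only polynomially many sets of observations, all determined by
the predictors. For a fixed set, comparison of multinomial counts with Poisson variables gives a
tail of order exp(−n^{1/8}/c) up to polynomial factors (`card_irregular_le`). Borel–Cantelli
finishes, as the number of trees is polynomial.

Thus the conditional probabilities of bad ratios tend to zero almost surely
(`ae_tendsto_condExpKernel_badSet`). Averaging them gives the convergences in probability; the extra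
bound on the loss ratio turns them into convergence of conditional expectations
(`abs_condRisk_div_sub_one_le`). -/

/-- The moments up to order four of independent centred errors with variances `s i`, the variances
and the fourth moments being at most `V`. -/
structure ErrorMoments {Ω : Type*} [MeasurableSpace Ω] (ν : Measure Ω) (e : Fin n → Ω → ℝ)
    (s : Fin n → ℝ) (V : ℝ) : Prop where
  meas : ∀ i, Measurable (e i)
  integrable : ∀ i, Integrable (fun ω => e i ω ^ 4) ν
  mean_zero : ∀ i, ∫ ω, e i ω ∂ν = 0
  cov : ∀ i j, i ≠ j → ∫ ω, e i ω * e j ω ∂ν = 0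
  var : ∀ i, ∫ ω, e i ω * e i ω ∂ν = s i
  mixed : ∀ i j k l, i ≠ j → i ≠ k → i ≠ l → ∫ ω, e i ω * e j ω * (e k ω * e l ω) ∂ν = 0
  sq_sq : ∀ i j, i ≠ j → ∫ ω, e i ω * e j ω * (e i ω * e j ω) ∂ν = s i * s j
  fourth : ∀ i, ∫ ω, e i ω ^ 4 ∂ν ≤ V
  var_le : ∀ i, s i ≤ V

/-! ### Second moments of linear and quadratic forms in the errors -/

lemma abs_mul_mul_le (a b c d : ℝ) :
    |a * b * (c * d)| ≤ a ^ 4 + b ^ 4 + (c ^ 4 + d ^ 4) := by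
  rw [abs_le]
  constructor
  · nlinarith [sq_nonneg (a * b + c * d), sq_nonneg (a ^ 2 - b ^ 2), sq_nonneg (c ^ 2 - d ^ 2),
      sq_nonneg (a ^ 2), sq_nonneg (b ^ 2), sq_nonneg (c ^ 2), sq_nonneg (d ^ 2)]
  · nlinarith [sq_nonneg (a * b - c * d), sq_nonneg (a ^ 2 - b ^ 2), sq_nonneg (c ^ 2 - d ^ 2),
      sq_nonneg (a ^ 2), sq_nonneg (b ^ 2), sq_nonneg (c ^ 2), sq_nonneg (d ^ 2)]

lemma abs_mul_le (a b : ℝ) : |a * b| ≤ 1 + (a ^ 4 + b ^ 4) := by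
  rw [abs_le]
  constructor
  · nlinarith [sq_nonneg (a + b), sq_nonneg (a ^ 2 - 1 / 2), sq_nonneg (b ^ 2 - 1 / 2)]
  · nlinarith [sq_nonneg (a - b), sq_nonneg (a ^ 2 - 1 / 2), sq_nonneg (b ^ 2 - 1 / 2)]

namespace ErrorMoments

variable {Ω : Type*} [MeasurableSpace Ω] {ν : Measure Ω} [IsProbabilityMeasure ν]
  {e : Fin n → Ω → ℝ} {s : Fin n → ℝ} {V : ℝ}

lemma integrable_four (h : ErrorMoments ν e s V) (i j k l : Fin n) :
    Integrable (fun ω => e i ω * e j ω * (e k ω * e l ω)) ν := by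
  have hm := h.meas
  refine Integrable.mono' (((h.integrable i).add (h.integrable j)).add
    ((h.integrable k).add (h.integrable l))) (by fun_prop)
    (ae_of_all _ fun ω => abs_mul_mul_le _ _ _ _)

lemma integrable_two (h : ErrorMoments ν e s V) (i j : Fin n) :
    Integrable (fun ω => e i ω * e j ω) ν := by
  have hm := h.meas
  refine Integrable.mono' ((integrable_const (1 : ℝ)).add
    ((h.integrable i).add (h.integrable j))) (by fun_prop)
    (ae_of_all _ fun ω => abs_mul_le _ _)

lemma integrable_one (h : ErrorMoments ν e s V) (i : Fin n) : Integrable (e i) ν := by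
  have hm := h.meas
  refine Integrable.mono' ((integrable_const (1 : ℝ)).add
    (h.integrable_two i i)) (by fun_prop) (ae_of_all _ fun ω => ?_)
  simp only [Pi.add_apply, Real.norm_eq_abs]
  generalize e i ω = a
  rw [abs_le]
  constructor <;> nlinarith [sq_nonneg (a + 1), sq_nonneg (a - 1)]

lemma var_nonneg (h : ErrorMoments ν e s V) (i : Fin n) : 0 ≤ s i := by
  rw [← h.var i]; exact integral_nonneg fun ω => mul_self_nonneg _

lemma integral_mul (h : ErrorMoments ν e s V) (i j : Fin n) :
    ∫ ω, e i ω * e j ω ∂ν = if i = j then s i else 0 := by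
  split_ifs with hij
  · subst hij; exact h.var i
  · exact h.cov i j hij

/-- A linear form in the errors has the expected second moment. -/
lemma integral_linear_sq (h : ErrorMoments ν e s V) (u : Fin n → ℝ) :
    Integrable (fun ω => (∑ i, u i * e i ω) ^ 2) ν ∧
      ∫ ω, (∑ i, u i * e i ω) ^ 2 ∂ν = ∑ i, u i ^ 2 * s i := by
  have hexp : (fun ω => (∑ i, u i * e i ω) ^ 2)
      = fun ω => ∑ i, ∑ j, u i * u j * (e i ω * e j ω) := by
    funext ω
    rw [sq, Finset.sum_mul_sum]
    refine Finset.sum_congr rfl fun i _ => Finset.sum_congr rfl fun j _ => by ring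
  have hint : ∀ i j, Integrable (fun ω => u i * u j * (e i ω * e j ω)) ν := fun i j =>
    (h.integrable_two i j).const_mul _
  rw [hexp]
  refine ⟨integrable_finsetSum _ fun i _ => integrable_finsetSum _ fun j _ => hint i j, ?_⟩
  rw [integral_finsetSum _ fun i _ => integrable_finsetSum _ fun j _ => hint i j]
  refine Finset.sum_congr rfl fun i _ => ?_
  rw [integral_finsetSum _ fun j _ => hint i j]
  simp only [integral_const_mul, h.integral_mul, mul_ite, mul_zero, Finset.sum_ite_eq,
    Finset.mem_univ, if_true]
  ring

lemma integral_linear_sq_le (h : ErrorMoments ν e s V) (u : Fin n → ℝ) :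
    ∫ ω, (∑ i, u i * e i ω) ^ 2 ∂ν ≤ V * ∑ i, u i ^ 2 := by
  rw [(h.integral_linear_sq u).2, Finset.mul_sum]
  exact Finset.sum_le_sum fun i _ => by nlinarith [h.var_le i, sq_nonneg (u i)]

/-- An index occurring only once kills the moment, so only the two pairings {i, j} = {k, l} survive.
The field `mixed` has the isolated index in first position, whence the reordering of factors. -/
lemma integral_mul_mul (h : ErrorMoments ν e s V) {i j k l : Fin n} (hij : i ≠ j) (hkl : k ≠ l) :
    ∫ ω, e i ω * e j ω * (e k ω * e l ω) ∂ν
      = (if i = k ∧ j = l then s i * s j else 0) + if i = l ∧ j = k then s i * s j else 0 := by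
  by_cases hik : i = k
  · subst hik
    by_cases hjl : j = l
    · subst hjl
      simp [h.sq_sq i j hij, hij]
    · have := h.mixed j i i l hij.symm hij.symm hjl
      simp only [hjl, hkl, and_false, false_and, if_false, add_zero]
      rw [← this]
      exact integral_congr_ae (ae_of_all _ fun ω => by ring)
  · by_cases hil : i = l
    · subst hil
      by_cases hjk : j = k
      · subst hjk
        simp only [hij, false_and, and_self, if_false, if_true, zero_add]
        rw [← h.sq_sq i j hij]
        exact integral_congr_ae (ae_of_all _ fun ω => by ring)
      · have := h.mixed j i k i hij.symm hjk hij.symm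
        simp only [hik, hjk, and_false, false_and, if_false, add_zero]
        rw [← this]
        exact integral_congr_ae (ae_of_all _ fun ω => by ring)
    · simpa [hik, hil] using h.mixed i j k l hij hik hil

/-- Second moment of a quadratic form without diagonal. -/
lemma integral_offDiag_sq_le (h : ErrorMoments ν e s V) (Q : Fin n → Fin n → ℝ) :
    Integrable (fun ω => (∑ i, ∑ j, if i = j then 0 else Q i j * (e i ω * e j ω)) ^ 2) ν ∧
      ∫ ω, (∑ i, ∑ j, if i = j then 0 else Q i j * (e i ω * e j ω)) ^ 2 ∂ν
        ≤ 2 * ∑ i, ∑ j, Q i j ^ 2 * (s i * s j) := by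
  set D : Finset (Fin n × Fin n) := Finset.univ.filter fun a => a.1 ≠ a.2 with hD
  have hsum : ∀ ω, (∑ i, ∑ j, if i = j then 0 else Q i j * (e i ω * e j ω))
      = ∑ a ∈ D, Q a.1 a.2 * (e a.1 ω * e a.2 ω) := by
    intro ω
    rw [hD, Finset.sum_filter, ← Finset.univ_product_univ, Finset.sum_product]
    simp only [ne_eq, ite_not]
  have hexp : (fun ω => (∑ i, ∑ j, if i = j then 0 else Q i j * (e i ω * e j ω)) ^ 2)
      = fun ω => ∑ a ∈ D, ∑ c ∈ D, Q a.1 a.2 * Q c.1 c.2 *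
        (e a.1 ω * e a.2 ω * (e c.1 ω * e c.2 ω)) := by
    funext ω
    rw [hsum, sq, Finset.sum_mul_sum]
    refine Finset.sum_congr rfl fun i _ => Finset.sum_congr rfl fun j _ => by ring
  have hint : ∀ a c : Fin n × Fin n, Integrable (fun ω => Q a.1 a.2 * Q c.1 c.2 *
        (e a.1 ω * e a.2 ω * (e c.1 ω * e c.2 ω))) ν := fun a c =>
    (h.integrable_four _ _ _ _).const_mul _
  rw [hexp]
  refine ⟨integrable_finsetSum _ fun i _ => integrable_finsetSum _ fun j _ => hint i j, ?_⟩
  rw [integral_finsetSum _ fun i _ => integrable_finsetSum _ fun j _ => hint i j]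
  have hterm : ∀ a ∈ D, ∫ ω, ∑ c ∈ D, Q a.1 a.2 * Q c.1 c.2 *
        (e a.1 ω * e a.2 ω * (e c.1 ω * e c.2 ω)) ∂ν
      = Q a.1 a.2 ^ 2 * (s a.1 * s a.2) + Q a.1 a.2 * Q a.2 a.1 * (s a.1 * s a.2) := by
    intro a ha
    have ha' : a.1 ≠ a.2 := by simpa [hD] using ha
    have haD : (a.2, a.1) ∈ D := by simpa [hD] using ha'.symm
    rw [integral_finsetSum _ fun j _ => hint a j]
    have : ∀ c ∈ D, ∫ ω, Q a.1 a.2 * Q c.1 c.2 * (e a.1 ω * e a.2 ω * (e c.1 ω * e c.2 ω)) ∂ν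
        = (if a = c then Q a.1 a.2 * Q c.1 c.2 * (s a.1 * s a.2) else 0)
          + if (a.2, a.1) = c then Q a.1 a.2 * Q c.1 c.2 * (s a.1 * s a.2) else 0 := by
      intro c hc
      have hc' : c.1 ≠ c.2 := by simpa [hD] using hc
      rw [integral_const_mul, h.integral_mul_mul ha' hc', mul_add]
      congr 1
      · simp only [Prod.ext_iff, mul_ite, mul_zero]
      · simp only [Prod.ext_iff, mul_ite, mul_zero, and_comm]
    rw [Finset.sum_congr rfl this, Finset.sum_add_distrib, Finset.sum_ite_eq, Finset.sum_ite_eq,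
      if_pos ha, if_pos haD]
    ring
  rw [Finset.sum_congr rfl hterm]
  have hs := h.var_nonneg
  -- The pairing with the transposed entry is absorbed by 2xy ≤ x² + y². Summed over all ordered
  -- pairs, an entry and its transpose contribute alike, hence 3/2 + 1/2 = 2.
  calc ∑ a ∈ D, (Q a.1 a.2 ^ 2 * (s a.1 * s a.2) + Q a.1 a.2 * Q a.2 a.1 * (s a.1 * s a.2))
      ≤ ∑ a ∈ D, ((3 / 2) * (Q a.1 a.2 ^ 2 * (s a.1 * s a.2))
          + (1 / 2) * (Q a.2 a.1 ^ 2 * (s a.2 * s a.1))) := by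
        refine Finset.sum_le_sum fun a _ => ?_
        have := mul_nonneg (hs a.1) (hs a.2)
        nlinarith [mul_nonneg this (sq_nonneg (Q a.1 a.2 - Q a.2 a.1))]
    _ ≤ ∑ a : Fin n × Fin n, ((3 / 2) * (Q a.1 a.2 ^ 2 * (s a.1 * s a.2))
          + (1 / 2) * (Q a.2 a.1 ^ 2 * (s a.2 * s a.1))) := by
        refine Finset.sum_le_sum_of_subset_of_nonneg (Finset.subset_univ _) fun a _ _ => ?_
        have := mul_nonneg (hs a.1) (hs a.2)
        have := mul_nonneg (hs a.2) (hs a.1)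
        positivity
    _ = 2 * ∑ i, ∑ j, Q i j ^ 2 * (s i * s j) := by
        rw [← Finset.univ_product_univ, Finset.sum_product]
        simp only [Finset.sum_add_distrib, ← Finset.mul_sum]
        rw [Finset.sum_comm (f := fun i j => Q j i ^ 2 * (s j * s i))]
        ring

/-- Second moment of a centred diagonal quadratic form. -/
lemma integral_diag_sq_le (h : ErrorMoments ν e s V) (q : Fin n → ℝ) :
    Integrable (fun ω => (∑ i, q i * (e i ω * e i ω - s i)) ^ 2) ν ∧
      ∫ ω, (∑ i, q i * (e i ω * e i ω - s i)) ^ 2 ∂ν ≤ V * ∑ i, q i ^ 2 := by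
  have hexp : (fun ω => (∑ i, q i * (e i ω * e i ω - s i)) ^ 2)
      = fun ω => ∑ i, ∑ j, q i * q j *
        ((e i ω * e i ω * (e j ω * e j ω) - s j * (e i ω * e i ω)) -
          (s i * (e j ω * e j ω) - s i * s j)) := by
    funext ω
    rw [sq, Finset.sum_mul_sum]
    refine Finset.sum_congr rfl fun i _ => Finset.sum_congr rfl fun j _ => by ring
  have h1 : ∀ i j, Integrable (fun ω => e i ω * e i ω * (e j ω * e j ω) - s j * (e i ω * e i ω)) ν :=
    fun i j => (h.integrable_four i i j j).sub ((h.integrable_two i i).const_mul _)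
  have h2 : ∀ i j, Integrable (fun ω => s i * (e j ω * e j ω) - s i * s j) ν :=
    fun i j => ((h.integrable_two j j).const_mul _).sub (integrable_const _)
  have hint : ∀ i j, Integrable (fun ω => q i * q j *
        ((e i ω * e i ω * (e j ω * e j ω) - s j * (e i ω * e i ω)) -
          (s i * (e j ω * e j ω) - s i * s j))) ν := fun i j =>
    ((h1 i j).sub (h2 i j)).const_mul _
  rw [hexp]
  refine ⟨integrable_finsetSum _ fun i _ => integrable_finsetSum _ fun j _ => hint i j, ?_⟩
  rw [integral_finsetSum _ fun i _ => integrable_finsetSum _ fun j _ => hint i j, Finset.mul_sum]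
  refine Finset.sum_le_sum fun i _ => ?_
  rw [integral_finsetSum _ fun j _ => hint i j]
  have key : ∀ j, ∫ ω, q i * q j * ((e i ω * e i ω * (e j ω * e j ω) - s j * (e i ω * e i ω)) -
          (s i * (e j ω * e j ω) - s i * s j)) ∂ν
      = q i * q j * (∫ ω, e i ω * e i ω * (e j ω * e j ω) ∂ν - s i * s j) := by
    intro j
    rw [integral_const_mul, integral_sub (h1 i j) (h2 i j),
      integral_sub (h.integrable_four i i j j) ((h.integrable_two i i).const_mul _),
      integral_sub ((h.integrable_two j j).const_mul _) (integrable_const _),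
      integral_const_mul, integral_const_mul, h.var, h.var]
    simp
    left; ring
  simp only [key]
  -- Centred squares of distinct errors are uncorrelated, so only the diagonal survives; there the
  -- negative term −s_i² is dropped.
  rw [Finset.sum_eq_single i]
  · have h4 : ∫ ω, e i ω * e i ω * (e i ω * e i ω) ∂ν ≤ V := by
      refine le_trans (le_of_eq ?_) (h.fourth i)
      exact integral_congr_ae (ae_of_all _ fun ω => by ring)
    nlinarith [sq_nonneg (q i), mul_self_nonneg (s i)]
  · intro j _ hj
    have : ∫ ω, e i ω * e i ω * (e j ω * e j ω) ∂ν = s i * s j := by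
      rw [← h.sq_sq i j hj.symm]
      exact integral_congr_ae (ae_of_all _ fun ω => by ring)
    rw [this]; ring
  · simp

end ErrorMoments

/-! ### Risk of a fixed design and tests against a finite-dimensional span -/

/-- The risk of the weights `w` for a deterministic design: squared bias plus variance, `s j` being
the error variances. -/
def risk (P : Fin M → Matrix (Fin n) (Fin n) ℝ) (mu s : Fin n → ℝ) (w : Fin M → ℝ) : ℝ :=
  ∑ i, (mu i - (weighted P w).mulVec mu i) ^ 2 + ∑ i, ∑ j, weighted P w i j ^ 2 * s j

/-- Norm bounds on the matrices of the trees. -/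
structure MatrixBounds (P : Fin M → Matrix (Fin n) (Fin n) ℝ) (K ρ : ℝ) : Prop where
  nonneg : ∀ m i j, 0 ≤ P m i j
  op : ∀ m (u : Fin n → ℝ), ∑ j, (∑ i, u i * P m i j) ^ 2 ≤ K * ∑ i, u i ^ 2
  diag_sq : ∀ m, ∑ i, P m i i ^ 2 ≤ K
  diag_le : ∀ m i, P m i i ≤ ρ
  col : ∀ m, ∑ j, (∑ i, P m i j ^ 2) ^ 2 ≤ K

/-- The variance part of the risk of a single tree. -/
def treeVar (P : Fin M → Matrix (Fin n) (Fin n) ℝ) (s : Fin n → ℝ) (m : Fin M) : ℝ :=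
  ∑ i, ∑ j, P m i j ^ 2 * s j

lemma weighted_apply (P : Fin M → Matrix (Fin n) (Fin n) ℝ) (w : Fin M → ℝ) (i j : Fin n) :
    weighted P w i j = ∑ m, w m * P m i j := by
  simp [weighted, Matrix.sum_apply]

lemma weighted_mulVec (P : Fin M → Matrix (Fin n) (Fin n) ℝ) (w : Fin M → ℝ) (y : Fin n → ℝ)
    (i : Fin n) : (weighted P w).mulVec y i = ∑ m, w m * (P m).mulVec y i := by
  simp only [Matrix.mulVec, dotProduct, weighted_apply, Finset.sum_mul, Finset.mul_sum]
  rw [Finset.sum_comm]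
  exact Finset.sum_congr rfl fun m _ => Finset.sum_congr rfl fun j _ => by ring

lemma bias_eq (P : Fin M → Matrix (Fin n) (Fin n) ℝ) {w : Fin M → ℝ}
    (hw : w ∈ stdSimplex ℝ (Fin M)) (mu : Fin n → ℝ) (i : Fin n) :
    mu i - (weighted P w).mulVec mu i = ∑ m, w m * (mu i - (P m).mulVec mu i) := by
  simp only [mul_sub, Finset.sum_sub_distrib, ← Finset.sum_mul, hw.2, one_mul, weighted_mulVec]

lemma sq_sum_mul_le {ι : Type*} (t : Finset ι) {w : ι → ℝ} (hw : ∀ i ∈ t, 0 ≤ w i)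
    (hw1 : ∑ i ∈ t, w i ≤ 1) (z : ι → ℝ) :
    (∑ i ∈ t, w i * z i) ^ 2 ≤ ∑ i ∈ t, w i * z i ^ 2 := by
  have h := Finset.sum_sq_le_sum_mul_sum_of_sq_le_mul t (r := fun i => w i * z i) (f := w)
    (g := fun i => w i * z i ^ 2) hw (fun i hi => mul_nonneg (hw i hi) (sq_nonneg _))
    (fun i _ => le_of_eq (by ring))
  have h0 : 0 ≤ ∑ i ∈ t, w i * z i ^ 2 :=
    Finset.sum_nonneg fun i hi => mul_nonneg (hw i hi) (sq_nonneg _)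
  nlinarith

section Parseval

variable {Ω : Type*} [MeasurableSpace Ω] {ν : Measure Ω}

/-- A random vector with bounded second moments in each direction, tested against the span of `M`
vectors: up to the norm of the test vector, the second moment grows like `M` uniformly. -/
lemma exists_span_bound (u : Fin M → Fin n → ℝ) (z : Fin n → Ω → ℝ) {C : ℝ} (hC : 0 ≤ C)
    (hz : ∀ a : Fin n → ℝ, Integrable (fun ω => (∑ i, a i * z i ω) ^ 2) ν ∧
      ∫ ω, (∑ i, a i * z i ω) ^ 2 ∂ν ≤ C * ∑ i, a i ^ 2) :
    ∃ G : Ω → ℝ, (∀ ω, 0 ≤ G ω) ∧ Integrable G ν ∧ ∫ ω, G ω ∂ν ≤ C * M ∧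
      ∀ ω (w : Fin M → ℝ), (∑ i, (∑ m, w m * u m i) * z i ω) ^ 2
        ≤ (∑ i, (∑ m, w m * u m i) ^ 2) * G ω := by
  -- This span has dimension at most M, whatever n is. G is the squared norm of the projection of z
  -- onto it: each basis vector costs at most C in the mean, and Cauchy–Schwarz in these coordinates
  -- handles all w at once.
  set S : Submodule ℝ (EuclideanSpace ℝ (Fin n)) :=
    Submodule.span ℝ (Set.range fun m => WithLp.toLp 2 (u m)) with hS
  set b := stdOrthonormalBasis ℝ S with hb
  have hnorm : ∀ k, ∑ i, (b k : EuclideanSpace ℝ (Fin n)) i ^ 2 = 1 := by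
    intro k
    have h1 : ‖(b k : EuclideanSpace ℝ (Fin n))‖ = 1 := b.orthonormal.1 k
    have h2 := EuclideanSpace.norm_sq_eq (b k : EuclideanSpace ℝ (Fin n))
    rw [h1] at h2
    simpa using h2.symm
  refine ⟨fun ω => ∑ k, (∑ i, (b k : EuclideanSpace ℝ (Fin n)) i * z i ω) ^ 2,
    fun ω => Finset.sum_nonneg fun k _ => sq_nonneg _,
    integrable_finsetSum _ fun k _ => (hz _).1, ?_, ?_⟩
  · rw [integral_finsetSum _ fun k _ => (hz _).1]
    calc ∑ k, ∫ ω, (∑ i, (b k : EuclideanSpace ℝ (Fin n)) i * z i ω) ^ 2 ∂ν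
        ≤ ∑ _k : Fin (Module.finrank ℝ S), C := by
          refine Finset.sum_le_sum fun k _ => (hz _).2.trans ?_
          rw [hnorm, mul_one]
      _ = C * (Module.finrank ℝ S : ℝ) := by simp [mul_comm]
      _ ≤ C * M := by
          refine mul_le_mul_of_nonneg_left ?_ hC
          have := finrank_range_le_card (R := ℝ) (fun m : Fin M => WithLp.toLp 2 (u m))
          rw [Fintype.card_fin] at this
          exact_mod_cast this
  · intro ω w
    have hmem : (∑ m, w m • WithLp.toLp 2 (u m) : EuclideanSpace ℝ (Fin n)) ∈ S :=
      Submodule.sum_mem _ fun m _ => Submodule.smul_mem _ _ (Submodule.subset_span ⟨m, rfl⟩)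
    set a : S := ⟨_, hmem⟩ with ha
    have hai : ∀ i, (a : EuclideanSpace ℝ (Fin n)) i = ∑ m, w m * u m i := by
      intro i; simp [ha]
    have hrep : ∀ i, (a : EuclideanSpace ℝ (Fin n)) i
        = ∑ k, inner ℝ (b k) a * (b k : EuclideanSpace ℝ (Fin n)) i := by
      intro i
      have := congrArg (fun t : S => (t : EuclideanSpace ℝ (Fin n)) i) (b.sum_repr' a)
      simpa using this.symm
    have hsum : ∑ i, (∑ m, w m * u m i) ^ 2 = ∑ k, inner ℝ (b k) a ^ 2 := by
      have h1 := EuclideanSpace.norm_sq_eq (a : EuclideanSpace ℝ (Fin n))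
      have h2 : _ = ‖(a : EuclideanSpace ℝ (Fin n))‖ ^ 2 := b.sum_sq_norm_inner_right a
      rw [← h2] at h1
      simp only [hai, Real.norm_eq_abs, sq_abs] at h1
      exact h1.symm
    have hlin : ∑ i, (∑ m, w m * u m i) * z i ω
        = ∑ k, inner ℝ (b k) a * ∑ i, (b k : EuclideanSpace ℝ (Fin n)) i * z i ω := by
      simp only [← hai]
      simp only [hrep, Finset.sum_mul, Finset.mul_sum]
      rw [Finset.sum_comm]
      exact Finset.sum_congr rfl fun k _ => Finset.sum_congr rfl fun i _ => by ring
    rw [hsum, hlin]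
    exact Finset.sum_mul_sq_le_sq_mul_sq _ _ _

end Parseval

section Risk

variable {P : Fin M → Matrix (Fin n) (Fin n) ℝ} {mu s : Fin n → ℝ} {w : Fin M → ℝ} {K ρ : ℝ}

lemma bias_le_risk (hs : ∀ i, 0 ≤ s i) :
    ∑ i, (mu i - (weighted P w).mulVec mu i) ^ 2 ≤ risk P mu s w := by
  unfold risk
  have : 0 ≤ ∑ i, ∑ j, weighted P w i j ^ 2 * s j :=
    Finset.sum_nonneg fun i _ => Finset.sum_nonneg fun j _ => mul_nonneg (sq_nonneg _) (hs j)
  linarith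

lemma treeVar_nonneg (hs : ∀ i, 0 ≤ s i) (m : Fin M) : 0 ≤ treeVar P s m :=
  Finset.sum_nonneg fun _ _ => Finset.sum_nonneg fun j _ => mul_nonneg (sq_nonneg _) (hs j)

/-- Weights and entries are nonnegative, so trees cannot cancel each other's variance: an entry of
P(w) is at least the contribution of any single tree. This lets the risk absorb quadratic forms
whose second moment is of the size of `treeVar`. -/
lemma sq_mul_treeVar_le_risk (hP : ∀ m i j, 0 ≤ P m i j) (hs : ∀ i, 0 ≤ s i)
    (hw : ∀ m, 0 ≤ w m) (m : Fin M) : w m ^ 2 * treeVar P s m ≤ risk P mu s w := by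
  have h0 : 0 ≤ ∑ i, (mu i - (weighted P w).mulVec mu i) ^ 2 :=
    Finset.sum_nonneg fun i _ => sq_nonneg _
  have h1 : w m ^ 2 * treeVar P s m ≤ ∑ i, ∑ j, weighted P w i j ^ 2 * s j := by
    rw [treeVar, Finset.mul_sum]
    refine Finset.sum_le_sum fun i _ => ?_
    rw [Finset.mul_sum]
    refine Finset.sum_le_sum fun j _ => ?_
    rw [← mul_assoc, ← mul_pow]
    refine mul_le_mul_of_nonneg_right ?_ (hs j)
    refine pow_le_pow_left₀ (mul_nonneg (hw m) (hP m i j)) ?_ 2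
    rw [weighted_apply]
    exact Finset.single_le_sum (f := fun m => w m * P m i j)
      (fun k _ => mul_nonneg (hw k) (hP k i j)) (Finset.mem_univ m)
  unfold risk
  linarith

/-- By 2w_m w_k ≤ w_m² + w_k², the minimum allowing each square to be matched with its own tree. It
serves the pairs of trees in the expansion of ‖P(w)e‖². -/
lemma mul_min_treeVar_le_risk (hP : ∀ m i j, 0 ≤ P m i j) (hs : ∀ i, 0 ≤ s i)
    (hw : ∀ m, 0 ≤ w m) (m k : Fin M) :
    w m * w k * min (treeVar P s m) (treeVar P s k) ≤ risk P mu s w := by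
  have hm := sq_mul_treeVar_le_risk (mu := mu) hP hs hw m
  have hk := sq_mul_treeVar_le_risk (mu := mu) hP hs hw k
  have hmin : 0 ≤ min (treeVar P s m) (treeVar P s k) :=
    le_min (treeVar_nonneg hs m) (treeVar_nonneg hs k)
  have h1 := mul_le_mul_of_nonneg_left (min_le_left (treeVar P s m) (treeVar P s k))
    (sq_nonneg (w m))
  have h2 := mul_le_mul_of_nonneg_left (min_le_right (treeVar P s m) (treeVar P s k))
    (sq_nonneg (w k))
  nlinarith [mul_nonneg hmin (sq_nonneg (w m - w k))]

end Risk

/-! ### Domination of the stochastic terms, uniformly over the simplex -/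

section Dominate

variable {Ω : Type*} [MeasurableSpace Ω] {ν : Measure Ω} [IsProbabilityMeasure ν]
  {P : Fin M → Matrix (Fin n) (Fin n) ℝ} {mu s : Fin n → ℝ} {K ρ V : ℝ} {e : Fin n → Ω → ℝ}

/-- The error tested against the bias. -/
lemma exists_bound_error_bias (he : ErrorMoments ν e s V) (hV : 0 ≤ V)
    (P : Fin M → Matrix (Fin n) (Fin n) ℝ) (mu : Fin n → ℝ) :
    ∃ G : Ω → ℝ, (∀ ω, 0 ≤ G ω) ∧ Integrable G ν ∧ ∫ ω, G ω ∂ν ≤ V * M ∧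
      ∀ ω, ∀ w ∈ stdSimplex ℝ (Fin M),
        (∑ i, (mu i - (weighted P w).mulVec mu i) * e i ω) ^ 2 ≤ risk P mu s w * G ω := by
  obtain ⟨G, h0, hi, hint, hG⟩ := exists_span_bound (ν := ν)
    (fun m i => mu i - (P m).mulVec mu i) e hV
    (fun a => ⟨(he.integral_linear_sq a).1, he.integral_linear_sq_le a⟩)
  refine ⟨G, h0, hi, hint, fun ω w hw => ?_⟩
  have := hG ω w
  simp only [← bias_eq P hw mu] at this
  exact this.trans (mul_le_mul_of_nonneg_right (bias_le_risk he.var_nonneg) (h0 ω))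

/-- The smoothed error tested against the bias. -/
lemma exists_bound_smooth_bias (hP : MatrixBounds P K ρ) (hK : 0 ≤ K)
    (he : ErrorMoments ν e s V) (hV : 0 ≤ V) (mu : Fin n → ℝ) :
    ∃ G : Ω → ℝ, (∀ ω, 0 ≤ G ω) ∧ Integrable G ν ∧ ∫ ω, G ω ∂ν ≤ V * K * M ^ 2 ∧
      ∀ ω, ∀ w ∈ stdSimplex ℝ (Fin M),
        (∑ i, (mu i - (weighted P w).mulVec mu i) * (weighted P w).mulVec (fun j => e j ω) i) ^ 2
          ≤ risk P mu s w * G ω := by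
  have hz : ∀ m (a : Fin n → ℝ),
      Integrable (fun ω => (∑ i, a i * (P m).mulVec (fun j => e j ω) i) ^ 2) ν ∧
      ∫ ω, (∑ i, a i * (P m).mulVec (fun j => e j ω) i) ^ 2 ∂ν ≤ V * K * ∑ i, a i ^ 2 := by
    intro m a
    -- Testing P_m e against a is testing e against P_mᵀa, whose squared norm is at most K‖a‖².
    have hswap : ∀ ω, ∑ i, a i * (P m).mulVec (fun j => e j ω) i
        = ∑ j, (∑ i, a i * P m i j) * e j ω := by
      intro ω
      simp only [Matrix.mulVec, dotProduct, Finset.sum_mul, Finset.mul_sum]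
      rw [Finset.sum_comm]
      exact Finset.sum_congr rfl fun k _ => Finset.sum_congr rfl fun i _ => by ring
    simp only [hswap]
    refine ⟨(he.integral_linear_sq _).1, (he.integral_linear_sq_le _).trans ?_⟩
    rw [mul_assoc]
    exact mul_le_mul_of_nonneg_left (hP.op m a) hV
  choose G h0 hi hint hG using fun m => exists_span_bound (ν := ν)
    (fun m i => mu i - (P m).mulVec mu i) (fun i ω => (P m).mulVec (fun j => e j ω) i)
    (mul_nonneg hV hK) (hz m)
  -- The span costs one factor M and the sum over the smoothing trees the other; convexity in the
  -- outer weights costs nothing more.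
  refine ⟨fun ω => ∑ m, G m ω, fun ω => Finset.sum_nonneg fun m _ => h0 m ω,
    integrable_finsetSum _ fun m _ => hi m, ?_, ?_⟩
  · rw [integral_finsetSum _ fun m _ => hi m]
    calc ∑ m, ∫ ω, G m ω ∂ν ≤ ∑ _m : Fin M, V * K * M := Finset.sum_le_sum fun m _ => hint m
      _ = V * K * M ^ 2 := by simp; ring
  · intro ω w hw
    have hb : ∑ i, (mu i - (weighted P w).mulVec mu i) * (weighted P w).mulVec (fun j => e j ω) i
        = ∑ m, w m * ∑ i, (mu i - (weighted P w).mulVec mu i) *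
          (P m).mulVec (fun j => e j ω) i := by
      simp only [weighted_mulVec P w (fun j => e j ω), Finset.mul_sum]
      rw [Finset.sum_comm]
      exact Finset.sum_congr rfl fun k _ => Finset.sum_congr rfl fun i _ => by ring
    rw [hb]
    refine (sq_sum_mul_le _ (fun m _ => hw.1 m) hw.2.le _).trans ?_
    rw [Finset.mul_sum]
    refine Finset.sum_le_sum fun m _ => ?_
    have h1 := hG m ω w
    simp only [← bias_eq P hw mu] at h1
    have h2 := h1.trans (mul_le_mul_of_nonneg_right (bias_le_risk (s := s) he.var_nonneg) (h0 m ω))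
    have hle : w m ≤ 1 := by
      rw [← hw.2]; exact Finset.single_le_sum (fun k _ => hw.1 k) (Finset.mem_univ m)
    refine le_trans ?_ h2
    exact mul_le_of_le_one_left (sq_nonneg _) hle

/-- The off-diagonal part of the bilinear form `eᵀ P(w) e`. -/
lemma exists_bound_offDiag (hP : MatrixBounds P K ρ) (he : ErrorMoments ν e s V) (hV : 0 ≤ V)
    (mu : Fin n → ℝ) :
    ∃ G : Ω → ℝ, (∀ ω, 0 ≤ G ω) ∧ Integrable G ν ∧ ∫ ω, G ω ∂ν ≤ 4 * V * M ^ 2 ∧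
      ∀ ω, ∀ w ∈ stdSimplex ℝ (Fin M), 1 ≤ risk P mu s w →
        (∑ i, ∑ j, if i = j then 0 else weighted P w i j * (e i ω * e j ω)) ^ 2
          ≤ risk P mu s w * G ω := by
  set Z : Fin M → Ω → ℝ := fun m ω => ∑ i, ∑ j, if i = j then 0 else P m i j * (e i ω * e j ω)
    with hZ
  have hs := he.var_nonneg
  have hD : ∀ m, 0 < treeVar P s m + 1 := fun m => by linarith [treeVar_nonneg (P := P) hs m]
  have hZi : ∀ m, Integrable (fun ω => Z m ω ^ 2) ν := fun m => (he.integral_offDiag_sq_le _).1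
  have hZb : ∀ m, ∫ ω, Z m ω ^ 2 ∂ν ≤ 2 * (V * treeVar P s m) := by
    intro m
    refine (he.integral_offDiag_sq_le _).2.trans ?_
    refine mul_le_mul_of_nonneg_left ?_ two_pos.le
    rw [treeVar, Finset.mul_sum]
    refine Finset.sum_le_sum fun i _ => ?_
    rw [Finset.mul_sum]
    refine Finset.sum_le_sum fun j _ => ?_
    have := mul_le_mul_of_nonneg_right (he.var_le i) (mul_nonneg (sq_nonneg (P m i j)) (hs j))
    linarith
  -- Each form is normalised by the variance of its own tree. The added 1 keeps denominators
  -- positive and is absorbed by `1 ≤ risk`, which explains the factor 2; the factor M comes from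
  -- Cauchy–Schwarz over the trees.
  refine ⟨fun ω => 2 * M * ∑ m, Z m ω ^ 2 / (treeVar P s m + 1), fun ω => ?_, ?_, ?_, ?_⟩
  · exact mul_nonneg (by positivity) (Finset.sum_nonneg fun m _ =>
      div_nonneg (sq_nonneg _) (hD m).le)
  · exact (integrable_finsetSum _ fun m _ => (hZi m).div_const _).const_mul _
  · rw [integral_const_mul, integral_finsetSum _ fun m _ => (hZi m).div_const _]
    have : ∀ m, ∫ ω, Z m ω ^ 2 / (treeVar P s m + 1) ∂ν ≤ 2 * V := by
      intro m
      rw [integral_div, div_le_iff₀ (hD m)]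
      nlinarith [hZb m]
    calc 2 * (M : ℝ) * ∑ m, ∫ ω, Z m ω ^ 2 / (treeVar P s m + 1) ∂ν
        ≤ 2 * (M : ℝ) * ∑ _m : Fin M, 2 * V :=
          mul_le_mul_of_nonneg_left (Finset.sum_le_sum fun m _ => this m) (by positivity)
      _ = 4 * V * M ^ 2 := by simp; ring
  · intro ω w hw hR
    have hsum : (∑ i, ∑ j, if i = j then 0 else weighted P w i j * (e i ω * e j ω))
        = ∑ m, w m * Z m ω := by
      have hterm : ∀ i j, (if i = j then 0 else weighted P w i j * (e i ω * e j ω))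
          = ∑ m, w m * if i = j then 0 else P m i j * (e i ω * e j ω) := by
        intro i j
        split_ifs
        · simp
        · rw [weighted_apply, Finset.sum_mul]
          exact Finset.sum_congr rfl fun m _ => by ring
      simp only [hterm, hZ, Finset.mul_sum]
      rw [Finset.sum_congr rfl fun i _ => Finset.sum_comm, Finset.sum_comm]
    rw [hsum]
    have h1 := sq_sum_le_card_mul_sum_sq (s := Finset.univ) (f := fun m => w m * Z m ω)
    simp only [Finset.card_univ, Fintype.card_fin] at h1
    refine h1.trans ?_
    have h2 : ∀ m, (w m * Z m ω) ^ 2 ≤ 2 * risk P mu s w * (Z m ω ^ 2 / (treeVar P s m + 1)) := by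
      intro m
      rw [mul_div_assoc', le_div_iff₀ (hD m)]
      have ha := sq_mul_treeVar_le_risk (mu := mu) hP.nonneg hs hw.1 m
      have hle : w m ≤ 1 := by
        rw [← hw.2]; exact Finset.single_le_sum (fun k _ => hw.1 k) (Finset.mem_univ m)
      have hb : w m ^ 2 ≤ 1 := pow_le_one₀ (hw.1 m) hle
      have hc : w m ^ 2 * (treeVar P s m + 1) ≤ 2 * risk P mu s w := by linarith
      have := mul_le_mul_of_nonneg_right hc (sq_nonneg (Z m ω))
      linarith
    calc (M : ℝ) * ∑ m, (w m * Z m ω) ^ 2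
        ≤ M * ∑ m, 2 * risk P mu s w * (Z m ω ^ 2 / (treeVar P s m + 1)) :=
          mul_le_mul_of_nonneg_left (Finset.sum_le_sum fun m _ => h2 m) (by positivity)
      _ = _ := by rw [← Finset.mul_sum]; ring

/-- The squared errors, weighted by the squared diagonal of `P(w)`. -/
lemma exists_bound_diag (hP : MatrixBounds P K ρ) (he : ErrorMoments ν e s V) (hV : 0 ≤ V) :
    ∃ G : Ω → ℝ, (∀ ω, 0 ≤ G ω) ∧ Integrable G ν ∧ ∫ ω, G ω ∂ν ≤ V * K * M ∧
      ∀ ω, ∀ w ∈ stdSimplex ℝ (Fin M), ∑ i, weighted P w i i ^ 2 * e i ω ^ 2 ≤ G ω := by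
  have hi : ∀ m i, Integrable (fun ω => P m i i ^ 2 * e i ω ^ 2) ν := fun m i => by
    have := (he.integrable_two i i).const_mul (P m i i ^ 2)
    simpa only [← sq] using this
  refine ⟨fun ω => ∑ m, ∑ i, P m i i ^ 2 * e i ω ^ 2, fun ω => by positivity,
    integrable_finsetSum _ fun m _ => integrable_finsetSum _ fun i _ => hi m i, ?_, ?_⟩
  · rw [integral_finsetSum _ fun m _ => integrable_finsetSum _ fun i _ => hi m i]
    calc ∑ m, ∫ ω, ∑ i, P m i i ^ 2 * e i ω ^ 2 ∂ν ≤ ∑ _m : Fin M, V * K := by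
          refine Finset.sum_le_sum fun m _ => ?_
          rw [integral_finsetSum _ fun i _ => hi m i]
          refine le_trans ?_ (mul_le_mul_of_nonneg_left (hP.diag_sq m) hV)
          rw [Finset.mul_sum]
          refine Finset.sum_le_sum fun i _ => ?_
          rw [integral_const_mul]
          have h1 : ∫ ω, e i ω ^ 2 ∂ν = s i := by simpa only [← sq] using he.var i
          rw [h1, mul_comm]
          exact mul_le_mul_of_nonneg_right (he.var_le i) (sq_nonneg _)
      _ = V * K * M := by simp; ring
  · intro ω w hw
    change _ ≤ ∑ m, ∑ i, P m i i ^ 2 * e i ω ^ 2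
    rw [Finset.sum_comm (f := fun m i => P m i i ^ 2 * e i ω ^ 2)]
    refine Finset.sum_le_sum fun i _ => ?_
    rw [← Finset.sum_mul]
    refine mul_le_mul_of_nonneg_right ?_ (sq_nonneg _)
    rw [weighted_apply]
    refine (sq_sum_mul_le _ (fun m _ => hw.1 m) hw.2.le _).trans ?_
    refine Finset.sum_le_sum fun m _ => mul_le_of_le_one_left (sq_nonneg _) ?_
    rw [← hw.2]; exact Finset.single_le_sum (fun k _ => hw.1 k) (Finset.mem_univ m)

end Dominate

section Dominate

variable {Ω : Type*} [MeasurableSpace Ω] {ν : Measure Ω} [IsProbabilityMeasure ν]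
  {P : Fin M → Matrix (Fin n) (Fin n) ℝ} {mu s : Fin n → ℝ} {K ρ V : ℝ} {e : Fin n → Ω → ℝ}

/-- The entries of `Pₘᵀ Pₖ`. -/
def gram (P : Fin M → Matrix (Fin n) (Fin n) ℝ) (m k : Fin M) (i j : Fin n) : ℝ :=
  ∑ r, P m r i * P k r j

lemma gram_symm (m k : Fin M) (i j : Fin n) : gram P m k i j = gram P k m j i :=
  Finset.sum_congr rfl fun _ _ => mul_comm _ _

/-- Applying P_mᵀ enlarges the squared norm of each column of P_k by at most K. With the roles of
the two trees exchanged the bound holds for the other variance as well, hence for the smaller one.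
-/
lemma MatrixBounds.sum_gram_sq_le (hP : MatrixBounds P K ρ) (hs : ∀ i, 0 ≤ s i)
    (hsV : ∀ i, s i ≤ V) (hV : 0 ≤ V) (m k : Fin M) :
    ∑ i, ∑ j, gram P m k i j ^ 2 * (s i * s j) ≤ V * K * treeVar P s k := by
  calc ∑ i, ∑ j, gram P m k i j ^ 2 * (s i * s j)
      ≤ ∑ i, ∑ j, gram P m k i j ^ 2 * (V * s j) := by
        refine Finset.sum_le_sum fun i _ => Finset.sum_le_sum fun j _ => ?_
        exact mul_le_mul_of_nonneg_left (mul_le_mul_of_nonneg_right (hsV i) (hs j)) (sq_nonneg _)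
    _ = ∑ j, V * s j * ∑ i, gram P m k i j ^ 2 := by
        rw [Finset.sum_comm]
        refine Finset.sum_congr rfl fun j _ => ?_
        rw [Finset.mul_sum]
        exact Finset.sum_congr rfl fun i _ => by ring
    _ ≤ ∑ j, V * s j * (K * ∑ r, P k r j ^ 2) := by
        refine Finset.sum_le_sum fun j _ => ?_
        refine mul_le_mul_of_nonneg_left ?_ (mul_nonneg hV (hs j))
        refine le_trans (le_of_eq ?_) (hP.op m fun r => P k r j)
        refine Finset.sum_congr rfl fun i _ => ?_
        rw [gram]
        exact congrArg (· ^ 2) (Finset.sum_congr rfl fun r _ => mul_comm _ _)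
    _ = V * K * treeVar P s k := by
        rw [treeVar, Finset.sum_comm, Finset.mul_sum]
        refine Finset.sum_congr rfl fun j _ => ?_
        rw [← Finset.sum_mul]
        ring

/-- Cauchy–Schwarz bounds a diagonal entry by the product of two column norms; the field `col`
exists for this sum. -/
lemma MatrixBounds.sum_gram_diag_sq_le (hP : MatrixBounds P K ρ) (m k : Fin M) :
    ∑ i, gram P m k i i ^ 2 ≤ K := by
  have h : ∀ i, gram P m k i i ^ 2
      ≤ (1 / 2) * (∑ r, P m r i ^ 2) ^ 2 + (1 / 2) * (∑ r, P k r i ^ 2) ^ 2 := by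
    intro i
    have := Finset.sum_mul_sq_le_sq_mul_sq Finset.univ (fun r => P m r i) (fun r => P k r i)
    rw [gram]
    nlinarith [sq_nonneg ((∑ r, P m r i ^ 2) - ∑ r, P k r i ^ 2)]
  calc ∑ i, gram P m k i i ^ 2
      ≤ ∑ i, ((1 / 2) * (∑ r, P m r i ^ 2) ^ 2 + (1 / 2) * (∑ r, P k r i ^ 2) ^ 2) :=
        Finset.sum_le_sum fun i _ => h i
    _ ≤ K := by
        rw [Finset.sum_add_distrib, ← Finset.mul_sum, ← Finset.mul_sum]
        linarith [hP.col m, hP.col k]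

/-- The squared norm of the smoothed error, minus its mean. -/
lemma smooth_sq_sub (P : Fin M → Matrix (Fin n) (Fin n) ℝ) (s ε : Fin n → ℝ)
    (w : Fin M → ℝ) :
    ∑ i, (weighted P w).mulVec ε i ^ 2 - ∑ i, ∑ j, weighted P w i j ^ 2 * s j
      = ∑ a : Fin M × Fin M, w a.1 * w a.2 *
          (∑ i, ∑ j, if i = j then 0 else gram P a.1 a.2 i j * (ε i * ε j))
        + ∑ a : Fin M × Fin M, w a.1 * w a.2 *
          ∑ i, gram P a.1 a.2 i i * (ε i * ε i - s i) := by
  have hg : ∀ i j, ∑ r, weighted P w r i * weighted P w r j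
      = ∑ a : Fin M × Fin M, w a.1 * w a.2 * gram P a.1 a.2 i j := by
    intro i j
    rw [← Finset.univ_product_univ, Finset.sum_product]
    simp only [weighted_apply, Finset.sum_mul_sum]
    rw [Finset.sum_comm]
    refine Finset.sum_congr rfl fun m _ => ?_
    rw [Finset.sum_comm]
    refine Finset.sum_congr rfl fun k _ => ?_
    rw [gram, Finset.mul_sum]
    exact Finset.sum_congr rfl fun r _ => by ring
  have h1 : ∑ i, (weighted P w).mulVec ε i ^ 2
      = ∑ i, ∑ j, (∑ r, weighted P w r i * weighted P w r j) * (ε i * ε j) := by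
    simp only [Matrix.mulVec, dotProduct, sq, Finset.sum_mul_sum]
    simp only [Finset.sum_mul]
    rw [Finset.sum_comm]
    refine Finset.sum_congr rfl fun i _ => ?_
    rw [Finset.sum_comm]
    exact Finset.sum_congr rfl fun k _ => Finset.sum_congr rfl fun r _ => by ring
  have h2 : ∑ i, ∑ j, weighted P w i j ^ 2 * s j
      = ∑ j, (∑ r, weighted P w r j * weighted P w r j) * s j := by
    rw [Finset.sum_comm]
    refine Finset.sum_congr rfl fun i _ => ?_
    rw [Finset.sum_mul]
    exact Finset.sum_congr rfl fun r _ => by ring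
  have h3 : ∀ a : Fin M × Fin M,
      (∑ i, ∑ j, if i = j then 0 else gram P a.1 a.2 i j * (ε i * ε j))
        + ∑ i, gram P a.1 a.2 i i * (ε i * ε i - s i)
      = ∑ i, ∑ j, gram P a.1 a.2 i j * (ε i * ε j) - ∑ i, gram P a.1 a.2 i i * s i := by
    intro a
    rw [← Finset.sum_add_distrib, ← Finset.sum_sub_distrib]
    refine Finset.sum_congr rfl fun i _ => ?_
    have : ∀ j, gram P a.1 a.2 i j * (ε i * ε j)
        = (if i = j then 0 else gram P a.1 a.2 i j * (ε i * ε j))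
          + if i = j then gram P a.1 a.2 i j * (ε i * ε j) else 0 := by
      intro j; split_ifs <;> simp
    rw [Finset.sum_congr rfl fun j _ => this j, Finset.sum_add_distrib, Finset.sum_ite_eq,
      if_pos (Finset.mem_univ i)]
    ring
  rw [← Finset.sum_add_distrib]
  simp only [← mul_add, h3]
  rw [h1, h2]
  simp only [hg, mul_sub, Finset.sum_sub_distrib, Finset.mul_sum, Finset.sum_mul]
  congr 1
  · rw [Finset.sum_congr rfl fun i _ => Finset.sum_comm, Finset.sum_comm]
    exact Finset.sum_congr rfl fun a _ => Finset.sum_congr rfl fun i _ =>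
      Finset.sum_congr rfl fun j _ => by ring
  · rw [Finset.sum_comm]
    exact Finset.sum_congr rfl fun a _ => Finset.sum_congr rfl fun i _ => by ring

/-- The squared norm of the smoothed error concentrates around its mean. -/
lemma exists_bound_smooth_sq (hP : MatrixBounds P K ρ) (hK : 0 ≤ K)
    (he : ErrorMoments ν e s V) (hV : 0 ≤ V) (mu : Fin n → ℝ) :
    ∃ G : Ω → ℝ, (∀ ω, 0 ≤ G ω) ∧ Integrable G ν ∧ ∫ ω, G ω ∂ν ≤ 10 * (V * K) * M ^ 2 ∧
      ∀ ω, ∀ w ∈ stdSimplex ℝ (Fin M), 1 ≤ risk P mu s w →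
        (∑ i, (weighted P w).mulVec (fun j => e j ω) i ^ 2
          - ∑ i, ∑ j, weighted P w i j ^ 2 * s j) ^ 2 ≤ risk P mu s w * G ω := by
  set Z : Fin M × Fin M → Ω → ℝ := fun a ω =>
    ∑ i, ∑ j, if i = j then 0 else gram P a.1 a.2 i j * (e i ω * e j ω) with hZ
  set Y : Fin M × Fin M → Ω → ℝ := fun a ω =>
    ∑ i, gram P a.1 a.2 i i * (e i ω * e i ω - s i) with hY
  have hs := he.var_nonneg
  -- The minimum fits on both sides: it controls the second moment of the form through whichever
  -- Gram bound is better, and its product with the two weights is at most the risk.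
  set D : Fin M × Fin M → ℝ := fun a => min (treeVar P s a.1) (treeVar P s a.2) + 1 with hDdef
  have hD : ∀ a, 0 < D a := fun a => by
    have := le_min (treeVar_nonneg (P := P) hs a.1) (treeVar_nonneg (P := P) hs a.2)
    simp only [hDdef]; linarith
  have hZi : ∀ a, Integrable (fun ω => Z a ω ^ 2) ν := fun a => (he.integral_offDiag_sq_le _).1
  have hYi : ∀ a, Integrable (fun ω => Y a ω ^ 2) ν := fun a => (he.integral_diag_sq_le _).1
  have hVK := mul_nonneg hV hK
  have hZb : ∀ a, ∫ ω, Z a ω ^ 2 ∂ν ≤ 2 * (V * K * D a) := by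
    intro a
    refine (he.integral_offDiag_sq_le _).2.trans ?_
    refine mul_le_mul_of_nonneg_left ?_ two_pos.le
    refine le_trans ?_ (mul_le_mul_of_nonneg_left
      (show min (treeVar P s a.1) (treeVar P s a.2) ≤ D a by simp [hDdef]) hVK)
    rcases min_choice (treeVar P s a.1) (treeVar P s a.2) with h | h
    · rw [h]
      refine le_trans (le_of_eq ?_) (hP.sum_gram_sq_le hs he.var_le hV a.2 a.1)
      rw [Finset.sum_comm]
      refine Finset.sum_congr rfl fun i _ => Finset.sum_congr rfl fun j _ => ?_
      rw [gram_symm, mul_comm (s i)]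
    · rw [h]
      exact hP.sum_gram_sq_le hs he.var_le hV a.1 a.2
  have hYb : ∀ a, ∫ ω, Y a ω ^ 2 ∂ν ≤ V * K := fun a =>
    (he.integral_diag_sq_le _).2.trans
      (mul_le_mul_of_nonneg_left (hP.sum_gram_diag_sq_le a.1 a.2) hV)
  have hcard : (Fintype.card (Fin M × Fin M) : ℝ) = (M : ℝ) ^ 2 := by simp; ring
  have hint : ∀ a, Integrable (fun ω => 4 * (Z a ω ^ 2 / D a) + 2 * Y a ω ^ 2) ν := fun a =>
    (((hZi a).div_const _).const_mul _).add ((hYi a).const_mul _)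
  refine ⟨fun ω => ∑ a, (4 * (Z a ω ^ 2 / D a) + 2 * Y a ω ^ 2), fun ω => ?_, ?_, ?_, ?_⟩
  · exact Finset.sum_nonneg fun a _ => add_nonneg
      (mul_nonneg (by norm_num) (div_nonneg (sq_nonneg _) (hD a).le)) (by positivity)
  · exact integrable_finsetSum _ fun a _ => hint a
  · rw [integral_finsetSum _ fun a _ => hint a]
    calc _ ≤ ∑ _a : Fin M × Fin M, 10 * (V * K) := by
          refine Finset.sum_le_sum fun a _ => ?_
          rw [integral_add (((hZi a).div_const _).const_mul _) ((hYi a).const_mul _),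
            integral_const_mul, integral_const_mul, integral_div]
          have : (∫ ω, Z a ω ^ 2 ∂ν) / D a ≤ 2 * (V * K) := by
            rw [div_le_iff₀ (hD a)]
            linarith [hZb a]
          linarith [hYb a]
      _ = 10 * (V * K) * M ^ 2 := by
          rw [Finset.sum_const, Finset.card_univ, nsmul_eq_mul, hcard]; ring
  · intro ω w hw hR
    rw [smooth_sq_sub]
    have hw0 : ∀ a ∈ (Finset.univ : Finset (Fin M × Fin M)), 0 ≤ w a.1 * w a.2 :=
      fun a _ => mul_nonneg (hw.1 _) (hw.1 _)
    have hw1 : ∑ a : Fin M × Fin M, w a.1 * w a.2 ≤ 1 := by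
      rw [← Finset.univ_product_univ, Finset.sum_product]
      simp only [← Finset.mul_sum, hw.2, mul_one]
      exact le_refl _
    have hle : ∀ a : Fin M × Fin M, w a.1 * w a.2 ≤ 1 := fun a =>
      (Finset.single_le_sum (f := fun a : Fin M × Fin M => w a.1 * w a.2) hw0
        (Finset.mem_univ a)).trans hw1
    -- Products of weights again sum to one, so convexity applies over pairs and the M² pairs give
    -- the order M² with no further factor.
    have hA := sq_sum_mul_le Finset.univ hw0 hw1 fun a => Z a ω
    have hB := sq_sum_mul_le Finset.univ hw0 hw1 fun a => Y a ω
    have hA' : ∑ a : Fin M × Fin M, w a.1 * w a.2 * Z a ω ^ 2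
        ≤ ∑ a, risk P mu s w * (2 * (Z a ω ^ 2 / D a)) := by
      refine Finset.sum_le_sum fun a _ => ?_
      rw [mul_div_assoc', mul_div_assoc', le_div_iff₀ (hD a)]
      have ha := mul_min_treeVar_le_risk (mu := mu) hP.nonneg hs hw.1 a.1 a.2
      have hc : w a.1 * w a.2 * D a ≤ 2 * risk P mu s w := by
        simp only [hDdef]; linarith [hle a]
      have := mul_le_mul_of_nonneg_right hc (sq_nonneg (Z a ω))
      linarith
    have hB' : ∑ a : Fin M × Fin M, w a.1 * w a.2 * Y a ω ^ 2
        ≤ ∑ a, risk P mu s w * Y a ω ^ 2 :=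
      Finset.sum_le_sum fun a _ =>
        mul_le_mul_of_nonneg_right ((hle a).trans hR) (sq_nonneg _)
    have hfin : risk P mu s w * ∑ a, (4 * (Z a ω ^ 2 / D a) + 2 * Y a ω ^ 2)
        = 2 * (∑ a, risk P mu s w * (2 * (Z a ω ^ 2 / D a)))
          + 2 * ∑ a, risk P mu s w * Y a ω ^ 2 := by
      simp only [Finset.sum_add_distrib, ← Finset.mul_sum]; ring
    change (∑ a : Fin M × Fin M, w a.1 * w a.2 * Z a ω
      + ∑ a : Fin M × Fin M, w a.1 * w a.2 * Y a ω) ^ 2 ≤ _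
    rw [hfin]
    nlinarith [sq_nonneg ((∑ a : Fin M × Fin M, w a.1 * w a.2 * Z a ω)
      - ∑ a : Fin M × Fin M, w a.1 * w a.2 * Y a ω)]

end Dominate

/-! ### Decomposition of loss and criterion -/

section Decomposition

variable {P : Fin M → Matrix (Fin n) (Fin n) ℝ} {mu s : Fin n → ℝ} {K ρ : ℝ}

lemma sqLoss_eq (P : Fin M → Matrix (Fin n) (Fin n) ℝ) (mu ε : Fin n → ℝ) (w : Fin M → ℝ) :
    sqLoss P mu (mu + ε) w
      = ∑ i, (mu i - (weighted P w).mulVec mu i - (weighted P w).mulVec ε i) ^ 2 := by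
  unfold sqLoss
  refine Finset.sum_congr rfl fun i _ => ?_
  rw [Matrix.mulVec_add, Pi.add_apply]
  ring

lemma sqLoss_eq_risk_add (P : Fin M → Matrix (Fin n) (Fin n) ℝ) (mu s ε : Fin n → ℝ)
    (w : Fin M → ℝ) :
    sqLoss P mu (mu + ε) w = risk P mu s w
      - 2 * ∑ i, (mu i - (weighted P w).mulVec mu i) * (weighted P w).mulVec ε i
      + (∑ i, (weighted P w).mulVec ε i ^ 2 - ∑ i, ∑ j, weighted P w i j ^ 2 * s j) := by
  rw [sqLoss_eq, risk]
  have : ∀ i, (mu i - (weighted P w).mulVec mu i - (weighted P w).mulVec ε i) ^ 2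
      = (mu i - (weighted P w).mulVec mu i) ^ 2
        - 2 * ((mu i - (weighted P w).mulVec mu i) * (weighted P w).mulVec ε i)
        + (weighted P w).mulVec ε i ^ 2 := fun i => by ring
  simp only [this, Finset.sum_add_distrib, Finset.sum_sub_distrib, ← Finset.mul_sum]
  ring

/-- The reason for the penalty: its part 2∑P_ii ε_i² cancels the diagonal of −2εᵀP(w)ε exactly. What
is left beside the loss and the constant ∑ε_i² is a linear form, an off-diagonal form, and two terms
that are small because the diagonal of P(w) is. -/
lemma mallows_eq (P : Fin M → Matrix (Fin n) (Fin n) ℝ) (mu ε : Fin n → ℝ) (w : Fin M → ℝ) :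
    mallows P (mu + ε) w = ∑ i, ε i ^ 2 + sqLoss P mu (mu + ε) w
      + 2 * ∑ i, (mu i - (weighted P w).mulVec mu i) * ε i
      - 2 * (∑ i, ∑ j, if i = j then 0 else weighted P w i j * (ε i * ε j))
      + 4 * ∑ i, (weighted P w i i * ε i) *
          (mu i - (weighted P w).mulVec mu i - (weighted P w).mulVec ε i)
      + 2 * ∑ i, weighted P w i i *
          (mu i - (weighted P w).mulVec mu i - (weighted P w).mulVec ε i) ^ 2 := by
  have hoff : (∑ i, ∑ j, if i = j then 0 else weighted P w i j * (ε i * ε j))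
      = ∑ i, (ε i * (weighted P w).mulVec ε i - weighted P w i i * ε i ^ 2) := by
    refine Finset.sum_congr rfl fun i _ => ?_
    have : ∀ j, (if i = j then 0 else weighted P w i j * (ε i * ε j))
        = ε i * (weighted P w i j * ε j) - if i = j then weighted P w i j * (ε i * ε j) else 0 := by
      intro j; split_ifs <;> ring
    simp only [this, Finset.sum_sub_distrib, Finset.sum_ite_eq, Finset.mem_univ, if_true,
      Matrix.mulVec, dotProduct, Finset.mul_sum]
    ring
  rw [hoff, sqLoss_eq]
  unfold mallows residual
  simp only [Finset.mul_sum, ← Finset.sum_add_distrib, ← Finset.sum_sub_distrib]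
  refine Finset.sum_congr rfl fun i _ => ?_
  rw [Matrix.mulVec_add, Pi.add_apply, Pi.add_apply]
  ring

end Decomposition

set_option maxHeartbeats 400000 in
/-- All stochastic terms separating the criterion, the loss and the risk are controlled uniformly
over the simplex by one random variable whose mean is of order `M²`. -/
lemma exists_uniform_bound {Ω : Type*} [MeasurableSpace Ω] {ν : Measure Ω} [IsProbabilityMeasure ν]
    {P : Fin M → Matrix (Fin n) (Fin n) ℝ} {s : Fin n → ℝ} {K ρ V : ℝ} {e : Fin n → Ω → ℝ}
    (hP : MatrixBounds P K ρ) (hK : 0 ≤ K) (hρ : 0 ≤ ρ) (he : ErrorMoments ν e s V) (hV : 0 ≤ V)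
    (hM : 1 ≤ M) (mu : Fin n → ℝ) :
    ∃ G : Ω → ℝ, (∀ ω, 0 ≤ G ω) ∧ Integrable G ν ∧
      ∫ ω, G ω ∂ν ≤ (5 * V + 12 * (V * K)) * M ^ 2 ∧
      ∀ ω, ∀ w ∈ stdSimplex ℝ (Fin M), 1 ≤ risk P mu s w →
        ∀ δ : ℝ, 0 ≤ δ → δ ≤ 1 / 3 → G ω ≤ δ ^ 2 * risk P mu s w →
        |sqLoss P mu (mu + fun i => e i ω) w - risk P mu s w| ≤ 3 * δ * risk P mu s w ∧
        |mallows P (mu + fun i => e i ω) w - ∑ i, e i ω ^ 2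
            - sqLoss P mu (mu + fun i => e i ω) w|
          ≤ (12 * δ + 4 * ρ) * risk P mu s w := by
  obtain ⟨G₁, p₁, i₁, b₁, h₁⟩ := exists_bound_error_bias he hV P mu
  obtain ⟨G₂, p₂, i₂, b₂, h₂⟩ := exists_bound_smooth_bias hP hK he hV mu
  obtain ⟨G₃, p₃, i₃, b₃, h₃⟩ := exists_bound_smooth_sq hP hK he hV mu
  obtain ⟨G₄, p₄, i₄, b₄, h₄⟩ := exists_bound_offDiag hP he hV mu
  obtain ⟨G₅, p₅, i₅, b₅, h₅⟩ := exists_bound_diag hP he hV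
  have hMM : (M : ℝ) ≤ (M : ℝ) ^ 2 := by
    have : (1 : ℝ) ≤ M := by exact_mod_cast hM
    nlinarith
  have hVK := mul_nonneg hV hK
  refine ⟨fun ω => G₁ ω + (G₂ ω + (G₃ ω + (G₄ ω + G₅ ω))), fun ω => ?_, ?_, ?_, ?_⟩
  · have := p₁ ω; have := p₂ ω; have := p₃ ω; have := p₄ ω; have := p₅ ω
    positivity
  · exact i₁.add (i₂.add (i₃.add (i₄.add i₅)))
  · have j₄ : Integrable (fun ω => G₄ ω + G₅ ω) ν := i₄.add i₅
    have j₃ : Integrable (fun ω => G₃ ω + (G₄ ω + G₅ ω)) ν := i₃.add j₄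
    have j₂ : Integrable (fun ω => G₂ ω + (G₃ ω + (G₄ ω + G₅ ω))) ν := i₂.add j₃
    rw [integral_add i₁ j₂, integral_add i₂ j₃, integral_add i₃ j₄, integral_add i₄ i₅]
    have e₁ := mul_le_mul_of_nonneg_left hMM hV
    have e₅ := mul_le_mul_of_nonneg_left hMM hVK
    linarith
  · intro ω w hw hR δ hδ hδ3 hG
    have q₁ := p₁ ω
    have q₂ := p₂ ω
    have q₃ := p₃ ω
    have q₄ := p₄ ω
    have q₅ := p₅ ω
    set R := risk P mu s w with hRdef
    have hR0 : 0 ≤ R := zero_le_one.trans hR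
    -- The common mechanism: each dominating variable is a nonnegative summand of G, hence itself at
    -- most δ²R.
    have habs : ∀ T g : ℝ, T ^ 2 ≤ R * g → g ≤ δ ^ 2 * R → |T| ≤ δ * R := by
      intro T g h1 h2
      refine abs_le_of_sq_le_sq ?_ (mul_nonneg hδ hR0)
      nlinarith [mul_le_mul_of_nonneg_left h2 hR0]
    simp only at hG
    have t₁ := habs _ _ (h₁ ω w hw) (by linarith)
    have t₂ := habs _ _ (h₂ ω w hw) (by linarith)
    have t₃ := habs _ _ (h₃ ω w hw hR) (by linarith)
    have t₄ := habs _ _ (h₄ ω w hw hR) (by linarith)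
    have hL := sqLoss_eq_risk_add P mu s (fun i => e i ω) w
    have hC := mallows_eq P mu (fun i => e i ω) w
    have hLd := sqLoss_eq P mu (fun i => e i ω) w
    set L := sqLoss P mu (mu + fun i => e i ω) w with hLdef
    rw [abs_le] at t₁ t₂ t₃ t₄
    have hLR : |L - R| ≤ 3 * δ * R := by
      rw [abs_le]; constructor <;> linarith
    refine ⟨hLR, ?_⟩
    have hL2 : L ≤ 2 * R := by
      have h := (abs_le.1 hLR).2
      have h' := mul_le_mul_of_nonneg_right hδ3 hR0
      linarith
    have hwd : ∀ i, 0 ≤ weighted P w i i ∧ weighted P w i i ≤ ρ := by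
      intro i
      rw [weighted_apply]
      refine ⟨Finset.sum_nonneg fun m _ => mul_nonneg (hw.1 m) (hP.nonneg m i i), ?_⟩
      calc ∑ m, w m * P m i i ≤ ∑ m, w m * ρ := Finset.sum_le_sum fun m _ =>
            mul_le_mul_of_nonneg_left (hP.diag_le m i) (hw.1 m)
        _ = ρ := by rw [← Finset.sum_mul, hw.2, one_mul]
    -- Cauchy–Schwarz separates the diagonal-weighted errors, at most δ²R, from the residual, whose
    -- squared norm is the loss and so at most 2R.
    have t₅ : |∑ i, (weighted P w i i * e i ω) * (mu i - (weighted P w).mulVec mu i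
        - (weighted P w).mulVec (fun j => e j ω) i)| ≤ 2 * δ * R := by
      refine abs_le_of_sq_le_sq ?_ (by positivity)
      refine (Finset.sum_mul_sq_le_sq_mul_sq _ _ _).trans ?_
      rw [← hLd]
      simp only [mul_pow]
      have a1 := (h₅ ω w hw).trans (show G₅ ω ≤ δ ^ 2 * R by linarith)
      have hL0 : 0 ≤ L := by rw [hLd]; exact Finset.sum_nonneg fun i _ => sq_nonneg _
      calc (∑ i, weighted P w i i ^ 2 * e i ω ^ 2) * L
          ≤ (δ ^ 2 * R) * (2 * R) := mul_le_mul a1 hL2 hL0 (by positivity)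
        _ ≤ 2 ^ 2 * δ ^ 2 * R ^ 2 := by nlinarith [mul_nonneg (sq_nonneg δ) (sq_nonneg R)]
    have t₆ : 0 ≤ ∑ i, weighted P w i i * (mu i - (weighted P w).mulVec mu i
        - (weighted P w).mulVec (fun j => e j ω) i) ^ 2 :=
      Finset.sum_nonneg fun i _ => mul_nonneg (hwd i).1 (sq_nonneg _)
    have t₇ : ∑ i, weighted P w i i * (mu i - (weighted P w).mulVec mu i
        - (weighted P w).mulVec (fun j => e j ω) i) ^ 2 ≤ 2 * ρ * R := by
      calc _ ≤ ∑ i, ρ * (mu i - (weighted P w).mulVec mu i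
            - (weighted P w).mulVec (fun j => e j ω) i) ^ 2 :=
            Finset.sum_le_sum fun i _ => mul_le_mul_of_nonneg_right (hwd i).2 (sq_nonneg _)
        _ = ρ * L := by rw [← Finset.mul_sum, ← hLd]
        _ ≤ 2 * ρ * R := (mul_le_mul_of_nonneg_left hL2 hρ).trans_eq (by ring)
    rw [abs_le] at t₅ ⊢
    have hρR := mul_nonneg hρ hR0
    -- The coefficients 2, 2 and 4 of the terms in `t₁`, `t₄`, `t₅` give (2 + 2 + 8)δ; twice the
    -- bound in `t₇` gives 4ρ.
    constructor <;> linarith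

/-! ### Deterministic selection argument -/

/-- A minimiser of a criterion that is uniformly close to the loss up to a constant, the loss being
uniformly close to the risk, nearly minimises the loss and the risk. -/
lemma selection_ratio {ι : Type*} [Nonempty ι] {L R C : ι → ℝ} {c η : ℝ} {a : ι}
    (hη : 0 ≤ η) (hη8 : η ≤ 1 / 8) (hR : ∀ w, 0 ≤ R w) (hξ : 0 < ⨅ w, R w)
    (hLR : ∀ w, |L w - R w| ≤ η * R w) (hCL : ∀ w, |C w - c - L w| ≤ η * R w)
    (hmin : ∀ w, C a ≤ C w) :
    |L a / (⨅ w, L w) - 1| ≤ 16 * η ∧ |L a / (⨅ w, R w) - 1| ≤ 16 * η ∧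
      |R a / (⨅ w, R w) - 1| ≤ 16 * η := by
  have hbR : BddBelow (Set.range R) := ⟨0, by rintro _ ⟨w, rfl⟩; exact hR w⟩
  have hL0 : ∀ w, (1 - η) * R w ≤ L w := fun w => by
    have := (abs_le.1 (hLR w)).1; linarith
  have hL1 : ∀ w, L w ≤ (1 + η) * R w := fun w => by
    have := (abs_le.1 (hLR w)).2; linarith
  have hLnn : ∀ w, 0 ≤ L w := fun w => le_trans (mul_nonneg (by linarith) (hR w)) (hL0 w)
  have hbL : BddBelow (Set.range L) := ⟨0, by rintro _ ⟨w, rfl⟩; exact hLnn w⟩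
  have hRL : ∀ w, R w ≤ 2 * L w := fun w => by nlinarith [hL0 w, hR w]
  have hxi : ∀ w, (⨅ w, R w) ≤ R w := fun w => ciInf_le hbR w
  have hmain : ∀ w, L a ≤ (1 + 6 * η) * L w := by
    intro w
    have h1 := (abs_le.1 (hCL a)).1
    have h2 := (abs_le.1 (hCL w)).2
    have h3 := hmin w
    have h4 : L a ≤ L w + η * R w + η * R a := by linarith
    -- Errors relative to the risk become errors relative to the loss through R ≤ 2L. The quotient
    -- (1 + 2η)/(1 − 2η) is at most 1 + 6η since η ≤ 1/8.
    have h5 : (1 - 2 * η) * L a ≤ (1 + 2 * η) * L w := by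
      nlinarith [mul_le_mul_of_nonneg_left (hRL a) hη, mul_le_mul_of_nonneg_left (hRL w) hη]
    have h6 : (1 + 2 * η) * L w ≤ (1 - 2 * η) * ((1 + 6 * η) * L w) := by
      have : (1 + 2 * η) ≤ (1 - 2 * η) * (1 + 6 * η) := by nlinarith
      nlinarith [mul_le_mul_of_nonneg_right this (hLnn w)]
    exact le_of_mul_le_mul_left (h5.trans h6) (by linarith)
  set ξ := ⨅ w, R w with hξdef
  have hLξ : (1 - η) * ξ ≤ ⨅ w, L w := le_ciInf fun w =>
    le_trans (mul_le_mul_of_nonneg_left (hxi w) (by linarith)) (hL0 w)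
  have hLpos : 0 < ⨅ w, L w := lt_of_lt_of_le (mul_pos (by linarith) hξ) hLξ
  have hLa_inf : (⨅ w, L w) ≤ L a := ciInf_le hbL a
  have hLa : L a ≤ (1 + 6 * η) * ⨅ w, L w := by
    rw [Real.mul_iInf_of_nonneg (by linarith)]
    exact le_ciInf hmain
  have hLaR : L a ≤ (1 + 8 * η) * ξ := by
    rw [hξdef, Real.mul_iInf_of_nonneg (by linarith)]
    refine le_ciInf fun w => (hmain w).trans ?_
    have h1 := mul_le_mul_of_nonneg_left (hL1 w) (show 0 ≤ 1 + 6 * η by linarith)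
    have : (1 + 6 * η) * (1 + η) ≤ 1 + 8 * η := by nlinarith
    nlinarith [mul_le_mul_of_nonneg_right this (hR w)]
  have hLaξ : (1 - η) * ξ ≤ L a := hLξ.trans hLa_inf
  have hRa : R a ≤ (1 + 16 * η) * ξ := by
    have h1 : (1 - η) * R a ≤ (1 + 8 * η) * ξ := (hL0 a).trans hLaR
    have h2 : (1 + 8 * η) ≤ (1 - η) * (1 + 16 * η) := by nlinarith
    have h3 := mul_le_mul_of_nonneg_right h2 hξ.le
    rw [mul_assoc] at h3
    exact le_of_mul_le_mul_left (h1.trans h3) (by linarith)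
  have key : ∀ x y : ℝ, 0 < y → (1 - 16 * η) * y ≤ x → x ≤ (1 + 16 * η) * y →
      |x / y - 1| ≤ 16 * η := by
    intro x y hy h1 h2
    rw [abs_le]
    constructor
    · have := (le_div_iff₀ hy).2 h1; linarith
    · have := (div_le_iff₀ hy).2 h2; linarith
  refine ⟨key _ _ hLpos ?_ ?_, key _ _ hξ ?_ ?_, key _ _ hξ ?_ ?_⟩
  · nlinarith
  · nlinarith
  · nlinarith
  · nlinarith
  · have := hxi a; nlinarith
  · exact hRa

/-! ### From regular leaves to matrix bounds -/

/-- The leaves of a tree that hold observations are large, and the bootstrap sample is spread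
regularly over each of them. -/
structure LeafRegular (T : SplitTree p) (X : Fin n → Fin p → ℝ) (b : Fin n → Fin n) (K : ℝ) :
    Prop where
  size : ∀ i, √(n : ℝ) ≤ K * leafSize T X b (T.leafOf (X i))
  card : ∀ i, ((Finset.univ.filter fun j => T.leafOf (X j) = T.leafOf (X i)).card : ℝ)
    ≤ K * leafSize T X b (T.leafOf (X i))
  pow : ∀ i, ∑ j ∈ Finset.univ.filter (fun j => T.leafOf (X j) = T.leafOf (X i)),
    (bootCount b j : ℝ) ^ 4 ≤ K * leafSize T X b (T.leafOf (X i))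

lemma natCast_sq_le_pow_four (k : ℕ) : (k : ℝ) ^ 2 ≤ (k : ℝ) ^ 4 := by
  rcases Nat.eq_zero_or_pos k with rfl | hk
  · simp
  · exact pow_le_pow_right₀ (by exact_mod_cast hk) (by norm_num)

namespace LeafRegular

variable {T : SplitTree p} {X : Fin n → Fin p → ℝ} {b : Fin n → Fin n} {K : ℝ}

lemma leafSize_pos (h : LeafRegular T X b K) (hn : 0 < n) (hK : 0 < K) (i : Fin n) :
    (0 : ℝ) < leafSize T X b (T.leafOf (X i)) := by
  have h1 : 0 < √(n : ℝ) := Real.sqrt_pos.2 (by exact_mod_cast hn)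
  have h2 := h.size i
  by_contra hc
  have : (leafSize T X b (T.leafOf (X i)) : ℝ) ≤ 0 := not_lt.1 hc
  nlinarith

/-- The occupied leaves partition the observations and, every draw being an observation, also the
draws; so their sizes add up to n. -/
lemma sum_pow_le (h : LeafRegular T X b K) :
    ∑ j, (bootCount b j : ℝ) ^ 4 ≤ K * n := by
  classical
  set I : Finset (List Bool) := Finset.univ.image fun i => T.leafOf (X i) with hI
  have h1 : ∑ j, (bootCount b j : ℝ) ^ 4
      = ∑ l ∈ I, ∑ j ∈ Finset.univ.filter (fun j => T.leafOf (X j) = l),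
        (bootCount b j : ℝ) ^ 4 :=
    (Finset.sum_fiberwise_of_maps_to (fun i _ => Finset.mem_image_of_mem _ (Finset.mem_univ i))
      _).symm
  have h2 : (n : ℝ) = ∑ l ∈ I, (leafSize T X b l : ℝ) := by
    have := Finset.card_eq_sum_card_fiberwise (s := (Finset.univ : Finset (Fin n))) (t := I)
      (f := fun k => T.leafOf (X (b k)))
      (fun i _ => Finset.mem_coe.2 (Finset.mem_image_of_mem _ (Finset.mem_univ (b i))))
    rw [Finset.card_univ, Fintype.card_fin] at this
    rw [← Nat.cast_sum]
    exact congrArg Nat.cast this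
  rw [h1, h2, Finset.mul_sum]
  refine Finset.sum_le_sum fun l hl => ?_
  obtain ⟨i, -, rfl⟩ := Finset.mem_image.1 hl
  exact h.pow i

/-- One count is at most the fourth root of the sum of fourth powers, so of order n^{1/4}. Against
leaves of order at least √n this makes the diagonal of a tree matrix O(n^{-1/4}). -/
lemma bootCount_le (h : LeafRegular T X b K) (hK : 1 ≤ K) (i : Fin n) :
    (bootCount b i : ℝ) ≤ K * √√(n : ℝ) := by
  have h1 : (bootCount b i : ℝ) ^ 4 ≤ K * n :=
    (Finset.single_le_sum (f := fun j => (bootCount b j : ℝ) ^ 4) (fun j _ => by positivity)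
      (Finset.mem_univ i)).trans h.sum_pow_le
  have h2 : (√√(n : ℝ)) ^ 4 = n := by
    rw [show (4 : ℕ) = 2 * 2 from rfl, pow_mul, Real.sq_sqrt (Real.sqrt_nonneg _),
      Real.sq_sqrt (Nat.cast_nonneg _)]
  have h3 : (bootCount b i : ℝ) ^ 4 ≤ (K * √√(n : ℝ)) ^ 4 := by
    rw [mul_pow, h2]
    refine h1.trans (mul_le_mul_of_nonneg_right ?_ (Nat.cast_nonneg _))
    exact le_self_pow₀ hK (by norm_num)
  exact le_of_pow_le_pow_left₀ (by norm_num) (by positivity) h3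

lemma treeMatrix_eq (T : SplitTree p) (X : Fin n → Fin p → ℝ) (b : Fin n → Fin n) (i j : Fin n) :
    treeMatrix T X b i j = if T.leafOf (X i) = T.leafOf (X j) then
      (bootCount b j : ℝ) / (leafSize T X b (T.leafOf (X j)) : ℝ) else 0 := by
  rw [treeMatrix, Matrix.of_apply]
  split_ifs with h1 h2 h2
  · rw [h1]
  · exact absurd h1.symm h2
  · exact absurd h2.symm h1
  · rfl

lemma card_mul_le (h : LeafRegular T X b K) (hn : 0 < n) (hK : 0 < K) (j : Fin n) (x : ℝ)
    (hx : 0 ≤ x) :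
    ((Finset.univ.filter fun i => T.leafOf (X i) = T.leafOf (X j)).card : ℝ)
        * (x / (leafSize T X b (T.leafOf (X j)) : ℝ) ^ 2)
      ≤ K * (x / leafSize T X b (T.leafOf (X j))) := by
  have hq := h.leafSize_pos hn hK j
  have := mul_le_mul_of_nonneg_right (h.card j) (div_nonneg hx
    (sq_nonneg (leafSize T X b (T.leafOf (X j)) : ℝ)))
  refine this.trans (le_of_eq ?_)
  field_simp

lemma sum_treeMatrix_sq_le (h : LeafRegular T X b K) (hn : 0 < n) (hK : 0 < K) (j : Fin n) :
    ∑ i, treeMatrix T X b i j ^ 2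
      ≤ K * ((bootCount b j : ℝ) ^ 2 / leafSize T X b (T.leafOf (X j))) := by
  refine le_trans (le_of_eq ?_) (h.card_mul_le hn hK j _ (sq_nonneg _))
  simp only [treeMatrix_eq, ite_pow, div_pow]
  rw [← Finset.sum_filter_add_sum_filter_not Finset.univ
    (fun i => T.leafOf (X i) = T.leafOf (X j))]
  rw [Finset.sum_congr rfl fun i hi => if_pos (Finset.mem_filter.1 hi).2,
    Finset.sum_congr (s₁ := Finset.univ.filter fun i => ¬ T.leafOf (X i) = T.leafOf (X j)) rfl
      fun i hi => if_neg (Finset.mem_filter.1 hi).2]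
  simp

/-- The matrix is block diagonal over leaves. Cauchy–Schwarz inside a leaf costs the number of its
observations, at most K n_l; summing h_j² over the leaf costs another K n_l, and the denominators
n_l² cancel both. -/
lemma matrix_op (h : LeafRegular T X b K) (hn : 0 < n) (hK : 0 < K) (u : Fin n → ℝ) :
    ∑ j, (∑ i, u i * treeMatrix T X b i j) ^ 2 ≤ K ^ 2 * ∑ i, u i ^ 2 := by
  have hq := h.leafSize_pos hn hK
  have h1 : ∀ j, (∑ i, u i * treeMatrix T X b i j) ^ 2
      ≤ ∑ i, if T.leafOf (X j) = T.leafOf (X i) then u i ^ 2 *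
        (K * ((bootCount b j : ℝ) ^ 2 / leafSize T X b (T.leafOf (X i)))) else 0 := by
    intro j
    have e1 : ∑ i, u i * treeMatrix T X b i j
        = ∑ i ∈ Finset.univ.filter (fun i => T.leafOf (X i) = T.leafOf (X j)),
          u i * ((bootCount b j : ℝ) / leafSize T X b (T.leafOf (X j))) := by
      rw [Finset.sum_filter]
      refine Finset.sum_congr rfl fun i _ => ?_
      rw [treeMatrix_eq, mul_ite, mul_zero]
    have e2 : (∑ i, if T.leafOf (X j) = T.leafOf (X i) then u i ^ 2 *
        (K * ((bootCount b j : ℝ) ^ 2 / leafSize T X b (T.leafOf (X i)))) else 0)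
        = ∑ i ∈ Finset.univ.filter (fun i => T.leafOf (X i) = T.leafOf (X j)),
          u i ^ 2 * (K * ((bootCount b j : ℝ) ^ 2 / leafSize T X b (T.leafOf (X j)))) := by
      rw [Finset.sum_filter]
      refine Finset.sum_congr rfl fun i _ => ?_
      by_cases hij : T.leafOf (X i) = T.leafOf (X j)
      · simp [hij]
      · rw [if_neg hij, if_neg (Ne.symm hij)]
    rw [e1, e2, ← Finset.sum_mul, ← Finset.sum_mul, mul_pow, div_pow]
    have c1 := sq_sum_le_card_mul_sum_sq
      (s := Finset.univ.filter (fun i => T.leafOf (X i) = T.leafOf (X j))) (f := u)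
    have c2 := h.card_mul_le hn hK j ((bootCount b j : ℝ) ^ 2) (sq_nonneg _)
    have c3 : 0 ≤ ∑ i ∈ Finset.univ.filter (fun i => T.leafOf (X i) = T.leafOf (X j)), u i ^ 2 :=
      Finset.sum_nonneg fun i _ => sq_nonneg _
    calc _ ≤ _ := mul_le_mul_of_nonneg_right c1 (by positivity)
      _ = (∑ i ∈ Finset.univ.filter (fun i => T.leafOf (X i) = T.leafOf (X j)), u i ^ 2) *
          (((Finset.univ.filter fun i => T.leafOf (X i) = T.leafOf (X j)).card : ℝ)
        * ((bootCount b j : ℝ) ^ 2 / (leafSize T X b (T.leafOf (X j)) : ℝ) ^ 2)) := by ring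
      _ ≤ _ := mul_le_mul_of_nonneg_left c2 c3
  refine (Finset.sum_le_sum fun j _ => h1 j).trans ?_
  rw [Finset.sum_comm, Finset.mul_sum]
  refine Finset.sum_le_sum fun i _ => ?_
  rw [← Finset.sum_filter, ← Finset.mul_sum, ← Finset.mul_sum, ← Finset.sum_div, mul_comm]
  refine mul_le_mul_of_nonneg_right ?_ (sq_nonneg _)
  rw [sq]
  refine mul_le_mul_of_nonneg_left ?_ hK.le
  rw [div_le_iff₀ (hq i)]
  exact (Finset.sum_le_sum fun j _ => natCast_sq_le_pow_four _).trans (h.pow i)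

lemma inv_leafSize_le (h : LeafRegular T X b K) (hn : 0 < n) (hK : 0 < K) (i : Fin n) :
    1 / (leafSize T X b (T.leafOf (X i)) : ℝ) ≤ K / √(n : ℝ) := by
  have h1 : 0 < √(n : ℝ) := Real.sqrt_pos.2 (by exact_mod_cast hn)
  rw [div_le_div_iff₀ (h.leafSize_pos hn hK i) h1, one_mul]
  exact h.size i

lemma div_leafSize_le (h : LeafRegular T X b K) (hn : 0 < n) (hK : 0 < K) (i : Fin n) {x : ℝ}
    (hx : 0 ≤ x) : x / (leafSize T X b (T.leafOf (X i)) : ℝ) ≤ x * (K / √(n : ℝ)) := by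
  rw [div_eq_mul_one_div]
  exact mul_le_mul_of_nonneg_left (h.inv_leafSize_le hn hK i) hx

lemma treeMatrix_diag (T : SplitTree p) (X : Fin n → Fin p → ℝ) (b : Fin n → Fin n) (i : Fin n) :
    treeMatrix T X b i i = (bootCount b i : ℝ) / leafSize T X b (T.leafOf (X i)) := by
  rw [treeMatrix_eq, if_pos rfl]

lemma treeMatrix_nonneg (T : SplitTree p) (X : Fin n → Fin p → ℝ) (b : Fin n → Fin n)
    (i j : Fin n) : 0 ≤ treeMatrix T X b i j := by
  rw [treeMatrix_eq]; split_ifs <;> positivity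

lemma sum_diag_sq_le (h : LeafRegular T X b K) (hn : 0 < n) (hK : 0 < K) :
    ∑ i, treeMatrix T X b i i ^ 2 ≤ K ^ 3 := by
  have hn' : (0 : ℝ) < n := by exact_mod_cast hn
  calc ∑ i, treeMatrix T X b i i ^ 2
      ≤ ∑ i, (bootCount b i : ℝ) ^ 4 * (K ^ 2 / n) := by
        refine Finset.sum_le_sum fun i _ => ?_
        rw [treeMatrix_diag]
        have h1 := h.div_leafSize_le hn hK i (Nat.cast_nonneg (α := ℝ) (bootCount b i))
        have h2 := pow_le_pow_left₀ (by positivity) h1 2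
        rw [mul_pow, div_pow K, Real.sq_sqrt hn'.le] at h2
        exact h2.trans (mul_le_mul_of_nonneg_right (natCast_sq_le_pow_four _) (by positivity))
    _ ≤ K * n * (K ^ 2 / n) := by
        rw [← Finset.sum_mul]
        exact mul_le_mul_of_nonneg_right h.sum_pow_le (by positivity)
    _ = K ^ 3 := by field_simp

/-- A squared column norm is of order h_j²/n_l, and its square at most of order h_j⁴/n because n_l
has at least order √n. This is where fourth powers of counts are needed. -/
lemma sum_col_le (h : LeafRegular T X b K) (hn : 0 < n) (hK : 0 < K) :
    ∑ j, (∑ i, treeMatrix T X b i j ^ 2) ^ 2 ≤ K ^ 5 := by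
  have hn' : (0 : ℝ) < n := by exact_mod_cast hn
  calc ∑ j, (∑ i, treeMatrix T X b i j ^ 2) ^ 2
      ≤ ∑ j, (bootCount b j : ℝ) ^ 4 * (K ^ 4 / n) := by
        refine Finset.sum_le_sum fun j _ => ?_
        have h1 := h.sum_treeMatrix_sq_le hn hK j
        have h2 := mul_le_mul_of_nonneg_left
          (h.div_leafSize_le hn hK j (sq_nonneg (bootCount b j : ℝ))) hK.le
        have h3 := pow_le_pow_left₀ (Finset.sum_nonneg fun i _ => sq_nonneg _) (h1.trans h2) 2
        refine h3.trans (le_of_eq ?_)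
        rw [mul_pow, mul_pow, div_pow K, Real.sq_sqrt hn'.le]
        ring
    _ ≤ K * n * (K ^ 4 / n) := by
        rw [← Finset.sum_mul]
        exact mul_le_mul_of_nonneg_right h.sum_pow_le (by positivity)
    _ = K ^ 5 := by field_simp

lemma diag_le (h : LeafRegular T X b K) (hn : 0 < n) (hK : 1 ≤ K) (i : Fin n) :
    treeMatrix T X b i i ≤ K ^ 2 / √√(n : ℝ) := by
  have hK0 : 0 < K := by linarith
  have hn' : (0 : ℝ) < n := by exact_mod_cast hn
  have hr : 0 < √√(n : ℝ) := Real.sqrt_pos.2 (Real.sqrt_pos.2 hn')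
  rw [treeMatrix_diag]
  refine (h.div_leafSize_le hn hK0 i (Nat.cast_nonneg _)).trans ?_
  refine (mul_le_mul_of_nonneg_right (h.bootCount_le hK i) (by positivity)).trans (le_of_eq ?_)
  have : √(n : ℝ) = √√(n : ℝ) * √√(n : ℝ) := (Real.mul_self_sqrt (Real.sqrt_nonneg _)).symm
  rw [this, Real.sqrt_mul_self (Real.sqrt_nonneg _)]
  field_simp

end LeafRegular

lemma matrixBounds_of_leafRegular {T : Fin M → SplitTree p} {X : Fin n → Fin p → ℝ}
    {b : Fin M → Fin n → Fin n} {K : ℝ} (hn : 0 < n) (hK : 1 ≤ K)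
    (h : ∀ m, LeafRegular (T m) X (b m) K) :
    MatrixBounds (fun m => treeMatrix (T m) X (b m)) (K ^ 5) (K ^ 2 / √√(n : ℝ)) := by
  have hK0 : 0 < K := by linarith
  refine ⟨fun m => LeafRegular.treeMatrix_nonneg _ _ _, fun m u => ?_, fun m => ?_, fun m =>
    (h m).diag_le hn hK, fun m => (h m).sum_col_le hn hK0⟩
  · refine ((h m).matrix_op hn hK0 u).trans (mul_le_mul_of_nonneg_right ?_ (by positivity))
    exact pow_le_pow_right₀ hK (by norm_num)
  · exact ((h m).sum_diag_sq_le hn hK0).trans (pow_le_pow_right₀ hK (by norm_num))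

/-! ### Tails of bootstrap counts by Poisson comparison -/

section Poissonization

open Polynomial

/-- The Leibniz rule read combinatorially: each of the N derivatives chooses a factor to hit, the
choices form a word b, and factor j is differentiated as often as j occurs in b. The induction peels
off the first letter. -/
lemma sum_prod_iterate_derivative {J : Type*} [Fintype J] [DecidableEq J] (N : ℕ) (G : J → ℝ[X]) :
    ∑ b : Fin N → J, ∏ j, (derivative^[(Finset.univ.filter fun k => b k = j).card] (G j)).eval 0
      = (derivative^[N] (∏ j, G j)).eval 0 := by
  induction N generalizing G with
  | zero => simp [eval_prod]
  | succ N ih =>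
    rw [← (Fin.consEquiv fun _ => J).sum_comp, Fintype.sum_prod_type, Function.iterate_succ_apply,
      derivative_prod_finset, iterate_derivative_sum, eval_finsetSum]
    refine Finset.sum_congr rfl fun j₀ _ => ?_
    have hup : (∏ b ∈ Finset.univ.erase j₀, G b) * derivative (G j₀)
        = ∏ j, Function.update G j₀ (derivative (G j₀)) j := by
      rw [← Finset.mul_prod_erase _ _ (Finset.mem_univ j₀), Function.update_self, mul_comm]
      congr 1
      exact Finset.prod_congr rfl fun j hj => by
        rw [Function.update_of_ne (Finset.ne_of_mem_erase hj)]
    rw [hup, ← ih]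
    refine Finset.sum_congr rfl fun b _ => Finset.prod_congr rfl fun j _ => ?_
    congr 1
    rw [Fin.card_filter_univ_succ]
    simp only [Fin.consEquiv_apply, Fin.cons_zero, Fin.cons_succ]
    by_cases hj : j₀ = j
    · subst hj
      rw [if_pos rfl, Function.update_self, Function.iterate_succ_apply]
    · rw [if_neg hj, Function.update_of_ne (Ne.symm hj)]

lemma coeff_prod_nonneg {J : Type*} (t : Finset J) (G : J → ℝ[X])
    (hG : ∀ j k, 0 ≤ (G j).coeff k) (k : ℕ) : 0 ≤ (∏ j ∈ t, G j).coeff k := by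
  classical
  induction t using Finset.induction_on generalizing k with
  | empty =>
    rw [Finset.prod_empty, coeff_one]
    split_ifs <;> norm_num
  | insert a t ha ih =>
    rw [Finset.prod_insert ha, coeff_mul]
    exact Finset.sum_nonneg fun x _ => mul_nonneg (hG _ _) (ih _)

/-- Comparison of the multinomial bootstrap counts with independent Poisson variables. -/
lemma sum_prod_bootCount_le (g : Fin n → ℕ → ℝ) (hg : ∀ j k, 0 ≤ g j k) :
    ∑ b : Fin n → Fin n, ∏ j, g j (bootCount b j)
      ≤ n.factorial * ∏ j, ∑ k ∈ Finset.range (n + 1), g j k / k.factorial := by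
  -- Exponential generating functions: the sum over samples is n! times the coefficient of xⁿ in ∏
  -- G_j. All coefficients being nonnegative, one of them is at most the value at 1.
  set G : Fin n → ℝ[X] := fun j =>
    ∑ k ∈ Finset.range (n + 1), monomial k (g j k / k.factorial) with hGdef
  have hcoeff : ∀ j k, (G j).coeff k = if k ∈ Finset.range (n + 1) then g j k / k.factorial
      else 0 := by
    intro j k
    simp only [hGdef, finsetSum_coeff, coeff_monomial]
    rw [Finset.sum_ite_eq']
  have hnn : ∀ j k, 0 ≤ (G j).coeff k := by
    intro j k
    rw [hcoeff]
    split_ifs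
    · exact div_nonneg (hg j k) (by positivity)
    · exact le_refl _
  have heval : ∀ j k, k ≤ n → (derivative^[k] (G j)).eval 0 = g j k := by
    intro j k hk
    rw [← coeff_zero_eq_eval_zero, coeff_iterate_derivative, zero_add, hcoeff,
      if_pos (Finset.mem_range.2 (by omega)), Nat.descFactorial_self, nsmul_eq_mul]
    have : (k.factorial : ℝ) ≠ 0 := by positivity
    field_simp
  have hle : ∀ (b : Fin n → Fin n) j, bootCount b j ≤ n := fun b j => by
    have := Finset.card_filter_le (Finset.univ : Finset (Fin n)) (fun k => b k = j)
    simpa [bootCount] using this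
  have h1 : ∑ b : Fin n → Fin n, ∏ j, g j (bootCount b j)
      = (derivative^[n] (∏ j, G j)).eval 0 := by
    rw [← sum_prod_iterate_derivative]
    refine Finset.sum_congr rfl fun b _ => Finset.prod_congr rfl fun j _ => ?_
    exact (heval j _ (hle b j)).symm
  have h2 : ∏ j, ∑ k ∈ Finset.range (n + 1), g j k / k.factorial = (∏ j, G j).eval 1 := by
    rw [eval_prod]
    refine Finset.prod_congr rfl fun j _ => ?_
    simp [hGdef, eval_finsetSum]
  rw [h1, h2, ← coeff_zero_eq_eval_zero, coeff_iterate_derivative, zero_add,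
    Nat.descFactorial_self, nsmul_eq_mul]
  refine mul_le_mul_of_nonneg_left ?_ (by positivity)
  by_cases hd : n ≤ (∏ j, G j).natDegree
  · rw [eval_eq_sum_range]
    simp only [one_pow, mul_one]
    exact Finset.single_le_sum (f := fun i => (∏ j, G j).coeff i)
      (fun i _ => coeff_prod_nonneg _ _ hnn i) (Finset.mem_range.2 (by omega))
  · rw [coeff_eq_zero_of_natDegree_lt (not_le.1 hd), eval_prod]
    refine Finset.prod_nonneg fun j _ => ?_
    rw [eval_eq_sum_range]
    exact Finset.sum_nonneg fun i _ => mul_nonneg (hnn _ _) (by simp)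

end Poissonization

/-- The induction step is e ≤ (1 + 1/n)^{n+1}. As there are nⁿ samples in all, passing from Poisson
to multinomial counts loses only a factor e·n. -/
lemma factorial_mul_exp_le (hn : 1 ≤ n) :
    (n.factorial : ℝ) * Real.exp n ≤ Real.exp 1 * n * (n : ℝ) ^ n := by
  induction n, hn using Nat.le_induction with
  | base => simp
  | succ n hn ih =>
    have hn0 : (0 : ℝ) < n := by exact_mod_cast hn
    have hlog : Real.exp 1 * (n : ℝ) ^ (n + 1) ≤ ((n : ℝ) + 1) ^ (n + 1) := by
      have h1 : (1 : ℝ) / (n + 1) ≤ Real.log ((n + 1) / n) := by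
        have := Real.one_sub_inv_le_log_of_pos (show (0 : ℝ) < (n + 1) / n by positivity)
        refine le_trans (le_of_eq ?_) this
        field_simp
        ring
      have h2 : Real.exp (1 / (n + 1)) ≤ (n + 1) / n := by
        rw [← Real.le_log_iff_exp_le (by positivity)]; exact h1
      have h3 := pow_le_pow_left₀ (Real.exp_pos _).le h2 (n + 1)
      rw [← Real.exp_nat_mul, div_pow, le_div_iff₀ (by positivity)] at h3
      push_cast at h3
      rwa [mul_one_div_cancel (by positivity)] at h3
    rw [Nat.factorial_succ]
    push_cast
    rw [Real.exp_add]
    calc ((n : ℝ) + 1) * n.factorial * (Real.exp n * Real.exp 1)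
        = (n + 1) * Real.exp 1 * (n.factorial * Real.exp n) := by ring
      _ ≤ (n + 1) * Real.exp 1 * (Real.exp 1 * n * (n : ℝ) ^ n) :=
          mul_le_mul_of_nonneg_left ih (by positivity)
      _ = (n + 1) * Real.exp 1 * (Real.exp 1 * (n : ℝ) ^ (n + 1)) := by ring
      _ ≤ (n + 1) * Real.exp 1 * ((n : ℝ) + 1) ^ (n + 1) :=
          mul_le_mul_of_nonneg_left hlog (by positivity)
      _ = _ := by ring

/-- Exponential tail bound for additive functionals of the bootstrap counts over a set `S`. -/
lemma card_bootCount_tail_le (hn : 1 ≤ n) (S : Finset (Fin n)) (φ : ℕ → ℝ) (a t : ℝ)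
    (hφ : ∑ k ∈ Finset.range (n + 1), Real.exp (φ k) / k.factorial ≤ Real.exp (1 + a)) :
    ((Finset.univ.filter fun b : Fin n → Fin n => t ≤ ∑ j ∈ S, φ (bootCount b j)).card : ℝ)
      ≤ (n : ℝ) ^ n * (Real.exp 1 * n * Real.exp (a * S.card - t)) := by
  classical
  -- Chernoff's bound. Outside S the factor is 1, with Poisson sum at most e; on S, dividing `hφ` by
  -- e says that the truncated Poisson exponential moment is at most exp a.
  set g : Fin n → ℕ → ℝ := fun j k => if j ∈ S then Real.exp (φ k) else 1 with hg
  have hprod : ∀ b : Fin n → Fin n,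
      ∏ j, g j (bootCount b j) = Real.exp (∑ j ∈ S, φ (bootCount b j)) := by
    intro b
    rw [Real.exp_sum, ← Finset.prod_filter_mul_prod_filter_not Finset.univ (· ∈ S)]
    rw [Finset.prod_congr rfl (fun j hj => if_pos (Finset.mem_filter.1 hj).2),
      Finset.prod_congr (s₁ := Finset.univ.filter (¬ · ∈ S)) rfl
        (fun j hj => if_neg (Finset.mem_filter.1 hj).2)]
    simp
  have h1 : ((Finset.univ.filter fun b : Fin n → Fin n =>
      t ≤ ∑ j ∈ S, φ (bootCount b j)).card : ℝ) * Real.exp t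
      ≤ ∑ b : Fin n → Fin n, ∏ j, g j (bootCount b j) := by
    rw [← nsmul_eq_mul, ← Finset.sum_const]
    refine (Finset.sum_le_sum fun b hb => ?_).trans
      (Finset.sum_le_sum_of_subset_of_nonneg (Finset.filter_subset _ _) fun b _ _ => ?_)
    · rw [hprod]; exact Real.exp_le_exp.2 (Finset.mem_filter.1 hb).2
    · rw [hprod]; exact (Real.exp_pos _).le
  have h2 := sum_prod_bootCount_le g fun j k => by
    simp only [hg]; split_ifs
    · exact (Real.exp_pos _).le
    · exact zero_le_one
  have hone : ∑ k ∈ Finset.range (n + 1), (1 : ℝ) / k.factorial ≤ Real.exp 1 := by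
    have := Real.sum_le_exp_of_nonneg zero_le_one (n + 1)
    simpa using this
  have h3 : ∏ j, ∑ k ∈ Finset.range (n + 1), g j k / k.factorial
      ≤ ∏ j, if j ∈ S then Real.exp (1 + a) else Real.exp 1 := by
    refine Finset.prod_le_prod (fun j _ => Finset.sum_nonneg fun k _ => ?_) fun j _ => ?_
    · simp only [hg]; split_ifs <;> positivity
    · by_cases hj : j ∈ S
      · simpa [hg, hj] using hφ
      · simpa [hg, hj] using hone
  have h4 : (∏ j : Fin n, if j ∈ S then Real.exp (1 + a) else Real.exp 1)
      = Real.exp n * Real.exp (a * S.card) := by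
    have : ∀ j : Fin n, (if j ∈ S then Real.exp (1 + a) else Real.exp 1)
        = Real.exp (1 + if j ∈ S then a else 0) := by
      intro j; split_ifs <;> simp
    simp only [this]
    rw [← Real.exp_sum, ← Real.exp_add, Finset.sum_add_distrib]
    simp [mul_comm]
  rw [h4] at h3
  have h5 := h1.trans (h2.trans (mul_le_mul_of_nonneg_left h3 (by positivity)))
  rw [Real.exp_sub]
  have h6 : (n.factorial : ℝ) * (Real.exp n * Real.exp (a * S.card))
      ≤ Real.exp 1 * n * (n : ℝ) ^ n * Real.exp (a * S.card) := by
    rw [← mul_assoc]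
    exact mul_le_mul_of_nonneg_right (factorial_mul_exp_le hn) (Real.exp_pos _).le
  rw [← le_div_iff₀ (Real.exp_pos _)] at h5
  refine h5.trans ?_
  rw [div_le_iff₀ (Real.exp_pos _)]
  refine h6.trans (le_of_eq ?_)
  have := (Real.exp_pos t).ne'
  field_simp

/-- A bound for `∑ k⁴ eᵏ / k!`. -/
def momentConst : ℝ := 24 * Real.exp (Real.exp 2)

/-- How regularly the bootstrap sample is spread over a set of observations. -/
def spreadConst : ℝ := 4 * (momentConst + 1)

lemma momentConst_pos : 0 < momentConst := by unfold momentConst; positivity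

lemma one_le_spreadConst : 1 ≤ spreadConst := by
  unfold spreadConst; linarith [momentConst_pos]

lemma sum_exp_mul_div_factorial_le (c : ℝ) (N : ℕ) :
    ∑ k ∈ Finset.range N, Real.exp (c * k) / k.factorial ≤ Real.exp (Real.exp c) := by
  refine le_trans (le_of_eq ?_) (Real.sum_le_exp_of_nonneg (Real.exp_pos c).le N)
  refine Finset.sum_congr rfl fun k _ => ?_
  rw [← Real.exp_nat_mul, mul_comm]

lemma sum_pow_four_exp_div_factorial_le (N : ℕ) :
    ∑ k ∈ Finset.range N, (k : ℝ) ^ 4 * Real.exp k / k.factorial ≤ momentConst := by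
  calc ∑ k ∈ Finset.range N, (k : ℝ) ^ 4 * Real.exp k / k.factorial
      ≤ ∑ k ∈ Finset.range N, 24 * (Real.exp (2 * k) / k.factorial) := by
        refine Finset.sum_le_sum fun k _ => ?_
        have h := Real.pow_div_factorial_le_exp (k : ℝ) (Nat.cast_nonneg k) 4
        have h4 : ((Nat.factorial 4 : ℕ) : ℝ) = 24 := by norm_num [Nat.factorial]
        rw [h4, div_le_iff₀ (by norm_num)] at h
        rw [← mul_div_assoc]
        refine div_le_div_of_nonneg_right ?_ (by positivity)
        rw [two_mul, Real.exp_add]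
        nlinarith [mul_le_mul_of_nonneg_right h (Real.exp_pos (k : ℝ)).le]
    _ ≤ momentConst := by
        rw [← Finset.mul_sum, momentConst]
        exact mul_le_mul_of_nonneg_left (sum_exp_mul_div_factorial_le 2 N) (by norm_num)

/-- Fourth powers of Poisson variables have no exponential moments. Capping λk⁴ at k restores them,
and eˣ ≤ 1 + x eˣ keeps the exponent linear in λ. -/
lemma sum_exp_min_div_factorial_le {lam : ℝ} (hl : 0 ≤ lam) (N : ℕ) :
    ∑ k ∈ Finset.range N, Real.exp (min (lam * (k : ℝ) ^ 4) k) / k.factorial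
      ≤ Real.exp (1 + lam * momentConst) := by
  have hpt : ∀ k : ℕ, Real.exp (min (lam * (k : ℝ) ^ 4) k)
      ≤ 1 + lam * ((k : ℝ) ^ 4 * Real.exp k) := by
    intro k
    set x := min (lam * (k : ℝ) ^ 4) (k : ℝ) with hx
    have hx0 : 0 ≤ x := le_min (by positivity) (by positivity)
    have h1 : Real.exp x ≤ 1 + x * Real.exp x := by
      have := Real.add_one_le_exp (-x)
      have h2 := mul_le_mul_of_nonneg_right this (Real.exp_pos x).le
      rw [← Real.exp_add, neg_add_cancel, Real.exp_zero] at h2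
      linarith
    have h3 : x * Real.exp x ≤ lam * (k : ℝ) ^ 4 * Real.exp k :=
      mul_le_mul (min_le_left _ _) (Real.exp_le_exp.2 (min_le_right _ _)) (Real.exp_pos _).le
        (by positivity)
    linarith
  have hone : ∑ k ∈ Finset.range N, (1 : ℝ) / k.factorial ≤ Real.exp 1 := by
    have := Real.sum_le_exp_of_nonneg zero_le_one N
    simpa using this
  calc _ ≤ ∑ k ∈ Finset.range N, ((1 : ℝ) / k.factorial
        + lam * ((k : ℝ) ^ 4 * Real.exp k / k.factorial)) := by
        refine Finset.sum_le_sum fun k _ => ?_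
        rw [mul_div_assoc', ← add_div]
        exact div_le_div_of_nonneg_right (hpt k) (by positivity)
    _ ≤ Real.exp 1 + lam * momentConst := by
        rw [Finset.sum_add_distrib, ← Finset.mul_sum]
        exact add_le_add hone
          (mul_le_mul_of_nonneg_left (sum_pow_four_exp_div_factorial_le N) hl)
    _ ≤ Real.exp (1 + lam * momentConst) := by
        rw [Real.exp_add]
        have h1 := Real.add_one_le_exp (lam * momentConst)
        have h2 : (1 : ℝ) ≤ Real.exp 1 := Real.one_le_exp zero_le_one
        have h3 := mul_nonneg hl momentConst_pos.le
        nlinarith [mul_le_mul_of_nonneg_left h1 (Real.exp_pos 1).le]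

/-- For a Poisson variable N of mean one, E e^{−N} = exp(1/e − 1) ≤ exp(−1/2); with the threshold at
|S|/4 the exponent is −|S|/2 + |S|/4. -/
lemma card_sparse_le (hn : 1 ≤ n) (S : Finset (Fin n)) :
    ((Finset.univ.filter fun b : Fin n → Fin n =>
        -((S.card : ℝ) / 4) ≤ ∑ j ∈ S, -(bootCount b j : ℝ)).card : ℝ)
      ≤ (n : ℝ) ^ n * (Real.exp 1 * n * Real.exp (-((S.card : ℝ) / 4))) := by
  have h := card_bootCount_tail_le hn S (fun k : ℕ => -(k : ℝ)) (-(1 / 2))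
    (-((S.card : ℝ) / 4)) ?_
  · convert h using 4
    ring
  · have h1 := sum_exp_mul_div_factorial_le (-1) (n + 1)
    simp only [neg_mul, one_mul] at h1
    refine h1.trans (Real.exp_le_exp.2 ?_)
    have h2 : (2 : ℝ) ≤ Real.exp 1 := by
      have := Real.add_one_le_exp (1 : ℝ); linarith
    rw [Real.exp_neg]
    have := inv_anti₀ (by norm_num) h2
    norm_num at this ⊢
    exact this

lemma card_bootCount_large_le (hn : 1 ≤ n) (i : Fin n) (T : ℝ) :
    ((Finset.univ.filter fun b : Fin n → Fin n => T ≤ (bootCount b i : ℝ)).card : ℝ)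
      ≤ (n : ℝ) ^ n * (Real.exp 1 * n * (Real.exp (Real.exp 1) * Real.exp (-T))) := by
  have h := card_bootCount_tail_le hn {i} (fun k : ℕ => (k : ℝ)) (Real.exp 1 - 1) T ?_
  · simp only [Finset.sum_singleton, Finset.card_singleton, Nat.cast_one, mul_one] at h
    refine h.trans ?_
    have : Real.exp (Real.exp 1 - 1 - T) ≤ Real.exp (Real.exp 1) * Real.exp (-T) := by
      rw [← Real.exp_add]
      exact Real.exp_le_exp.2 (by linarith)
    gcongr
  · have h1 := sum_exp_mul_div_factorial_le 1 (n + 1)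
    simp only [one_mul] at h1
    simpa using h1

/-- The part `momentConst` of the threshold pays for the exponential moment, and the extra 1 leaves
λ·max(|S|, r) ≥ λr as decay, even for small S. -/
lemma card_pow_large_le (hn : 1 ≤ n) (S : Finset (Fin n)) {lam : ℝ} (hl : 0 ≤ lam) (r : ℝ) :
    ((Finset.univ.filter fun b : Fin n → Fin n =>
        lam * ((momentConst + 1) * max (S.card : ℝ) r)
          ≤ ∑ j ∈ S, min (lam * (bootCount b j : ℝ) ^ 4) (bootCount b j : ℝ)).card : ℝ)
      ≤ (n : ℝ) ^ n * (Real.exp 1 * n * Real.exp (-(lam * r))) := by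
  have h := card_bootCount_tail_le hn S (fun k : ℕ => min (lam * (k : ℝ) ^ 4) (k : ℝ))
    (lam * momentConst) (lam * ((momentConst + 1) * max (S.card : ℝ) r))
    (sum_exp_min_div_factorial_le hl _)
  refine h.trans ?_
  have : Real.exp (lam * momentConst * (S.card : ℝ)
      - lam * ((momentConst + 1) * max (S.card : ℝ) r)) ≤ Real.exp (-(lam * r)) := by
    refine Real.exp_le_exp.2 ?_
    have h1 : lam * momentConst * (S.card : ℝ) ≤ lam * momentConst * max (S.card : ℝ) r :=
      mul_le_mul_of_nonneg_left (le_max_left _ _) (mul_nonneg hl momentConst_pos.le)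
    have h2 : lam * r ≤ lam * max (S.card : ℝ) r :=
      mul_le_mul_of_nonneg_left (le_max_right _ _) hl
    linarith
  gcongr

/-- The bootstrap samples that are spread irregularly over a set `S` of observations although many
draws fall into `S`. -/
def irregular (S : Finset (Fin n)) (c : ℝ) : Set (Fin n → Fin n) :=
  {b | √(n : ℝ) ≤ c * ∑ j ∈ S, (bootCount b j : ℝ) ∧
    ¬ ((S.card : ℝ) ≤ spreadConst * ∑ j ∈ S, (bootCount b j : ℝ) ∧
      ∑ j ∈ S, (bootCount b j : ℝ) ^ 4 ≤ spreadConst * ∑ j ∈ S, (bootCount b j : ℝ))}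

/-- The constant in the tail bound for irregular bootstrap samples. -/
def tailConst : ℝ := Real.exp 1 * (2 + Real.exp (Real.exp 1))

-- Irregularity forces one of three rare events: S receives too few draws, some count reaches
-- n^{1/8}, or the capped fourth powers over S are too large. If all counts stay below n^{1/8}, the
-- cap is inactive and the last event concerns true fourth powers.
open Classical in
lemma card_irregular_le (hn : 1 ≤ n) (S : Finset (Fin n)) {c : ℝ} (hc : 1 ≤ c) :
    ((Finset.univ.filter fun b => b ∈ irregular S c).card : ℝ)
      ≤ (n : ℝ) ^ n * (tailConst * n ^ 2 * Real.exp (-(√√√(n : ℝ) / c))) := by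
  have hn1 : (1 : ℝ) ≤ n := by exact_mod_cast hn
  set T := √√√(n : ℝ) with hT
  have hT1 : 1 ≤ T := by
    rw [hT, Real.one_le_sqrt, Real.one_le_sqrt, Real.one_le_sqrt]; exact hn1
  have hT4 : T ^ 4 = √(n : ℝ) := by
    rw [show (4 : ℕ) = 2 * 2 from rfl, pow_mul, hT, Real.sq_sqrt (Real.sqrt_nonneg _),
      Real.sq_sqrt (Real.sqrt_nonneg _)]
  have hT0 : 0 < T := by linarith
  have hc0 : 0 < c := by linarith
  -- With T = n^{1/8}, this is small enough that λk⁴ ≤ k for k ≤ T, and large enough that λr = T/c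
  -- with r = √n/c.
  set lam := 1 / T ^ 3 with hlam
  have hlam0 : 0 < lam := by positivity
  set r := T ^ 4 / c with hr
  have hr0 : 0 < r := by positivity
  have hlr : lam * r = T / c := by rw [hlam, hr]; field_simp
  have hTr : T / c ≤ r := by
    rw [hr]; exact div_le_div_of_nonneg_right (le_self_pow₀ hT1 (by norm_num)) hc0.le
  set A := Finset.univ.filter fun b : Fin n → Fin n =>
    -((S.card : ℝ) / 4) ≤ ∑ j ∈ S, -(bootCount b j : ℝ) with hA
  set B : Fin n → Finset (Fin n → Fin n) := fun i => Finset.univ.filter fun b =>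
    T ≤ (bootCount b i : ℝ) with hB
  set D := Finset.univ.filter fun b : Fin n → Fin n =>
    lam * ((momentConst + 1) * max (S.card : ℝ) r)
      ≤ ∑ j ∈ S, min (lam * (bootCount b j : ℝ) ^ 4) (bootCount b j : ℝ) with hD
  have hmc := momentConst_pos
  have cA : 4 * r ≤ S.card → (A.card : ℝ)
      ≤ (n : ℝ) ^ n * (Real.exp 1 * n * Real.exp (-(T / c))) := by
    intro h
    refine (card_sparse_le hn S).trans ?_
    have : Real.exp (-((S.card : ℝ) / 4)) ≤ Real.exp (-(T / c)) :=
      Real.exp_le_exp.2 (by linarith)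
    gcongr
  have cB : ∀ i, ((B i).card : ℝ) ≤ (n : ℝ) ^ n *
      (Real.exp 1 * n * (Real.exp (Real.exp 1) * Real.exp (-(T / c)))) := by
    intro i
    refine (card_bootCount_large_le hn i T).trans ?_
    have : Real.exp (-T) ≤ Real.exp (-(T / c)) :=
      Real.exp_le_exp.2 (neg_le_neg (div_le_self hT0.le hc))
    gcongr
  have cD : (D.card : ℝ) ≤ (n : ℝ) ^ n * (Real.exp 1 * n * Real.exp (-(T / c))) := by
    have := card_pow_large_le hn S hlam0.le r
    rwa [hlr] at this
  -- For |S| < 4r the sparsity bound would be too weak, but it is not needed: an irregular sample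
  -- puts at least r draws into S by definition.
  set A' : Finset (Fin n → Fin n) := if (S.card : ℝ) < 4 * r then ∅ else A with hA'
  have cA' : (A'.card : ℝ) ≤ (n : ℝ) ^ n * (Real.exp 1 * n * Real.exp (-(T / c))) := by
    by_cases h : (S.card : ℝ) < 4 * r
    · rw [hA', if_pos h]; simp only [Finset.card_empty, Nat.cast_zero]; positivity
    · rw [hA', if_neg h]; exact cA (not_lt.1 h)
  have hsub : (Finset.univ.filter fun b => b ∈ irregular S c)
      ⊆ A' ∪ (Finset.univ.biUnion B ∪ D) := by
    intro b hb
    obtain ⟨hb1, hb2⟩ := (Finset.mem_filter.1 hb).2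
    by_contra hcon
    simp only [Finset.mem_union, not_or, Finset.mem_biUnion, Finset.mem_univ, true_and,
      not_exists] at hcon
    obtain ⟨n1, n2, n3⟩ := hcon
    set H := ∑ j ∈ S, (bootCount b j : ℝ) with hH
    have hrH : r ≤ H := by
      rw [hr, hT4, div_le_iff₀ hc0]; linarith
    have hcard : (S.card : ℝ) ≤ 4 * H := by
      by_cases h : (S.card : ℝ) < 4 * r
      · linarith
      · rw [hA', if_neg h, hA, Finset.mem_filter] at n1
        simp only [Finset.mem_univ, true_and, not_le, Finset.sum_neg_distrib] at n1
        linarith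
    have hbT : ∀ j, (bootCount b j : ℝ) < T := by
      intro j
      have := n2 j
      simpa [hB] using this
    have hmin : ∀ j, min (lam * (bootCount b j : ℝ) ^ 4) (bootCount b j : ℝ)
        = lam * (bootCount b j : ℝ) ^ 4 := by
      intro j
      refine min_eq_left ?_
      have h3 : (bootCount b j : ℝ) ^ 3 ≤ T ^ 3 :=
        pow_le_pow_left₀ (by positivity) (hbT j).le 3
      rw [hlam, one_div, inv_mul_le_iff₀ (by positivity)]
      calc (bootCount b j : ℝ) ^ 4 = (bootCount b j : ℝ) ^ 3 * bootCount b j := by ring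
        _ ≤ T ^ 3 * bootCount b j := mul_le_mul_of_nonneg_right h3 (by positivity)
    have hpow : ∑ j ∈ S, (bootCount b j : ℝ) ^ 4 < (momentConst + 1) * max (S.card : ℝ) r := by
      rw [hD, Finset.mem_filter] at n3
      simp only [Finset.mem_univ, true_and, not_le, hmin, ← Finset.mul_sum] at n3
      exact lt_of_mul_lt_mul_left n3 hlam0.le
    have hH0 : 0 ≤ H := Finset.sum_nonneg fun j _ => by positivity
    have hmax : max (S.card : ℝ) r ≤ 4 * H := max_le hcard (by linarith)
    refine hb2 ⟨hcard.trans (mul_le_mul_of_nonneg_right ?_ hH0), hpow.le.trans ?_⟩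
    · unfold spreadConst; linarith
    · refine (mul_le_mul_of_nonneg_left hmax (by linarith)).trans (le_of_eq ?_)
      unfold spreadConst; ring
  have hfin : ((Finset.univ.filter fun b => b ∈ irregular S c).card : ℝ)
      ≤ A'.card + (∑ i, ((B i).card : ℝ) + D.card) := by
    have h1 := (Finset.card_le_card hsub).trans (Finset.card_union_le _ _)
    have h2 := Finset.card_union_le (Finset.univ.biUnion B) D
    have h3 := Finset.card_biUnion_le (s := Finset.univ) (t := B)
    have : (Finset.univ.filter fun b => b ∈ irregular S c).card
        ≤ A'.card + (∑ i, (B i).card + D.card) := by omega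
    exact_mod_cast this
  have hsumB : ∑ i, ((B i).card : ℝ) ≤ n * ((n : ℝ) ^ n *
      (Real.exp 1 * n * (Real.exp (Real.exp 1) * Real.exp (-(T / c))))) := by
    refine (Finset.sum_le_sum fun i _ => cB i).trans (le_of_eq ?_)
    simp
  have hnn : (n : ℝ) ≤ (n : ℝ) ^ 2 := by nlinarith
  have hgain : (n : ℝ) ^ n * (Real.exp 1 * n * Real.exp (-(T / c)))
      ≤ (n : ℝ) ^ n * (Real.exp 1 * (n : ℝ) ^ 2 * Real.exp (-(T / c))) := by gcongr
  refine hfin.trans ?_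
  have hexp : (n : ℝ) ^ n * (tailConst * n ^ 2 * Real.exp (-(T / c)))
      = (n : ℝ) ^ n * (Real.exp 1 * (n : ℝ) ^ 2 * Real.exp (-(T / c)))
        + (n * ((n : ℝ) ^ n * (Real.exp 1 * n * (Real.exp (Real.exp 1) * Real.exp (-(T / c)))))
        + (n : ℝ) ^ n * (Real.exp 1 * (n : ℝ) ^ 2 * Real.exp (-(T / c)))) := by
    unfold tailConst; ring
  rw [hexp]
  linarith

/-! ### Cells of trees as boxes, and the sets of observations they cut out -/

lemma SplitTree.leafOf_mem_leaves (T : SplitTree p) (x : Fin p → ℝ) : T.leafOf x ∈ T.leaves := by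
  induction T with
  | leaf => simp [SplitTree.leafOf, SplitTree.leaves]
  | node j c l r hl hr =>
    simp only [SplitTree.leafOf, SplitTree.leaves, Finset.mem_union, Finset.mem_image]
    split_ifs
    · exact Or.inl ⟨_, hl, rfl⟩
    · exact Or.inr ⟨_, hr, rfl⟩

/-- The cells of a tree are boxes. -/
lemma SplitTree.exists_box (T : SplitTree p) (x₀ : Fin p → ℝ) :
    ∃ a b : Fin p → EReal, ∀ x : Fin p → ℝ,
      T.leafOf x = T.leafOf x₀ ↔ ∀ j, a j ≤ (x j : EReal) ∧ (x j : EReal) < b j := by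
  classical
  -- Splits are strict, so boxes are closed below and open above; extended reals allow missing
  -- sides.
  induction T with
  | leaf =>
    exact ⟨fun _ => ⊥, fun _ => ⊤, fun x => by simp [SplitTree.leafOf, EReal.coe_lt_top]⟩
  | node k c l r hl hr =>
    by_cases h0 : x₀ k < c
    · obtain ⟨a, b, hab⟩ := hl
      refine ⟨a, fun j => if j = k then min (b j) c else b j, fun x => ?_⟩
      have hx : (SplitTree.node k c l r).leafOf x = (SplitTree.node k c l r).leafOf x₀
          ↔ x k < c ∧ l.leafOf x = l.leafOf x₀ := by
        simp only [SplitTree.leafOf, h0, if_true]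
        by_cases h : x k < c <;> simp [h]
      rw [hx, hab]
      constructor
      · rintro ⟨h1, h2⟩ j
        refine ⟨(h2 j).1, ?_⟩
        dsimp only
        split_ifs with hj
        · subst hj; exact lt_min (h2 j).2 (EReal.coe_lt_coe_iff.2 h1)
        · exact (h2 j).2
      · intro h
        have hk := (h k).2
        dsimp only at hk
        rw [if_pos rfl, lt_min_iff] at hk
        refine ⟨EReal.coe_lt_coe_iff.1 hk.2, fun j => ⟨(h j).1, ?_⟩⟩
        by_cases hj : j = k
        · subst hj; exact hk.1
        · simpa [hj] using (h j).2
    · obtain ⟨a, b, hab⟩ := hr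
      refine ⟨fun j => if j = k then max (a j) c else a j, b, fun x => ?_⟩
      have hx : (SplitTree.node k c l r).leafOf x = (SplitTree.node k c l r).leafOf x₀
          ↔ c ≤ x k ∧ r.leafOf x = r.leafOf x₀ := by
        simp only [SplitTree.leafOf, h0, if_false]
        by_cases h : x k < c
        · simp [h]
        · simp [h, not_lt.1 h]
      rw [hx, hab]
      constructor
      · rintro ⟨h1, h2⟩ j
        refine ⟨?_, (h2 j).2⟩
        dsimp only
        split_ifs with hj
        · subst hj; exact max_le (h2 j).1 (EReal.coe_le_coe_iff.2 h1)
        · exact (h2 j).1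
      · intro h
        have hk := (h k).1
        dsimp only at hk
        rw [if_pos rfl, max_le_iff] at hk
        refine ⟨EReal.coe_le_coe_iff.1 hk.2, fun j => ⟨?_, (h j).2⟩⟩
        by_cases hj : j = k
        · subst hj; exact hk.1
        · simpa [hj] using (h j).1

open Classical in
/-- The observations in a box whose sides are given by observations (or are missing). -/
def boxSet (X : Fin n → Fin p → ℝ) (s : Fin p → Option (Fin n) × Option (Fin n)) :
    Finset (Fin n) :=
  Finset.univ.filter fun i => ∀ j, (∀ k, (s j).1 = some k → X k j ≤ X i j) ∧
    ∀ k, (s j).2 = some k → X i j < X k j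

open Classical in
/-- Each nonempty cell cuts out one of polynomially many sets of observations. -/
lemma exists_boxSet_eq (T : SplitTree p) (X : Fin n → Fin p → ℝ) (i₀ : Fin n) :
    ∃ s, (Finset.univ.filter fun i => T.leafOf (X i) = T.leafOf (X i₀)) = boxSet X s := by
  obtain ⟨a, b, hab⟩ := T.exists_box (X i₀)
  have h0 := (hab (X i₀)).1 rfl
  -- A side may be moved up to the smallest observed coordinate at or above it. For lower sides one
  -- exists, since observation i₀ lies in the cell; an upper side with no such coordinate is
  -- dropped.
  have hlow : ∀ j, ∃ o : Option (Fin n), ∀ i, a j ≤ (X i j : EReal) ↔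
      ∀ k, o = some k → X k j ≤ X i j := by
    intro j
    obtain ⟨k, hk, hmin⟩ := Finset.exists_min_image
      (Finset.univ.filter fun i => a j ≤ (X i j : EReal)) (fun i => X i j)
      ⟨i₀, by simpa using (h0 j).1⟩
    refine ⟨some k, fun i => ⟨fun h k' hk' => ?_, fun h => ?_⟩⟩
    · obtain rfl := Option.some.inj hk'
      exact hmin i (by simpa using h)
    · have h1 : a j ≤ (X k j : EReal) := by simpa using hk
      exact h1.trans (EReal.coe_le_coe_iff.2 (h k rfl))
  have hup : ∀ j, ∃ o : Option (Fin n), ∀ i, (X i j : EReal) < b j ↔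
      ∀ k, o = some k → X i j < X k j := by
    intro j
    by_cases hne : (Finset.univ.filter fun i => b j ≤ (X i j : EReal)).Nonempty
    · obtain ⟨k, hk, hmin⟩ := Finset.exists_min_image _ (fun i => X i j) hne
      have h1 : b j ≤ (X k j : EReal) := by simpa using hk
      refine ⟨some k, fun i => ⟨fun h k' hk' => ?_, fun h => ?_⟩⟩
      · obtain rfl := Option.some.inj hk'
        exact EReal.coe_lt_coe_iff.1 (h.trans_le h1)
      · by_contra hc
        exact absurd (hmin i (by simpa using hc)) (not_le.2 (h k rfl))
    · refine ⟨none, fun i => ⟨fun _ k hk => by simp at hk, fun _ => ?_⟩⟩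
      by_contra hc
      exact hne ⟨i, by simpa using hc⟩
  choose u hu using hlow
  choose v hv using hup
  refine ⟨fun j => (u j, v j), ?_⟩
  ext i
  simp only [boxSet, Finset.mem_filter, Finset.mem_univ, true_and, hab, hu, hv]

lemma measurableSet_boxSet_eq (s : Fin p → Option (Fin n) × Option (Fin n))
    (S : Finset (Fin n)) : MeasurableSet {X : Fin n → Fin p → ℝ | boxSet X s = S} := by
  have h1 : ∀ i, MeasurableSet {X : Fin n → Fin p → ℝ | i ∈ boxSet X s} := by
    intro i
    simp only [boxSet, Finset.mem_filter, Finset.mem_univ, true_and, Set.ofPred_forall,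
      Set.ofPred_and]
    refine MeasurableSet.iInter fun j => MeasurableSet.inter
      (MeasurableSet.iInter fun k => MeasurableSet.iInter fun _ => ?_)
      (MeasurableSet.iInter fun k => MeasurableSet.iInter fun _ => ?_)
    · exact measurableSet_le (by fun_prop) (by fun_prop)
    · exact measurableSet_lt (by fun_prop) (by fun_prop)
  have h2 : {X : Fin n → Fin p → ℝ | boxSet X s = S}
      = ⋂ i, {X : Fin n → Fin p → ℝ | i ∈ boxSet X s ↔ i ∈ S} := by
    ext X
    simp only [Set.mem_ofPred_eq, Set.mem_iInter, Finset.ext_iff]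
  rw [h2]
  refine MeasurableSet.iInter fun i => ?_
  by_cases hi : i ∈ S
  · simpa [hi] using h1 i
  · simpa [hi, Set.compl_ofPred] using (h1 i).compl

lemma leafSize_eq_sum (T : SplitTree p) (X : Fin n → Fin p → ℝ) (b : Fin n → Fin n)
    (l : List Bool) :
    leafSize T X b l = ∑ j ∈ Finset.univ.filter (fun j => T.leafOf (X j) = l), bootCount b j := by
  rw [leafSize, Finset.card_eq_sum_card_fiberwise (f := b)
    (t := Finset.univ.filter fun j => T.leafOf (X j) = l)]
  · refine Finset.sum_congr rfl fun j hj => ?_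
    rw [bootCount]
    congr 1
    ext k
    simp only [Finset.mem_filter, Finset.mem_univ, true_and] at hj ⊢
    constructor
    · exact fun h => h.2
    · rintro rfl; exact ⟨hj, rfl⟩
  · intro k hk
    simpa using hk

/-- Regularity is required over all boxes, not merely over the leaves of T, because T may have been
grown from b itself. The bound `hsize` supplies the first clause of `irregular`, so only the second
can fail. -/
lemma leafRegular_of_notMem_irregular {T : SplitTree p} {X : Fin n → Fin p → ℝ}
    {b : Fin n → Fin n} {c : ℝ}
    (hsize : ∀ l ∈ T.leaves, √(n : ℝ) ≤ c * leafSize T X b l)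
    (hreg : ∀ s, b ∉ irregular (boxSet X s) c) : LeafRegular T X b (max c spreadConst) := by
  have hsz : ∀ i, √(n : ℝ) ≤ c * leafSize T X b (T.leafOf (X i)) := fun i =>
    hsize _ (T.leafOf_mem_leaves _)
  have key : ∀ i,
      ((Finset.univ.filter fun j => T.leafOf (X j) = T.leafOf (X i)).card : ℝ)
        ≤ spreadConst * leafSize T X b (T.leafOf (X i)) ∧
      ∑ j ∈ Finset.univ.filter (fun j => T.leafOf (X j) = T.leafOf (X i)),
        (bootCount b j : ℝ) ^ 4 ≤ spreadConst * leafSize T X b (T.leafOf (X i)) := by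
    intro i
    obtain ⟨s, hs⟩ := exists_boxSet_eq T X i
    have hq : (leafSize T X b (T.leafOf (X i)) : ℝ) = ∑ j ∈ boxSet X s, (bootCount b j : ℝ) := by
      rw [leafSize_eq_sum, ← hs, Nat.cast_sum]
    have hir := hreg s
    have h1 := hsz i
    rw [hq] at h1 ⊢
    have h2 : (boxSet X s).card ≤ spreadConst * ∑ j ∈ boxSet X s, (bootCount b j : ℝ) ∧
      ∑ j ∈ boxSet X s, (bootCount b j : ℝ) ^ 4
        ≤ spreadConst * ∑ j ∈ boxSet X s, (bootCount b j : ℝ) := by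
      by_contra hc
      exact hir ⟨h1, hc⟩
    rw [← hs] at h2 ⊢
    convert h2
  have hmono : ∀ i, spreadConst * (leafSize T X b (T.leafOf (X i)) : ℝ)
      ≤ max c spreadConst * leafSize T X b (T.leafOf (X i)) := fun i =>
    mul_le_mul_of_nonneg_right (le_max_right _ _) (Nat.cast_nonneg _)
  exact ⟨fun i => (hsz i).trans (mul_le_mul_of_nonneg_right (le_max_left _ _) (Nat.cast_nonneg _)),
    fun i => (key i).1.trans (hmono i), fun i => (key i).2.trans (hmono i)⟩

/-! ### Almost sure regularity by a union bound and Borel–Cantelli -/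

section Probability

variable {Ω : Type*} [MeasurableSpace Ω] {μ : Measure Ω} [IsProbabilityMeasure μ]

/-- For a fixed box description the random set depends on X only, so by independence it can be
frozen at each of its values S and the counting bound applies. A union over the (n + 1)^{2p}
descriptions follows. -/
lemma measure_irregular_le {X : Ω → Fin n → Fin p → ℝ} {b : Ω → Fin n → Fin n} (hn : 1 ≤ n)
    (hX : Measurable X) (hb : Measurable b) (hind : IndepFun b X μ)
    (hunif : μ.map b = uniformOn Set.univ) {c : ℝ} (hc : 1 ≤ c) :
    μ {ω | ∃ s, b ω ∈ irregular (boxSet (X ω) s) c}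
      ≤ ENNReal.ofReal (((n : ℝ) + 1) ^ (2 * p) *
        (tailConst * n ^ 2 * Real.exp (-(√√√(n : ℝ) / c)))) := by
  classical
  set ε : ℝ := tailConst * n ^ 2 * Real.exp (-(√√√(n : ℝ) / c)) with hε
  have hε0 : 0 ≤ ε := by rw [hε, tailConst]; positivity
  have hn0 : (0 : ℝ) < n := by exact_mod_cast hn
  have hbS : ∀ S, μ (b ⁻¹' irregular S c) ≤ ENNReal.ofReal ε := by
    intro S
    rw [← Measure.map_apply hb (Set.toFinite _).measurableSet, hunif, uniformOn_univ]
    have h1 : Measure.count (irregular S c)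
        = ((Finset.univ.filter fun b => b ∈ irregular S c).card : ENNReal) := by
      rw [← Measure.count_apply_finset]
      congr 1
      ext b
      simp
    rw [h1]
    have h2 := card_irregular_le hn S hc
    have h3 : ((Finset.univ.filter fun b => b ∈ irregular S c).card : ENNReal)
        ≤ ENNReal.ofReal ((n : ℝ) ^ n * ε) := by
      rw [← ENNReal.ofReal_natCast]; exact ENNReal.ofReal_le_ofReal h2
    refine (ENNReal.div_le_div_right h3 _).trans (le_of_eq ?_)
    rw [Fintype.card_fun, Fintype.card_fin]
    rw [ENNReal.ofReal_mul (by positivity), Nat.cast_pow, ENNReal.ofReal_pow (by positivity),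
      ENNReal.ofReal_natCast, mul_comm]
    refine ENNReal.mul_div_cancel_right ?_ ?_
    · exact pow_ne_zero _ (by exact_mod_cast (by omega : n ≠ 0))
    · exact ENNReal.pow_ne_top (ENNReal.natCast_ne_top n)
  have hs : ∀ s, μ {ω | b ω ∈ irregular (boxSet (X ω) s) c} ≤ ENNReal.ofReal ε := by
    intro s
    have hsub : {ω | b ω ∈ irregular (boxSet (X ω) s) c}
        ⊆ ⋃ S ∈ (Finset.univ : Finset (Finset (Fin n))),
          (b ⁻¹' irregular S c ∩ X ⁻¹' {X | boxSet X s = S}) := by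
      intro ω hω
      simp only [Set.mem_iUnion, Finset.mem_univ, exists_prop, true_and]
      exact ⟨boxSet (X ω) s, hω, rfl⟩
    calc μ {ω | b ω ∈ irregular (boxSet (X ω) s) c}
        ≤ ∑ S, μ (b ⁻¹' irregular S c ∩ X ⁻¹' {X | boxSet X s = S}) :=
          (measure_mono hsub).trans (measure_biUnion_finset_le _ _)
      _ = ∑ S, μ (b ⁻¹' irregular S c) * μ (X ⁻¹' {X | boxSet X s = S}) :=
          Finset.sum_congr rfl fun S _ => hind.measure_inter_preimage_eq_mul _ _
            (Set.toFinite _).measurableSet (measurableSet_boxSet_eq s S)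
      _ ≤ ∑ S, ENNReal.ofReal ε * μ (X ⁻¹' {X | boxSet X s = S}) :=
          Finset.sum_le_sum fun S _ => mul_le_mul_left (hbS S) _
      _ = ENNReal.ofReal ε := by
          rw [← Finset.mul_sum, ← measure_biUnion_finset]
          · have : (⋃ S ∈ (Finset.univ : Finset (Finset (Fin n))), X ⁻¹' {X | boxSet X s = S})
                = Set.univ := by
              ext ω; simp
            rw [this, measure_univ, mul_one]
          · intro S _ S' _ hSS
            refine Set.disjoint_left.2 fun ω h1 h2 => hSS ?_
            exact (show boxSet (X ω) s = S from h1).symm.trans h2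
          · exact fun S _ => hX (measurableSet_boxSet_eq s S)
  have hun : {ω | ∃ s, b ω ∈ irregular (boxSet (X ω) s) c}
      = ⋃ s ∈ (Finset.univ : Finset (Fin p → Option (Fin n) × Option (Fin n))),
        {ω | b ω ∈ irregular (boxSet (X ω) s) c} := by
    ext ω; simp
  rw [hun]
  refine (measure_biUnion_finset_le _ _).trans ((Finset.sum_le_sum fun s _ => hs s).trans
    (le_of_eq ?_))
  rw [Finset.sum_const, Finset.card_univ, nsmul_eq_mul,
    ENNReal.ofReal_mul (show (0 : ℝ) ≤ ((n : ℝ) + 1) ^ (2 * p) by positivity)]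
  congr 1
  simp only [Fintype.card_fun, Fintype.card_prod, Fintype.card_option, Fintype.card_fin]
  rw [ENNReal.ofReal_pow (by positivity), ENNReal.ofReal_add (by positivity) zero_le_one,
    ENNReal.ofReal_natCast, ENNReal.ofReal_one, pow_mul]
  push_cast
  rw [sq]

end Probability

lemma summable_irregular_bound {N : ℕ → ℕ} {k : ℕ}
    (hN : Asymptotics.IsBigO atTop (fun n => (N n : ℝ)) fun n => (n : ℝ) ^ k) (p : ℕ) {c : ℝ}
    (hc : 0 < c) :
    Summable fun n : ℕ => (N n : ℝ) * (((n : ℝ) + 1) ^ (2 * p) *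
      (tailConst * n ^ 2 * Real.exp (-(√√√(n : ℝ) / c)))) := by
  -- Degrees: k for the number of trees, 2p for the boxes, 2 for the factor n², and 2 more for
  -- summability.
  set q : ℕ := k + (2 * p + (2 + 2)) with hq
  have hT : Tendsto (fun n : ℕ => √√√(n : ℝ)) atTop atTop :=
    Real.tendsto_sqrt_atTop.comp (Real.tendsto_sqrt_atTop.comp
      (Real.tendsto_sqrt_atTop.comp tendsto_natCast_atTop_atTop))
  have hexp : Asymptotics.IsBigO atTop (fun n : ℕ => Real.exp (-(√√√(n : ℝ) / c)))
      fun n => ((n : ℝ) ^ q)⁻¹ := by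
    have h1 := (isLittleO_exp_neg_mul_rpow_atTop (show 0 < 1 / c by positivity)
      (-(8 * q : ℕ) : ℝ)).isBigO.comp_tendsto hT
    refine (h1.congr_left fun n => ?_).congr_right fun n => ?_
    · simp only [Function.comp_apply]; congr 1; ring
    · simp only [Function.comp_apply]
      rw [Real.rpow_neg (Real.sqrt_nonneg _), Real.rpow_natCast, pow_mul]
      congr 2
      rw [show (8 : ℕ) = 2 * 2 * 2 from rfl, pow_mul, pow_mul, Real.sq_sqrt (Real.sqrt_nonneg _),
        Real.sq_sqrt (Real.sqrt_nonneg _), Real.sq_sqrt (Nat.cast_nonneg _)]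
  have hsucc : Asymptotics.IsBigO atTop (fun n : ℕ => ((n : ℝ) + 1) ^ (2 * p))
      fun n => (n : ℝ) ^ (2 * p) := by
    refine Asymptotics.IsBigO.pow ?_ _
    refine Asymptotics.IsBigO.of_bound 2 ?_
    filter_upwards [eventually_ge_atTop 1] with n hn
    have hn1 : (1 : ℝ) ≤ n := by exact_mod_cast hn
    rw [Real.norm_of_nonneg (by positivity), Real.norm_of_nonneg (by positivity)]
    linarith
  have h := hN.mul (hsucc.mul ((((Asymptotics.isBigO_refl (fun n : ℕ => (n : ℝ) ^ 2) atTop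
    ).const_mul_left tailConst)).mul hexp))
  refine summable_of_isBigO_nat (Real.summable_nat_pow_inv.2 (by norm_num : 1 < 2)) (h.trans ?_)
  refine Asymptotics.IsBigO.of_bound 1 ?_
  filter_upwards [eventually_ge_atTop 1] with n hn
  have hn0 : (0 : ℝ) < n := by exact_mod_cast hn
  rw [one_mul]
  refine le_of_eq (congrArg norm ?_)
  rw [hq, pow_add, pow_add, pow_add]
  field_simp

lemma MatrixBounds.mono {P : Fin M → Matrix (Fin n) (Fin n) ℝ} {K K' ρ ρ' : ℝ}
    (h : MatrixBounds P K ρ) (hK : K ≤ K') (hρ : ρ ≤ ρ') : MatrixBounds P K' ρ' :=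
  ⟨h.nonneg, fun m u => (h.op m u).trans (mul_le_mul_of_nonneg_right hK (by positivity)),
    fun m => (h.diag_sq m).trans hK, fun m i => (h.diag_le m i).trans hρ,
    fun m => (h.col m).trans hK⟩


section MatrixBounds

variable {Ω Θ : Type*} [MeasurableSpace Ω] [MeasurableSpace Θ] {μ : Measure Ω}
  [IsProbabilityMeasure μ] {F : Forest p Ω Θ}

lemma IsSUTForest.measurable_X (hF : IsSUTForest F μ) (n : ℕ) : Measurable (F.X n) :=
  measurable_pi_lambda _ fun i => hF.meas_x n i

/-- Almost surely, no bootstrap sample is spread irregularly over a well-filled box for large `n`. -/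
lemma ae_eventually_regular (hF : IsSUTForest F μ) {k : ℕ}
    (hM : Asymptotics.IsBigO atTop (fun n => (F.M n : ℝ)) fun n => (n : ℝ) ^ k) {c : ℝ}
    (hc : 1 ≤ c) :
    ∀ᵐ ω ∂μ, ∀ᶠ n in atTop, ∀ m s, F.b n m ω ∉ irregular (boxSet (F.X n ω) s) c := by
  set A : ℕ → Set Ω := fun n => {ω | 1 ≤ n ∧ ∃ m s, F.b n m ω ∈ irregular (boxSet (F.X n ω) s) c}
    with hA
  set f : ℕ → ℝ := fun n => (F.M n : ℝ) * (((n : ℝ) + 1) ^ (2 * p) *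
      (tailConst * n ^ 2 * Real.exp (-(√√√(n : ℝ) / c)))) with hf
  have hf0 : ∀ n, 0 ≤ f n := fun n => by simp only [hf, tailConst]; positivity
  have hAf : ∀ n, μ (A n) ≤ ENNReal.ofReal (f n) := by
    intro n
    rcases Nat.lt_or_ge n 1 with hn | hn
    · have : A n = ∅ := by
        ext ω; simp [hA, Nat.not_le.2 hn]
      rw [this, measure_empty]; exact zero_le
    · have hsub : A n ⊆ ⋃ m ∈ (Finset.univ : Finset (Fin (F.M n))),
          {ω | ∃ s, F.b n m ω ∈ irregular (boxSet (F.X n ω) s) c} := by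
        rintro ω ⟨-, m, s, h⟩
        simp only [Set.mem_iUnion, Finset.mem_univ, exists_prop, true_and]
        exact ⟨m, s, h⟩
      refine (measure_mono hsub).trans ((measure_biUnion_finset_le _ _).trans ?_)
      refine (Finset.sum_le_sum fun m _ => measure_irregular_le hn (hF.measurable_X n)
        (hF.meas_b n m) ?_ (hF.bootstrap n m) hc).trans (le_of_eq ?_)
      · have hm : Measurable fun z : (Fin (F.M n) → Fin n → Fin n) × (Fin (F.M n) → Θ) =>
            z.1 m := by fun_prop
        exact (hF.indep_rand n).comp hm measurable_fst
      · rw [Finset.sum_const, Finset.card_univ, Fintype.card_fin, nsmul_eq_mul, hf,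
          ENNReal.ofReal_mul (Nat.cast_nonneg _), ENNReal.ofReal_natCast]
  have hsum : ∑' n, μ (A n) ≠ ⊤ := by
    have hs : Summable f := summable_irregular_bound hM p (by linarith)
    refine ne_top_of_le_ne_top ?_ (ENNReal.tsum_le_tsum hAf)
    rw [← ENNReal.ofReal_tsum_of_nonneg hf0 hs]
    exact ENNReal.ofReal_ne_top
  filter_upwards [ae_eventually_notMem hsum] with ω hω
  filter_upwards [hω, eventually_ge_atTop 1] with n hn h1 m s hms
  exact hn ⟨h1, m, s, hms⟩

/-- Almost surely, the matrices of the trees satisfy uniform norm bounds for large `n`. -/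
lemma ae_eventually_matrixBounds (hF : IsSUTForest F μ)
    (hM : ∃ k : ℕ, Asymptotics.IsBigO atTop (fun n => (F.M n : ℝ)) fun n => (n : ℝ) ^ k)
    (h3 : LeafCondition F μ) :
    ∀ᵐ ω ∂μ, ∃ K : ℝ, 1 ≤ K ∧ ∀ᶠ n in atTop, MatrixBounds (F.mat n ω) K (K / √√(n : ℝ)) := by
  obtain ⟨k, hM⟩ := hM
  -- The constant in the leaf condition depends on ω; integer constants keep the exceptional null
  -- sets countable, and the random one is rounded up.
  have hreg : ∀ᵐ ω ∂μ, ∀ c : ℕ, 1 ≤ c → ∀ᶠ n in atTop, ∀ m s,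
      F.b n m ω ∉ irregular (boxSet (F.X n ω) s) (c : ℝ) := by
    rw [ae_all_iff]
    intro c
    by_cases hc : 1 ≤ c
    · filter_upwards [ae_eventually_regular hF hM (show (1 : ℝ) ≤ c by exact_mod_cast hc)]
        with ω hω _ using hω
    · exact ae_of_all _ fun ω h => absurd h hc
  filter_upwards [hreg, h3] with ω hω h3ω
  obtain ⟨c₀, hc₀⟩ := h3ω
  obtain ⟨c, hc⟩ := exists_nat_ge (max c₀ 1)
  have hc1 : 1 ≤ c := by exact_mod_cast (le_max_right c₀ 1).trans hc
  have hcc : c₀ ≤ c := (le_max_left _ _).trans hc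
  set K := max (c : ℝ) spreadConst with hK
  have hK1 : 1 ≤ K := one_le_spreadConst.trans (le_max_right _ _)
  refine ⟨K ^ 5, one_le_pow₀ hK1, ?_⟩
  filter_upwards [hω c hc1, hc₀, eventually_ge_atTop 1] with n h1 h2 hn
  have := matrixBounds_of_leafRegular (T := fun m => F.tree n m ω) (X := F.X n ω)
    (b := fun m => F.b n m ω) hn hK1 fun m => leafRegular_of_notMem_irregular
      (fun l hl => (h2 m l hl).trans (mul_le_mul_of_nonneg_right hcc (Nat.cast_nonneg _)))
      (h1 m)
  refine this.mono le_rfl (div_le_div_of_nonneg_right ?_ (Real.sqrt_nonneg _))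
  exact pow_le_pow_right₀ hK1 (by norm_num)

end MatrixBounds

/-! ### Factorization of conditional expectations -/

section CondProd

variable {Ω ι A B W : Type*} [Fintype ι] [MeasurableSpace Ω] [MeasurableSpace A]
  [MeasurableSpace B] [MeasurableSpace W] {μ : Measure Ω} [IsProbabilityMeasure μ]
  {x : ι → Ω → A} {y : ι → Ω → B} {r : Ω → W}

lemma integrable_prod_of_iIndepFun {X : ι → Ω → A} {f : ι → A → ℝ} (hX : ∀ i, Measurable (X i))
    (hind : iIndepFun X μ) (hf : ∀ i, Measurable (f i))
    (hint : ∀ i, Integrable (fun ω => f i (X i ω)) μ) :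
    Integrable (fun ω => ∏ i, f i (X i ω)) μ := by
  have h1 : ∀ i, Integrable (f i) (μ.map (X i)) := fun i =>
    (integrable_map_measure (hf i).aestronglyMeasurable (hX i).aemeasurable).2 (hint i)
  have : ∀ i, IsProbabilityMeasure (μ.map (X i)) := fun i =>
    Measure.isProbabilityMeasure_map (hX i).aemeasurable
  have h2 := Integrable.fintype_prod (f := f) h1
  rw [← hind.map_fun_eq_pi_map fun i => (hX i).aemeasurable] at h2
  exact h2.comp_measurable (measurable_pi_lambda _ hX)

/-- The indicator of a rectangle splits into one factor per observation and one for r, so both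
independence assumptions apply. Since f is arbitrary, it serves the product and its candidate
conditional expectation alike. -/
lemma integral_prod_rectangle (hx : ∀ i, Measurable (x i)) (hy : ∀ i, Measurable (y i))
    (hr : Measurable r) (h1 : iIndepFun (fun i ω => (x i ω, y i ω)) μ)
    (h2 : IndepFun r (fun ω i => (x i ω, y i ω)) μ) {f : ι → A × B → ℝ}
    (hf : ∀ i, Measurable (f i)) {S : ι → Set A} (hS : ∀ i, MeasurableSet (S i)) {T : Set W}
    (hT : MeasurableSet T) :
    ∫ ω in (fun ω => ((fun i => x i ω), r ω)) ⁻¹' (Set.univ.pi S ×ˢ T),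
        ∏ i, f i (x i ω, y i ω) ∂μ
      = (∫ ω, T.indicator (fun _ => (1 : ℝ)) (r ω) ∂μ)
        * ∏ i, ∫ ω in x i ⁻¹' S i, f i (x i ω, y i ω) ∂μ := by
  classical
  set g : ι → A × B → ℝ := fun i z => (S i).indicator (fun _ => (1 : ℝ)) z.1 * f i z with hg
  have hgm : ∀ i, Measurable (g i) := fun i =>
    ((measurable_const.indicator (hS i)).comp measurable_fst).mul (hf i)
  have hxy : ∀ i, Measurable fun ω => (x i ω, y i ω) := fun i => (hx i).prodMk (hy i)
  have hZ : MeasurableSet ((fun ω => ((fun i => x i ω), r ω)) ⁻¹' (Set.univ.pi S ×ˢ T)) :=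
    ((measurable_pi_lambda _ hx).prodMk hr) ((MeasurableSet.univ_pi hS).prod hT)
  rw [← integral_indicator hZ]
  have hpt : ((fun ω => ((fun i => x i ω), r ω)) ⁻¹' (Set.univ.pi S ×ˢ T)).indicator
      (fun ω => ∏ i, f i (x i ω, y i ω))
      = fun ω => T.indicator (fun _ => (1 : ℝ)) (r ω) * ∏ i, g i (x i ω, y i ω) := by
    funext ω
    by_cases hω : ω ∈ (fun ω => ((fun i => x i ω), r ω)) ⁻¹' (Set.univ.pi S ×ˢ T)
    · rw [Set.indicator_of_mem hω]
      obtain ⟨ha, hb⟩ := hω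
      rw [Set.indicator_of_mem hb, one_mul]
      refine Finset.prod_congr rfl fun i _ => ?_
      rw [hg]
      simp only
      rw [Set.indicator_of_mem (ha i (Set.mem_univ i)), one_mul]
    · rw [Set.indicator_of_notMem hω]
      by_cases hb : r ω ∈ T
      · have : ∃ i, x i ω ∉ S i := by
          by_contra hc
          push Not at hc
          exact hω ⟨fun i _ => hc i, hb⟩
        obtain ⟨i, hi⟩ := this
        rw [Finset.prod_eq_zero (Finset.mem_univ i), mul_zero]
        simp [hg, hi]
      · rw [Set.indicator_of_notMem hb, zero_mul]
  rw [hpt]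
  have e1 : ∫ ω, T.indicator (fun _ => (1 : ℝ)) (r ω) * ∏ i, g i (x i ω, y i ω) ∂μ
      = (∫ ω, T.indicator (fun _ => (1 : ℝ)) (r ω) ∂μ) * ∫ ω, ∏ i, g i (x i ω, y i ω) ∂μ :=
    h2.integral_fun_comp_mul_comp (f := T.indicator fun _ => (1 : ℝ))
      (g := fun z : ι → A × B => ∏ i, g i (z i))
      hr.aemeasurable (measurable_pi_lambda _ hxy).aemeasurable
      (measurable_const.indicator hT).aestronglyMeasurable
      (Finset.measurable_prod _ fun i _ =>
        (hgm i).comp (measurable_pi_apply i)).aestronglyMeasurable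
  rw [e1, h1.integral_fun_prod_comp (f := g) (fun i => (hxy i).aemeasurable)
    fun i => (hgm i).aestronglyMeasurable]
  congr 1
  refine Finset.prod_congr rfl fun i _ => ?_
  rw [← integral_indicator (hx i (hS i))]
  refine integral_congr_ae (ae_of_all _ fun ω => ?_)
  by_cases hi : x i ω ∈ S i
  · rw [Set.indicator_of_mem (show ω ∈ x i ⁻¹' S i from hi)]
    simp [hg, hi]
  · rw [Set.indicator_of_notMem (show ω ∉ x i ⁻¹' S i from hi)]
    simp [hg, hi]

/-- For independent pairs `(x i, y i)`, independent of `r`, conditional expectations given all the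
`x i` and `r` factorize. -/
lemma condExp_prod_of_indep (hx : ∀ i, Measurable (x i)) (hy : ∀ i, Measurable (y i))
    (hr : Measurable r) (h1 : iIndepFun (fun i ω => (x i ω, y i ω)) μ)
    (h2 : IndepFun r (fun ω i => (x i ω, y i ω)) μ) {f : ι → A × B → ℝ}
    (hf : ∀ i, Measurable (f i)) (hint : ∀ i, Integrable (fun ω => f i (x i ω, y i ω)) μ) :
    μ[fun ω => ∏ i, f i (x i ω, y i ω) |
        MeasurableSpace.comap (fun ω => ((fun i => x i ω), r ω)) inferInstance]
      =ᵐ[μ] fun ω => ∏ i, (μ[fun ω => f i (x i ω, y i ω) |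
        MeasurableSpace.comap (x i) inferInstance]) ω := by
  set Z : Ω → (ι → A) × W := fun ω => ((fun i => x i ω), r ω) with hZdef
  have hZ : Measurable Z := (measurable_pi_lambda _ hx).prodMk hr
  have hxy : ∀ i, Measurable fun ω => (x i ω, y i ω) := fun i => (hx i).prodMk (hy i)
  choose h hhm hh using fun i => (stronglyMeasurable_condExp (m := MeasurableSpace.comap (x i)
    inferInstance) (μ := μ) (f := fun ω => f i (x i ω, y i ω))).exists_eq_measurable_comp
  have hh' : ∀ i ω, (μ[fun ω => f i (x i ω, y i ω) |
      MeasurableSpace.comap (x i) inferInstance]) ω = h i (x i ω) := fun i ω => congrFun (hh i) ω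
  have hhint : ∀ i, Integrable (fun ω => h i (x i ω)) μ := fun i => by
    have : Integrable (μ[fun ω => f i (x i ω, y i ω) |
      MeasurableSpace.comap (x i) inferInstance]) μ := integrable_condExp
    rw [hh i] at this
    exact this
  have hk : ∀ i, Measurable (fun z : A × B => h i z.1) := fun i =>
    (hhm i).measurable.comp measurable_fst
  simp only [hh']
  have hΦ : Integrable (fun ω => ∏ i, f i (x i ω, y i ω)) μ :=
    integrable_prod_of_iIndepFun hxy h1 hf hint
  have hΨ : Integrable (fun ω => ∏ i, h i (x i ω)) μ :=
    integrable_prod_of_iIndepFun (f := fun i z => h i z.1) hxy h1 hk hhint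
  have hrect : ∀ (S : ι → Set A) (T : Set W), (∀ i, MeasurableSet (S i)) → MeasurableSet T →
      ∫ ω in Z ⁻¹' (Set.univ.pi S ×ˢ T), ∏ i, h i (x i ω) ∂μ
        = ∫ ω in Z ⁻¹' (Set.univ.pi S ×ˢ T), ∏ i, f i (x i ω, y i ω) ∂μ := by
    intro S T hS hT
    have a1 := integral_prod_rectangle hx hy hr h1 h2 hf hS hT
    have a2 := integral_prod_rectangle hx hy hr h1 h2 hk hS hT
    refine a2.trans (Eq.trans ?_ a1.symm)
    congr 1
    refine Finset.prod_congr rfl fun i _ => ?_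
    have := setIntegral_condExp (m := MeasurableSpace.comap (x i) inferInstance)
      (hx i).comap_le (hint i) (s := x i ⁻¹' S i) ⟨S i, hS i, rfl⟩
    simpa only [hh'] using this
  refine (ae_eq_condExp_of_forall_setIntegral_eq hZ.comap_le hΦ
    (fun s _ _ => hΨ.integrableOn) ?_ ?_).symm
  · rintro _ ⟨t, ht, rfl⟩ -
    -- Rectangles form a generating π-system, so the equality of integrals extends from them by
    -- Dynkin's argument.
    have hgen : (inferInstance : MeasurableSpace ((ι → A) × W))
        = MeasurableSpace.generateFrom (Set.image2 (· ×ˢ ·)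
          (Set.univ.pi '' Set.univ.pi fun _ : ι => {s : Set A | MeasurableSet s})
          {T : Set W | MeasurableSet T}) := by
      have hp := generateFrom_prod_eq (C := Set.univ.pi '' Set.univ.pi
          fun _ : ι => {s : Set A | MeasurableSet s}) (D := {T : Set W | MeasurableSet T})
        (IsCountablySpanning.pi fun _ => isCountablySpanning_measurableSet)
        isCountablySpanning_measurableSet
      rw [← hp, generateFrom_pi, MeasurableSpace.generateFrom_measurableSet]
    have hpi := isPiSystem_pi (α := fun _ : ι => A) |>.prod
      (MeasurableSpace.isPiSystem_measurableSet (α := W))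
    have hunivset : Z ⁻¹' (Set.univ.pi (fun _ : ι => (Set.univ : Set A)) ×ˢ (Set.univ : Set W))
        = Set.univ := by ext; simp
    have htot : ∫ ω, ∏ i, h i (x i ω) ∂μ = ∫ ω, ∏ i, f i (x i ω, y i ω) ∂μ := by
      have := hrect (fun _ => Set.univ) Set.univ (fun _ => MeasurableSet.univ) MeasurableSet.univ
      rwa [hunivset, setIntegral_univ, setIntegral_univ] at this
    induction t, ht using MeasurableSpace.induction_on_inter hgen hpi with
    | empty => simp
    | basic t ht =>
      obtain ⟨_, ⟨S, hS, rfl⟩, T, hT, rfl⟩ := ht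
      exact hrect S T (fun i => hS i (Set.mem_univ i)) hT
    | compl t ht ih =>
      rw [Set.preimage_compl, setIntegral_compl (hZ ht) hΨ, setIntegral_compl (hZ ht) hΦ, ih, htot]
    | iUnion t hd ht ih =>
      rw [Set.preimage_iUnion, integral_iUnion (fun i => hZ (ht i))
        (fun i j hij => (hd hij).preimage _) hΨ.integrableOn,
        integral_iUnion (fun i => hZ (ht i)) (fun i j hij => (hd hij).preimage _) hΦ.integrableOn]
      exact tsum_congr ih
  · have hm : Measurable[MeasurableSpace.comap Z inferInstance] fun ω => ∏ i, h i (x i ω) := by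
      have : Measurable fun z : (ι → A) × W => ∏ i, h i (z.1 i) :=
        Finset.measurable_prod _ fun i _ =>
          (hhm i).measurable.comp ((measurable_pi_apply i).comp measurable_fst)
      exact this.comp (comap_measurable Z)
    exact hm.stronglyMeasurable.aestronglyMeasurable

end CondProd

/-! ### Conditional moments of the errors -/

lemma abs_pow_le_one_add_pow_four (x : ℝ) {a : ℕ} (ha : a ≤ 4) : |x ^ a| ≤ 1 + x ^ 4 := by
  rw [abs_pow]
  have h4 : x ^ 4 = |x| ^ 4 := by rw [← abs_pow, abs_of_nonneg (by positivity)]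
  rw [h4]
  rcases le_total |x| 1 with h | h
  · have := pow_le_one₀ (n := a) (abs_nonneg x) h
    have : 0 ≤ |x| ^ 4 := by positivity
    linarith
  · have := pow_le_pow_right₀ h ha
    linarith

section

variable {Ω Θ : Type*} [MeasurableSpace Ω] [MeasurableSpace Θ] {μ : Measure Ω}
  [IsProbabilityMeasure μ] {F : Forest p Ω Θ}

/-- The conditional moment of order `a` of the error of observation `i`, given `xᵢ`. -/
def errMoment (F : Forest p Ω Θ) (μ : Measure Ω) (n : ℕ) (i : Fin n) (a : ℕ) : Ω → ℝ :=
  μ[fun ω => F.err μ n i ω ^ a | MeasurableSpace.comap (F.x n i) inferInstance]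

lemma IsSUTForest.info_le (hF : IsSUTForest F μ) (n : ℕ) :
    F.info n ≤ (inferInstance : MeasurableSpace Ω) :=
  Measurable.comap_le (f := fun ω => (F.X n ω, (fun m => F.b n m ω), (fun m => F.θ n m ω)))
    ((hF.measurable_X n).prodMk ((measurable_pi_lambda _ fun m => hF.meas_b n m).prodMk
      (measurable_pi_lambda _ fun m => hF.meas_θ n m)))

lemma IsSUTForest.measurable_mean (hF : IsSUTForest F μ) (n : ℕ) (i : Fin n) :
    Measurable (F.mean μ n i) :=
  (stronglyMeasurable_condExp.mono (hF.meas_x n i).comap_le).measurable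

lemma IsSUTForest.measurable_err (hF : IsSUTForest F μ) (n : ℕ) (i : Fin n) :
    Measurable (F.err μ n i) :=
  (hF.meas_y n i).sub (hF.measurable_mean n i)

lemma IsSUTForest.integrable_err_pow (hF : IsSUTForest F μ) {n : ℕ} {i : Fin n}
    (h : Integrable (fun ω => F.err μ n i ω ^ 4) μ) {a : ℕ} (ha : a ≤ 4) :
    Integrable (fun ω => F.err μ n i ω ^ a) μ := by
  have hm := hF.measurable_err n i
  refine ((integrable_const (1 : ℝ)).add h).mono' (by fun_prop) (ae_of_all _ fun ω => ?_)
  exact abs_pow_le_one_add_pow_four _ ha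

/-- The conditional mean is a function on Ω; written as a Borel function of x_i, it makes every
power of the error a function of the pair (x_i, y_i), and these pairs are independent. -/
lemma condExp_prod_err (hF : IsSUTForest F μ) {n : ℕ}
    (h : ∀ i, Integrable (fun ω => F.err μ n i ω ^ 4) μ) {α : Fin n → ℕ} (hα : ∀ i, α i ≤ 4) :
    μ[fun ω => ∏ i, F.err μ n i ω ^ α i | F.info n]
      =ᵐ[μ] fun ω => ∏ i, errMoment F μ n i (α i) ω := by
  choose g hgm hg using fun i => (stronglyMeasurable_condExp (m := MeasurableSpace.comap (F.x n i)
    inferInstance) (μ := μ) (f := F.y n i)).exists_eq_measurable_comp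
  have hg' : ∀ i ω, F.mean μ n i ω = g i (F.x n i ω) := fun i ω => congrFun (hg i) ω
  have hind : IndepFun (fun ω => ((fun m => F.b n m ω), (fun m => F.θ n m ω)))
      (fun ω i => (F.x n i ω, F.y n i ω)) μ := by
    have hm : Measurable fun z : (Fin n → Fin p → ℝ) × (Fin n → ℝ) => fun i => (z.1 i, z.2 i) := by
      fun_prop
    exact (hF.indep_rand n).comp measurable_id hm
  have key := condExp_prod_of_indep (f := fun i z => (z.2 - g i z.1) ^ α i) (hF.meas_x n)
    (hF.meas_y n) ((measurable_pi_lambda _ fun m => hF.meas_b n m).prodMk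
      (measurable_pi_lambda _ fun m => hF.meas_θ n m)) (hF.indep_obs n) hind
    (fun i => by
      have := (hgm i).measurable
      fun_prop)
    (fun i => by
      have := hF.integrable_err_pow (h i) (hα i)
      simpa only [Forest.err, hg'] using this)
  simp only [errMoment, Forest.err, hg']
  exact key

lemma errMoment_zero (F : Forest p Ω Θ) (hF : IsSUTForest F μ) (n : ℕ) (i : Fin n) :
    errMoment F μ n i 0 = fun _ => 1 := by
  simp only [errMoment, pow_zero]
  exact condExp_const (hF.meas_x n i).comap_le 1

lemma errMoment_one (hF : IsSUTForest F μ) (n : ℕ) (i : Fin n) :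
    errMoment F μ n i 1 =ᵐ[μ] 0 := by
  simp only [errMoment, pow_one]
  have hle := (hF.meas_x n i).comap_le
  have h1 := condExp_sub (hF.integrable_y n i) (g := F.mean μ n i) integrable_condExp
    (MeasurableSpace.comap (F.x n i) inferInstance)
  have h2 : μ[F.mean μ n i | MeasurableSpace.comap (F.x n i) inferInstance] = F.mean μ n i :=
    condExp_of_stronglyMeasurable hle stronglyMeasurable_condExp integrable_condExp
  rw [h2] at h1
  refine Filter.EventuallyEq.trans ?_ (h1.trans ?_)
  · exact Filter.EventuallyEq.rfl
  · refine ae_of_all _ fun ω => ?_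
    exact sub_self _

variable [StandardBorelSpace Ω]

lemma ae_integral_prod_err (hF : IsSUTForest F μ) {n : ℕ}
    (h : ∀ i, Integrable (fun ω => F.err μ n i ω ^ 4) μ) {α : Fin n → ℕ} (hα : ∀ i, α i ≤ 4)
    {f : Ω → ℝ} (hf : ∀ ω, ∏ i, F.err μ n i ω ^ α i = f ω) (hfi : Integrable f μ) :
    ∀ᵐ ω ∂μ, ∫ ω', f ω' ∂(condExpKernel μ (F.info n) ω) = ∏ i, errMoment F μ n i (α i) ω := by
  have hf' : (fun ω => ∏ i, F.err μ n i ω ^ α i) = f := funext hf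
  have h1 := condExp_prod_err hF h hα
  rw [hf'] at h1
  filter_upwards [h1, condExp_ae_eq_integral_condExpKernel (hF.info_le n) hfi] with ω a1 a2
  rw [← a2, a1]

/-- Given the predictors and the trees, the errors are almost surely centred and uncorrelated up to
order four, with bounded fourth moments. -/
lemma ae_errorMoments (hF : IsSUTForest F μ) {n : ℕ} {v : ℝ}
    (hv : ∀ i, Integrable (fun ω => F.err μ n i ω ^ 4) μ ∧
      ∀ᵐ ω ∂μ, errMoment F μ n i 4 ω ≤ v) :
    ∀ᵐ ω ∂μ, ErrorMoments (condExpKernel μ (F.info n) ω) (F.err μ n)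
      (fun i => errMoment F μ n i 2 ω) (1 + v) := by
  have h4 := fun i => (hv i).1
  have hm := hF.measurable_err (μ := μ) n
  set e := F.err μ n with he
  have i4 : ∀ i j k l, Integrable (fun ω => e i ω * e j ω * (e k ω * e l ω)) μ := by
    intro i j k l
    refine Integrable.mono' (((h4 i).add (h4 j)).add ((h4 k).add (h4 l))) (by fun_prop)
      (ae_of_all _ fun ω => abs_mul_mul_le _ _ _ _)
  have i2 : ∀ i j, Integrable (fun ω => e i ω * e j ω) μ := by
    intro i j
    refine Integrable.mono' ((integrable_const (1 : ℝ)).add ((h4 i).add (h4 j))) (by fun_prop)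
      (ae_of_all _ fun ω => abs_mul_le _ _)
  have i1 : ∀ i, Integrable (e i) μ := fun i => by
    simpa only [pow_one] using hF.integrable_err_pow (h4 i) (show 1 ≤ 4 by norm_num)
  -- Indicator exponents write every monomial as a product over all observations, so a single
  -- factorization covers all index coincidences.
  have hone : ∀ i ω, ∏ r, e r ω ^ (if r = i then 1 else 0) = e i ω := by
    intro i ω
    simp [pow_ite, Finset.prod_ite_eq']
  have a4 : ∀ᵐ ω ∂μ, ∀ i j k l, ∫ ω', e i ω' * e j ω' * (e k ω' * e l ω')
      ∂(condExpKernel μ (F.info n) ω) = ∏ r, errMoment F μ n r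
        (((if r = i then 1 else 0) + (if r = j then 1 else 0))
          + ((if r = k then 1 else 0) + (if r = l then 1 else 0))) ω := by
    simp only [ae_all_iff]
    intro i j k l
    refine ae_integral_prod_err hF h4 (fun r => ?_) (fun ω => ?_) (i4 i j k l)
    · split_ifs <;> norm_num
    · simp only [pow_add, Finset.prod_mul_distrib, ← he, hone]
  have a2 : ∀ᵐ ω ∂μ, ∀ i j, ∫ ω', e i ω' * e j ω'
      ∂(condExpKernel μ (F.info n) ω) = ∏ r, errMoment F μ n r
        ((if r = i then 1 else 0) + (if r = j then 1 else 0)) ω := by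
    simp only [ae_all_iff]
    intro i j
    refine ae_integral_prod_err hF h4 (fun r => ?_) (fun ω => ?_) (i2 i j)
    · split_ifs <;> norm_num
    · simp only [pow_add, Finset.prod_mul_distrib, ← he, hone]
  have a1 : ∀ᵐ ω ∂μ, ∀ i, ∫ ω', e i ω'
      ∂(condExpKernel μ (F.info n) ω) = ∏ r, errMoment F μ n r (if r = i then 1 else 0) ω := by
    simp only [ae_all_iff]
    intro i
    refine ae_integral_prod_err hF h4 (fun r => ?_) (fun ω => ?_) (i1 i)
    · split_ifs <;> norm_num
    · simp only [← he, hone]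
  have b1 : ∀ᵐ ω ∂μ, ∀ i, errMoment F μ n i 1 ω = 0 := by
    rw [ae_all_iff]; exact fun i => errMoment_one hF n i
  have b4 : ∀ᵐ ω ∂μ, ∀ i, errMoment F μ n i 4 ω ≤ v := by
    rw [ae_all_iff]; exact fun i => (hv i).2
  have c4 : ∀ᵐ ω ∂μ, ∀ i, Integrable (fun ω => e i ω ^ 4) (condExpKernel μ (F.info n) ω) := by
    rw [ae_all_iff]; exact fun i => (h4 i).condExpKernel_ae
  filter_upwards [a4, a2, a1, b1, b4, c4] with ω a4 a2 a1 b1 b4 c4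
  have b0 : ∀ i, errMoment F μ n i 0 ω = 1 := fun i => congrFun (errMoment_zero F hF n i) ω
  have hvar : ∀ i, ∫ ω', e i ω' * e i ω' ∂(condExpKernel μ (F.info n) ω)
      = errMoment F μ n i 2 ω := by
    intro i
    rw [a2, Finset.prod_eq_single i]
    · simp
    · intro r _ hr; simp [hr, b0]
    · simp
  have hfour : ∀ i, ∫ ω', e i ω' ^ 4 ∂(condExpKernel μ (F.info n) ω)
      = errMoment F μ n i 4 ω := by
    intro i
    have := a4 i i i i
    rw [Finset.prod_eq_single i] at this
    · simp only [if_true] at this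
      rw [← this]
      exact integral_congr_ae (ae_of_all _ fun ω => by ring)
    · intro r _ hr; simp [hr, b0]
    · simp
  refine ⟨hm, c4, fun i => ?_, fun i j hij => ?_, hvar, fun i j k l hij hik hil => ?_,
    fun i j hij => ?_, fun i => ?_, fun i => ?_⟩
  · rw [a1]
    exact Finset.prod_eq_zero (Finset.mem_univ i) (by simp [b1])
  · rw [a2]
    exact Finset.prod_eq_zero (Finset.mem_univ i) (by simp [b1, hij])
  · rw [a4]
    exact Finset.prod_eq_zero (Finset.mem_univ i) (by simp [b1, hij, hik, hil])
  · rw [a4, ← Finset.mul_prod_erase _ _ (Finset.mem_univ i),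
      ← Finset.mul_prod_erase _ _ (Finset.mem_erase.2 ⟨hij.symm, Finset.mem_univ j⟩),
      Finset.prod_eq_one]
    · simp [hij, hij.symm]
    · intro r hr
      simp only [Finset.mem_erase] at hr
      simp [hr.1, hr.2.1, b0]
  · rw [hfour]; linarith [b4 i]
  · rw [← hvar]
    -- From e² ≤ 1 + e⁴, which is why the common moment bound is 1 + v.
    have h1 : ∫ ω', e i ω' * e i ω' ∂(condExpKernel μ (F.info n) ω)
        ≤ ∫ ω', (1 + e i ω' ^ 4) ∂(condExpKernel μ (F.info n) ω) := by
      refine integral_mono_of_nonneg (ae_of_all _ fun ω => mul_self_nonneg _)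
        ((integrable_const _).add (c4 i)) (ae_of_all _ fun ω => ?_)
      have := (abs_le.1 (abs_pow_le_one_add_pow_four (e i ω) (show 2 ≤ 4 by norm_num))).2
      rw [sq] at this
      exact this
    rw [integral_add (integrable_const _) (c4 i), hfour] at h1
    simp only [integral_const, probReal_univ, smul_eq_mul, mul_one] at h1
    linarith [b4 i]

end

/-! ### Regular conditional probabilities -/

section Kernel

variable {Ω : Type*} {m : MeasurableSpace Ω} [mΩ : MeasurableSpace Ω] [StandardBorelSpace Ω]
  {μ : Measure Ω} [IsFiniteMeasure μ]

/-- Almost sure properties hold almost surely under a regular conditional probability. -/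
lemma ae_ae_condExpKernel (hm : m ≤ mΩ) {q : Ω → Prop} (h : ∀ᵐ ω ∂μ, q ω) :
    ∀ᵐ ω ∂μ, ∀ᵐ ω' ∂(condExpKernel μ m ω), q ω' := by
  refine ae_of_ae_trim hm (Measure.ae_ae_of_ae_comp ?_)
  rwa [condExpKernel_comp_trim hm]

/-- What is measurable with respect to the conditioning σ-algebra is almost surely constant under
the regular conditional probability. -/
lemma ae_condExpKernel_eq (hm : m ≤ mΩ) {f : Ω → ℝ} (hf : Measurable[m] f) :
    ∀ᵐ ω ∂μ, ∀ᵐ ω' ∂(condExpKernel μ m ω), f ω' = f ω := by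
  -- The sublevel sets have conditional probability 0 or 1, according to their indicator at ω;
  -- countably many rational levels pin down the value of f.
  have hq : ∀ᵐ ω ∂μ, ∀ q : ℚ, ∀ᵐ ω' ∂(condExpKernel μ m ω), (f ω' < q ↔ f ω < q) := by
    rw [ae_all_iff]
    intro q
    have hsm : MeasurableSet[m] {ω | f ω < q} := 
      hf measurableSet_Iio
    have hs := hm _ hsm
    have h1 := condExpKernel_ae_eq_condExp (μ := μ) hm hs
    have h2 := condExpKernel_ae_eq_condExp (μ := μ) hm hs.compl
    rw [condExp_of_stronglyMeasurable hm
      ((@stronglyMeasurable_const _ _ m _ _).indicator hsm)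
      ((integrable_const _).indicator hs)] at h1
    rw [condExp_of_stronglyMeasurable hm
      ((@stronglyMeasurable_const _ _ m _ _).indicator hsm.compl)
      ((integrable_const _).indicator hs.compl)] at h2
    filter_upwards [h1, h2] with ω h1 h2
    by_cases hω : f ω < q
    · have : (condExpKernel μ m ω).real {ω | f ω < q}ᶜ = 0 := by
        rw [h2]; simp [hω]
      rw [measureReal_eq_zero_iff] at this
      filter_upwards [compl_mem_ae_iff.2 this] with ω' h'
      simp only [compl_compl] at h'
      exact ⟨fun _ => hω, fun _ => h'⟩
    · have : (condExpKernel μ m ω).real {ω | f ω < q} = 0 := by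
        rw [h1]; simp [hω]
      rw [measureReal_eq_zero_iff] at this
      filter_upwards [compl_mem_ae_iff.2 this] with ω' h'
      exact ⟨fun h => absurd h h', fun h => absurd h hω⟩
  filter_upwards [hq] with ω hω
  filter_upwards [ae_all_iff.2 hω] with ω' h
  rcases lt_trichotomy (f ω') (f ω) with h' | h' | h'
  · obtain ⟨q, a, b⟩ := exists_rat_btwn h'
    exact absurd ((h q).1 a) (not_lt.2 b.le)
  · exact h'
  · obtain ⟨q, a, b⟩ := exists_rat_btwn h'
    exact absurd ((h q).2 a) (not_lt.2 b.le)

lemma lintegral_condExpKernel (hm : m ≤ mΩ) {s : Set Ω} (hs : MeasurableSet s) :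
    ∫⁻ ω, condExpKernel μ m ω s ∂μ = μ s := by
  conv_rhs => rw [← condExpKernel_comp_trim (μ := μ) hm]
  rw [Measure.bind_apply hs (Kernel.aemeasurable _), lintegral_trim hm (measurable_condExpKernel hs)]

/-- Sets whose conditional probabilities tend to zero almost surely tend to zero in probability. -/
lemma tendsto_measure_of_condExpKernel {m : ℕ → MeasurableSpace Ω} (hm : ∀ n, m n ≤ mΩ)
    {s : ℕ → Set Ω} (hs : ∀ n, MeasurableSet (s n))
    (h : ∀ᵐ ω ∂μ, Tendsto (fun n => condExpKernel μ (m n) ω (s n)) atTop (𝓝 0)) :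
    Tendsto (fun n => μ (s n)) atTop (𝓝 0) := by
  have := tendsto_lintegral_of_dominated_convergence (μ := μ) (fun _ => 1)
    (fun n => (measurable_condExpKernel (μ := μ) (m := m n) (hs n)).mono (hm n) le_rfl)
    (fun n => ae_of_all _ fun ω => prob_le_one) (by simp) h
  simpa only [lintegral_condExpKernel (hm _) (hs _), lintegral_zero] using this

end Kernel

/-! ### Measurability and the bias-variance formula -/

lemma measurable_ciInf_of_continuous {Ω α : Type*} [MeasurableSpace Ω] [TopologicalSpace α]
    [CompactSpace α] [SecondCountableTopology α] [Nonempty α] {f : α → Ω → ℝ}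
    (hc : ∀ ω, Continuous fun a => f a ω) (hf : ∀ a, Measurable (f a)) :
    Measurable fun ω => ⨅ a, f a ω := by
  obtain ⟨s, hsc, hsd⟩ := TopologicalSpace.exists_countable_dense α
  have h : ∀ ω, ⨅ a, f a ω = ⨅ a : s, f a ω := fun ω =>
    (hsd.ciInf (hc ω) (isCompact_range (hc ω)).bddBelow).symm
  simp only [h]
  have := hsc.to_subtype
  have : Nonempty s := hsd.nonempty.to_subtype
  exact Measurable.iInf fun a => hf a

lemma continuous_sqLoss (P : Fin M → Matrix (Fin n) (Fin n) ℝ) (mu y : Fin n → ℝ) :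
    Continuous (sqLoss P mu y) := by
  unfold sqLoss
  simp only [weighted_mulVec]
  fun_prop

lemma continuous_risk (P : Fin M → Matrix (Fin n) (Fin n) ℝ) (mu s : Fin n → ℝ) :
    Continuous (risk P mu s) := by
  unfold risk
  simp only [weighted_mulVec, weighted_apply]
  fun_prop

section

variable {Ω : Type*} [MeasurableSpace Ω]

lemma measurable_sqLoss {P : Ω → Fin M → Matrix (Fin n) (Fin n) ℝ} {mu y : Fin n → Ω → ℝ}
    {w : Ω → Fin M → ℝ} (hP : ∀ m i j, Measurable fun ω => P ω m i j)
    (hmu : ∀ i, Measurable (mu i)) (hy : ∀ i, Measurable (y i)) (hw : Measurable w) :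
    Measurable fun ω => sqLoss (P ω) (fun i => mu i ω) (fun i => y i ω) (w ω) := by
  unfold sqLoss
  simp only [weighted_apply, Matrix.mulVec, dotProduct]
  fun_prop

lemma measurable_risk {P : Ω → Fin M → Matrix (Fin n) (Fin n) ℝ} {mu s : Fin n → Ω → ℝ}
    {w : Ω → Fin M → ℝ} (hP : ∀ m i j, Measurable fun ω => P ω m i j)
    (hmu : ∀ i, Measurable (mu i)) (hs : ∀ i, Measurable (s i)) (hw : Measurable w) :
    Measurable fun ω => risk (P ω) (fun i => mu i ω) (fun i => s i ω) (w ω) := by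
  unfold risk
  simp only [weighted_apply, Matrix.mulVec, dotProduct]
  fun_prop

/-- The expected loss of fixed weights is given by the bias-variance decomposition. -/
lemma ErrorMoments.integral_sqLoss {ν : Measure Ω} [IsProbabilityMeasure ν] {e : Fin n → Ω → ℝ}
    {s : Fin n → ℝ} {V : ℝ} (he : ErrorMoments ν e s V)
    (P : Fin M → Matrix (Fin n) (Fin n) ℝ) (mu : Fin n → ℝ) (w : Fin M → ℝ) :
    ∫ ω, sqLoss P mu (mu + fun i => e i ω) w ∂ν = risk P mu s w := by
  have h1 : ∀ i, Integrable (fun ω => (weighted P w).mulVec (fun j => e j ω) i) ν := fun i => by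
    simp only [Matrix.mulVec, dotProduct]
    exact integrable_finsetSum _ fun j _ => (he.integrable_one j).const_mul _
  have h0 : ∀ i, ∫ ω, (weighted P w).mulVec (fun j => e j ω) i ∂ν = 0 := fun i => by
    simp only [Matrix.mulVec, dotProduct]
    rw [integral_finsetSum _ fun j _ => (he.integrable_one j).const_mul _]
    exact Finset.sum_eq_zero fun j _ => by rw [integral_const_mul, he.mean_zero, mul_zero]
  have h2 : ∀ i, Integrable (fun ω => (weighted P w).mulVec (fun j => e j ω) i ^ 2) ν ∧
      ∫ ω, (weighted P w).mulVec (fun j => e j ω) i ^ 2 ∂ν = ∑ j, weighted P w i j ^ 2 * s j :=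
    fun i => he.integral_linear_sq (fun j => weighted P w i j)
  have h3 : Integrable (fun ω => ∑ i, (mu i - (weighted P w).mulVec mu i)
      * (weighted P w).mulVec (fun j => e j ω) i) ν :=
    integrable_finsetSum _ fun i _ => (h1 i).const_mul _
  have h4 : ∫ ω, ∑ i, (mu i - (weighted P w).mulVec mu i)
      * (weighted P w).mulVec (fun j => e j ω) i ∂ν = 0 := by
    rw [integral_finsetSum _ fun i _ => (h1 i).const_mul _]
    exact Finset.sum_eq_zero fun i _ => by rw [integral_const_mul, h0, mul_zero]
  have h5 : Integrable (fun ω => ∑ i, (weighted P w).mulVec (fun j => e j ω) i ^ 2) ν :=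
    integrable_finsetSum _ fun i _ => (h2 i).1
  have h6 : ∫ ω, ∑ i, (weighted P w).mulVec (fun j => e j ω) i ^ 2 ∂ν
      = ∑ i, ∑ j, weighted P w i j ^ 2 * s j := by
    rw [integral_finsetSum _ fun i _ => (h2 i).1]
    exact Finset.sum_congr rfl fun i _ => (h2 i).2
  have key : ∀ {A B : Ω → ℝ} (c d : ℝ), Integrable A ν → Integrable B ν →
      ∫ ω, (c - 2 * A ω + (B ω - d)) ∂ν = c - 2 * ∫ ω, A ω ∂ν + (∫ ω, B ω ∂ν - d) := by
    intro A B c d hA hB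
    have i1 : Integrable (fun ω => c - 2 * A ω) ν := (integrable_const c).sub (hA.const_mul 2)
    have i2 : Integrable (fun ω => B ω - d) ν := hB.sub (integrable_const d)
    rw [integral_add i1 i2, integral_sub (integrable_const c) (hA.const_mul 2),
      integral_sub hB (integrable_const d), integral_const_mul]
    simp
  simp only [sqLoss_eq_risk_add P mu s]
  refine (key _ _ h3 h5).trans ?_
  rw [h4, h6]
  simp

end

section

variable {Ω Θ : Type*} [MeasurableSpace Ω] [MeasurableSpace Θ] {μ : Measure Ω}
  [IsProbabilityMeasure μ] {F : Forest p Ω Θ}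

/-- The bias-variance formula for the risk of the weights `w`. -/
def biasVarRisk (F : Forest p Ω Θ) (μ : Measure Ω) (n : ℕ) (w : Fin (F.M n) → ℝ) (ω : Ω) : ℝ :=
  risk (F.mat n ω) (fun i => F.mean μ n i ω) (fun i => errMoment F μ n i 2 ω) w

/-- The infimum of `biasVarRisk` over the simplex. -/
def infBiasVarRisk (F : Forest p Ω Θ) (μ : Measure Ω) (n : ℕ) (ω : Ω) : ℝ :=
  ⨅ w : stdSimplex ℝ (Fin (F.M n)), biasVarRisk F μ n w ω

/-- The model grants measurability only of the events that two observations share a leaf; writing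
the leaf size as a sum of counts over such observations makes this enough. -/
lemma IsSUTForest.measurable_mat (hF : IsSUTForest F μ) (n : ℕ) (m : Fin (F.M n)) (i j : Fin n) :
    Measurable[F.info n] fun ω => F.mat n ω m i j := by
  classical
  have hg : Measurable fun z : (Fin n → Fin p → ℝ) × (Fin n → Fin n) × Θ =>
      treeMatrix (F.grow n m z.1 z.2.1 z.2.2) z.1 z.2.1 i j := by
    have hb : ∀ k, Measurable fun z : (Fin n → Fin p → ℝ) × (Fin n → Fin n) × Θ =>
        (bootCount z.2.1 k : ℝ) := fun k =>
      (measurable_of_finite fun b : Fin n → Fin n => (bootCount b k : ℝ)).comp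
        measurable_snd.fst
    simp only [treeMatrix, Matrix.of_apply, leafSize_eq_sum, Finset.sum_filter, Nat.cast_sum,
      Nat.cast_ite, Nat.cast_zero]
    refine Measurable.ite (hF.meas_grow n m j i) ((hb j).div ?_) measurable_const
    exact Finset.measurable_sum _ fun k _ =>
      Measurable.ite (hF.meas_grow n m k i) (hb k) measurable_const
  have hz : Measurable fun z : (Fin n → Fin p → ℝ) × (Fin (F.M n) → Fin n → Fin n) ×
      (Fin (F.M n) → Θ) => (z.1, z.2.1 m, z.2.2 m) := by fun_prop
  exact (hg.comp hz).comp (comap_measurable _)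

lemma comap_x_le_info (F : Forest p Ω Θ) (n : ℕ) (i : Fin n) :
    MeasurableSpace.comap (F.x n i) inferInstance ≤ F.info n := by
  rw [← measurable_iff_comap_le]
  have hz : Measurable fun z : (Fin n → Fin p → ℝ) × (Fin (F.M n) → Fin n → Fin n) ×
      (Fin (F.M n) → Θ) => z.1 i := by fun_prop
  exact hz.comp (comap_measurable _)

lemma measurable_info_mean (n : ℕ) (i : Fin n) : Measurable[F.info n] (F.mean μ n i) :=
  (stronglyMeasurable_condExp.mono (comap_x_le_info F n i)).measurable

lemma measurable_info_errMoment (n : ℕ) (i : Fin n) (a : ℕ) :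
    Measurable[F.info n] (errMoment F μ n i a) :=
  (stronglyMeasurable_condExp.mono (comap_x_le_info F n i)).measurable

lemma IsSUTForest.nonempty_stdSimplex (hF : IsSUTForest F μ) (n : ℕ) :
    Nonempty (stdSimplex ℝ (Fin (F.M n))) := by
  have : Nonempty (Fin (F.M n)) := ⟨⟨0, hF.pos_M n⟩⟩
  infer_instance

lemma IsSUTForest.measurable_L (hF : IsSUTForest F μ) (n : ℕ) {w : Ω → Fin (F.M n) → ℝ}
    (hw : Measurable w) : Measurable fun ω => F.L μ n (w ω) ω :=
  measurable_sqLoss (fun m i j => (hF.measurable_mat n m i j).mono (hF.info_le n) le_rfl)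
    (hF.measurable_mean n) (hF.meas_y n) hw

lemma IsSUTForest.measurable_biasVarRisk (hF : IsSUTForest F μ) (n : ℕ)
    {w : Ω → Fin (F.M n) → ℝ} (hw : Measurable w) :
    Measurable fun ω => biasVarRisk F μ n (w ω) ω :=
  measurable_risk (fun m i j => (hF.measurable_mat n m i j).mono (hF.info_le n) le_rfl)
    (hF.measurable_mean n)
    (fun i => (measurable_info_errMoment n i 2).mono (hF.info_le n) le_rfl) hw

lemma IsSUTForest.measurable_infL (hF : IsSUTForest F μ) (n : ℕ) : Measurable (F.infL μ n) := by
  have := hF.nonempty_stdSimplex n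
  exact measurable_ciInf_of_continuous (f := fun (w : stdSimplex ℝ (Fin (F.M n))) => F.L μ n w)
    (fun ω => (continuous_sqLoss _ _ _).comp continuous_subtype_val)
    (fun w => hF.measurable_L n measurable_const)

lemma IsSUTForest.measurable_infBiasVarRisk (hF : IsSUTForest F μ) (n : ℕ) :
    Measurable (infBiasVarRisk F μ n) := by
  have := hF.nonempty_stdSimplex n
  exact measurable_ciInf_of_continuous
    (f := fun (w : stdSimplex ℝ (Fin (F.M n))) => biasVarRisk F μ n w)
    (fun ω => (continuous_risk _ _ _).comp continuous_subtype_val)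
    (fun w => hF.measurable_biasVarRisk n measurable_const)

variable [StandardBorelSpace Ω]

/-! ### The selection argument under the conditional law -/

/-- Given predictors and trees, everything but the errors is almost surely constant. -/
lemma ae_condExpKernel_info (hF : IsSUTForest F μ) (n : ℕ) :
    ∀ᵐ ω ∂μ, ∀ᵐ ω' ∂(condExpKernel μ (F.info n) ω), F.mat n ω' = F.mat n ω ∧
      (fun i => F.mean μ n i ω') = (fun i => F.mean μ n i ω) ∧
      (fun i => errMoment F μ n i 2 ω') = (fun i => errMoment F μ n i 2 ω) := by
  have h1 : ∀ᵐ ω ∂μ, ∀ m i j, ∀ᵐ ω' ∂(condExpKernel μ (F.info n) ω),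
      F.mat n ω' m i j = F.mat n ω m i j := by
    simp only [ae_all_iff]
    exact fun m i j => ae_condExpKernel_eq (hF.info_le n) (hF.measurable_mat n m i j)
  have h2 : ∀ᵐ ω ∂μ, ∀ i, ∀ᵐ ω' ∂(condExpKernel μ (F.info n) ω),
      F.mean μ n i ω' = F.mean μ n i ω := by
    rw [ae_all_iff]
    exact fun i => ae_condExpKernel_eq (hF.info_le n) (measurable_info_mean n i)
  have h3 : ∀ᵐ ω ∂μ, ∀ i, ∀ᵐ ω' ∂(condExpKernel μ (F.info n) ω),
      errMoment F μ n i 2 ω' = errMoment F μ n i 2 ω := by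
    rw [ae_all_iff]
    exact fun i => ae_condExpKernel_eq (hF.info_le n) (measurable_info_errMoment n i 2)
  filter_upwards [h1, h2, h3] with ω h1 h2 h3
  simp only [← ae_all_iff] at h1 h2 h3
  filter_upwards [h1, h2, h3] with ω' h1 h2 h3
  exact ⟨by ext m i j; exact h1 m i j, funext h2, funext h3⟩

/-- The data of the `n`-th forest at `ω` that enter the argument conditionally on predictors and
trees. -/
structure CondModel (F : Forest p Ω Θ) (μ : Measure Ω) [IsFiniteMeasure μ] (V : ℝ) (n : ℕ)
    (ω : Ω) : Prop where
  const : ∀ᵐ ω' ∂(condExpKernel μ (F.info n) ω), F.mat n ω' = F.mat n ω ∧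
    (fun i => F.mean μ n i ω') = (fun i => F.mean μ n i ω) ∧
    (fun i => errMoment F μ n i 2 ω') = (fun i => errMoment F μ n i 2 ω)
  moments : ErrorMoments (condExpKernel μ (F.info n) ω) (F.err μ n)
    (fun i => errMoment F μ n i 2 ω) V

lemma L_eq_of_const {ω ω' : Ω} (h1 : F.mat n ω' = F.mat n ω)
    (h2 : (fun i => F.mean μ n i ω') = (fun i => F.mean μ n i ω)) (w : Fin (F.M n) → ℝ) :
    F.L μ n w ω' = sqLoss (F.mat n ω) (fun i => F.mean μ n i ω)
      ((fun i => F.mean μ n i ω) + fun i => F.err μ n i ω') w := by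
  have hY : F.Y n ω' = (fun i => F.mean μ n i ω') + fun i => F.err μ n i ω' := by
    ext i; simp [Forest.Y, Forest.err]
  rw [Forest.L, hY, h1, h2]

lemma C'_eq_of_const {ω ω' : Ω} (h1 : F.mat n ω' = F.mat n ω)
    (h2 : (fun i => F.mean μ n i ω') = (fun i => F.mean μ n i ω)) (w : Fin (F.M n) → ℝ) :
    F.C' n w ω' = mallows (F.mat n ω)
      ((fun i => F.mean μ n i ω) + fun i => F.err μ n i ω') w := by
  have hY : F.Y n ω' = (fun i => F.mean μ n i ω') + fun i => F.err μ n i ω' := by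
    ext i; simp [Forest.Y, Forest.err]
  rw [Forest.C', hY, h1, h2]

/-- `CondModel` does not involve w, so one null set serves all weights, hence also the infimum and
random weights. -/
lemma CondModel.R_eq {V : ℝ} {ω : Ω} (h : CondModel F μ V n ω) (w : Fin (F.M n) → ℝ) :
    F.R μ n w ω = biasVarRisk F μ n w ω := by
  rw [Forest.R, Forest.condRisk, biasVarRisk, ← h.moments.integral_sqLoss]
  refine integral_congr_ae ?_
  filter_upwards [h.const] with ω' h'
  exact L_eq_of_const h'.1 h'.2.1 w

lemma CondModel.xi_eq {V : ℝ} {ω : Ω} (h : CondModel F μ V n ω) :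
    F.xi μ n ω = infBiasVarRisk F μ n ω := by
  simp only [Forest.xi, infBiasVarRisk, h.R_eq]

lemma ae_condModel (hF : IsSUTForest F μ) (h2 : MomentCondition F μ) :
    ∃ V : ℝ, 0 ≤ V ∧ ∀ᵐ ω ∂μ, ∀ n, CondModel F μ V n ω := by
  obtain ⟨v, hv, h⟩ := h2
  refine ⟨1 + v, by linarith, ae_all_iff.2 fun n => ?_⟩
  filter_upwards [ae_condExpKernel_info hF n, ae_errorMoments hF (h n)] with ω a b
  exact ⟨a, b⟩

lemma biasVarRisk_eq_of_const {ω ω' : Ω} (h1 : F.mat n ω' = F.mat n ω)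
    (h2 : (fun i => F.mean μ n i ω') = (fun i => F.mean μ n i ω))
    (h3 : (fun i => errMoment F μ n i 2 ω') = (fun i => errMoment F μ n i 2 ω))
    (w : Fin (F.M n) → ℝ) : biasVarRisk F μ n w ω' = biasVarRisk F μ n w ω := by
  rw [biasVarRisk, h1, h2, h3, biasVarRisk]

lemma biasVarRisk_nonneg {V : ℝ} {ω : Ω} (h : CondModel F μ V n ω) (w : Fin (F.M n) → ℝ) :
    0 ≤ biasVarRisk F μ n w ω :=
  (Finset.sum_nonneg fun _ _ => sq_nonneg _).trans
    (bias_le_risk fun i => h.moments.var_nonneg i)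

/-- The event that one of the three ratios differs from one by at least `ε`. -/
def badSet (F : Forest p Ω Θ) (μ : Measure Ω) (n : ℕ) (W : Ω → Fin (F.M n) → ℝ) (ε : ℝ) : Set Ω :=
  {ω | ε ≤ |F.L μ n (W ω) ω / F.infL μ n ω - 1|} ∪
  {ω | ε ≤ |F.L μ n (W ω) ω / infBiasVarRisk F μ n ω - 1|} ∪
  {ω | ε ≤ |biasVarRisk F μ n (W ω) ω / infBiasVarRisk F μ n ω - 1|}

lemma IsSUTForest.measurableSet_badSet (hF : IsSUTForest F μ) (n : ℕ)
    {W : Ω → Fin (F.M n) → ℝ} (hW : Measurable W) (ε : ℝ) :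
    MeasurableSet (badSet F μ n W ε) := by
  have h1 := hF.measurable_L n hW
  have h2 := hF.measurable_biasVarRisk n hW
  have h3 := hF.measurable_infL n
  have h4 := hF.measurable_infBiasVarRisk n
  exact ((measurableSet_le measurable_const ((h1.div h3).sub_const 1).norm).union
    (measurableSet_le measurable_const ((h1.div h4).sub_const 1).norm)).union
    (measurableSet_le measurable_const ((h2.div h4).sub_const 1).norm)

/-- Conditionally on predictors and trees, a ratio far from one has small probability once the
minimal risk dominates the squared number of trees. -/
lemma condExpKernel_badSet_le (hM : 1 ≤ F.M n) {V K ρ δ ε : ℝ} {ω : Ω}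
    (hV : 0 ≤ V) (h : CondModel F μ V n ω) (hP : MatrixBounds (F.mat n ω) K ρ) (hK : 0 ≤ K)
    (hρ : 0 ≤ ρ) (hξ : 1 ≤ infBiasVarRisk F μ n ω) {W : Ω → Fin (F.M n) → ℝ}
    (hmem : ∀ ω, W ω ∈ stdSimplex ℝ (Fin (F.M n)))
    (hmin : ∀ ω, ∀ w ∈ stdSimplex ℝ (Fin (F.M n)), F.C' n (W ω) ω ≤ F.C' n w ω)
    (hδ : 0 < δ) (hη : 12 * δ + 4 * ρ ≤ 1 / 8) (hε : 16 * (12 * δ + 4 * ρ) < ε) :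
    (condExpKernel μ (F.info n) ω).real (badSet F μ n W ε)
      ≤ (5 * V + 12 * (V * K)) / δ ^ 2 * ((infBiasVarRisk F μ n ω)⁻¹ * (F.M n : ℝ) ^ 2) := by
  obtain ⟨G, hG0, hGi, hGle, hG⟩ := exists_uniform_bound hP hK hρ h.moments hV hM
    (fun i => F.mean μ n i ω)
  set ν := condExpKernel μ (F.info n) ω
  set ξ := infBiasVarRisk F μ n ω with hξdef
  have : Nonempty (stdSimplex ℝ (Fin (F.M n))) := ⟨⟨W ω, hmem ω⟩⟩
  have hξle : ∀ w ∈ stdSimplex ℝ (Fin (F.M n)), ξ ≤ biasVarRisk F μ n w ω := fun w hw =>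
    ciInf_le (f := fun w : stdSimplex ℝ (Fin (F.M n)) => biasVarRisk F μ n w ω)
      ⟨0, by rintro _ ⟨w, rfl⟩; exact biasVarRisk_nonneg h w⟩ ⟨w, hw⟩
  -- If G < δ²ξ, then G ≤ δ²R(w) for every w since ξ ≤ R(w), and the selection argument is
  -- deterministic.
  have hsub : badSet F μ n W ε ≤ᵐ[ν] {ω' | δ ^ 2 * ξ ≤ G ω'} := by
    filter_upwards [h.const] with ω' hc hbad
    by_contra hlt
    have hlt : G ω' < δ ^ 2 * ξ := not_le.1 hlt
    have key := fun w hw => hG ω' w hw (hξ.trans (hξle w hw)) δ hδ.le (by linarith)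
      (hlt.le.trans (mul_le_mul_of_nonneg_left (hξle w hw) (sq_nonneg δ)))
    have hinf : infBiasVarRisk F μ n ω' = ξ := by
      simp only [hξdef, infBiasVarRisk, biasVarRisk_eq_of_const hc.1 hc.2.1 hc.2.2]
    obtain ⟨r1, r2, r3⟩ := selection_ratio
      (L := fun w : stdSimplex ℝ (Fin (F.M n)) => F.L μ n w ω')
      (R := fun w : stdSimplex ℝ (Fin (F.M n)) => biasVarRisk F μ n w ω)
      (C := fun w : stdSimplex ℝ (Fin (F.M n)) => F.C' n w ω')
      (c := ∑ i, F.err μ n i ω' ^ 2) (η := 12 * δ + 4 * ρ) (a := ⟨W ω', hmem ω'⟩)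
      (by positivity) hη (fun w => biasVarRisk_nonneg h w) (one_pos.trans_le hξ)
      (fun w => by
        rw [L_eq_of_const hc.1 hc.2.1]
        refine (key w w.2).1.trans (mul_le_mul_of_nonneg_right (by linarith)
          (biasVarRisk_nonneg h w)))
      (fun w => by
        rw [L_eq_of_const hc.1 hc.2.1, C'_eq_of_const hc.1 hc.2.1]
        exact (key w w.2).2)
      (fun w => hmin ω' w w.2)
    rcases hbad with (hb | hb) | hb
    · exact absurd (r1.trans_lt hε) (not_lt.2 hb)
    · have hb : ε ≤ |F.L μ n (W ω') ω' / infBiasVarRisk F μ n ω' - 1| := hb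
      rw [hinf] at hb
      exact absurd (r2.trans_lt hε) (not_lt.2 hb)
    · have hb : ε ≤ |biasVarRisk F μ n (W ω') ω' / infBiasVarRisk F μ n ω' - 1| := hb
      rw [hinf, biasVarRisk_eq_of_const hc.1 hc.2.1 hc.2.2] at hb
      exact absurd (r3.trans_lt hε) (not_lt.2 hb)
  have hmarkov := mul_meas_ge_le_integral_of_nonneg (ae_of_all ν hG0) hGi (δ ^ 2 * ξ)
  have hpos : 0 < δ ^ 2 * ξ := by have := one_pos.trans_le hξ; positivity
  have hle : ν.real (badSet F μ n W ε) ≤ ν.real {ω' | δ ^ 2 * ξ ≤ G ω'} :=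
    ENNReal.toReal_mono (measure_ne_top _ _) (measure_mono_ae hsub)
  calc ν.real (badSet F μ n W ε) ≤ ν.real {ω' | δ ^ 2 * ξ ≤ G ω'} := hle
    _ ≤ ((5 * V + 12 * (V * K)) * (F.M n : ℝ) ^ 2) / (δ ^ 2 * ξ) := by
        rw [le_div_iff₀ hpos, mul_comm]
        exact hmarkov.trans hGle
    _ = _ := by
        have := one_pos.trans_le hξ
        field_simp

/-- At fixed ω, Markov's bound is a constant times M²/ξ. That the constant depends on ω through the
matrix bound is harmless, as convergence is claimed pointwise. -/
lemma ae_tendsto_condExpKernel_badSet (hF : IsSUTForest F μ)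
    (hM : ∃ k : ℕ, Asymptotics.IsBigO atTop (fun n => (F.M n : ℝ)) fun n => (n : ℝ) ^ k)
    (h1 : RiskCondition F μ) (h2 : MomentCondition F μ) (h3 : LeafCondition F μ)
    {W : (n : ℕ) → Ω → Fin (F.M n) → ℝ}
    (hmem : ∀ n ω, W n ω ∈ stdSimplex ℝ (Fin (F.M n)))
    (hmin : ∀ n ω, ∀ w ∈ stdSimplex ℝ (Fin (F.M n)), F.C' n (W n ω) ω ≤ F.C' n w ω) :
    ∀ᵐ ω ∂μ, ∀ ε : ℝ, 0 < ε →
      Tendsto (fun n => (condExpKernel μ (F.info n) ω).real (badSet F μ n (W n) ε)) atTop (𝓝 0) := by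
  obtain ⟨V, hV, hmod⟩ := ae_condModel hF h2
  filter_upwards [hmod, h1, ae_eventually_matrixBounds hF hM h3] with ω hmod h1 ⟨K, hK, hKn⟩ ε hε
  obtain ⟨hpos, hlim⟩ := h1
  simp only [(hmod _).xi_eq] at hpos hlim
  -- Once ρ < δ, the tolerance 12δ + 4ρ is below 16δ ≤ 1/8, and 16 times it is below 256δ < ε.
  set δ := min ε 1 / 10000 with hδdef
  have hmin1 : 0 < min ε 1 := lt_min hε one_pos
  have hδ : 0 < δ := by positivity
  have hρ : Tendsto (fun n : ℕ => K / √√(n : ℝ)) atTop (𝓝 0) :=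
    tendsto_const_nhds.div_atTop (Real.tendsto_sqrt_atTop.comp
      (Real.tendsto_sqrt_atTop.comp tendsto_natCast_atTop_atTop))
  have hub : Tendsto (fun n => (5 * V + 12 * (V * K)) / δ ^ 2 *
      ((infBiasVarRisk F μ n ω)⁻¹ * (F.M n : ℝ) ^ 2)) atTop (𝓝 0) := by
    simpa using hlim.const_mul ((5 * V + 12 * (V * K)) / δ ^ 2)
  refine tendsto_of_tendsto_of_tendsto_of_le_of_le' tendsto_const_nhds hub
    (Eventually.of_forall fun n => measureReal_nonneg) ?_
  filter_upwards [hpos, hlim.eventually (gt_mem_nhds one_pos), hρ.eventually (gt_mem_nhds hδ),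
    hKn] with n hpos hlt hρn hP
  have hMn : (1 : ℝ) ≤ F.M n := by exact_mod_cast hF.pos_M n
  have hξ : 1 ≤ infBiasVarRisk F μ n ω := by
    rw [inv_mul_lt_iff₀ hpos] at hlt
    nlinarith
  have hm1 : min ε 1 ≤ 1 := min_le_right _ _
  have hme : min ε 1 ≤ ε := min_le_left _ _
  exact condExpKernel_badSet_le (hF.pos_M n) hV (hmod n) hP (by linarith) (by positivity) hξ
    (hmem n) (hmin n) hδ (by linarith) (by linarith)

end

/-! ### Passage to unconditional statements -/

section

variable {Ω Θ : Type*} [MeasurableSpace Ω] [MeasurableSpace Θ] {μ : Measure Ω}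
  [IsProbabilityMeasure μ] {F : Forest p Ω Θ} [StandardBorelSpace Ω]

/-- Conditional probabilities of the bad event tend to zero almost surely, and bounded convergence
averages them. Asking for `hf` only almost everywhere lets risks be replaced by their bias-variance
formula. -/
lemma tendstoInMeasure_of_badSet (hF : IsSUTForest F μ) {W : (n : ℕ) → Ω → Fin (F.M n) → ℝ}
    (hW : ∀ n, Measurable (W n))
    (h : ∀ᵐ ω ∂μ, ∀ ε : ℝ, 0 < ε →
      Tendsto (fun n => (condExpKernel μ (F.info n) ω).real (badSet F μ n (W n) ε)) atTop (𝓝 0))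
    {f : ℕ → Ω → ℝ} (hf : ∀ n, ∀ᵐ ω ∂μ, ∀ ε, ε ≤ |f n ω - 1| → ω ∈ badSet F μ n (W n) ε) :
    TendstoInMeasure μ f atTop (fun _ => 1) := by
  rw [tendstoInMeasure_iff_dist]
  intro ε hε
  have hb := tendsto_measure_of_condExpKernel (μ := μ) (fun n => hF.info_le n)
    (fun n => hF.measurableSet_badSet n (hW n) ε) (by
      filter_upwards [h] with ω hω
      have := ENNReal.tendsto_ofReal (hω ε hε)
      rw [ENNReal.ofReal_zero] at this
      exact this.congr fun n => ENNReal.ofReal_toReal (measure_ne_top _ _))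
  refine tendsto_of_tendsto_of_tendsto_of_le_of_le tendsto_const_nhds hb (fun _ => zero_le)
    fun n => measure_mono_ae ?_
  filter_upwards [hf n] with ω hω hd
  exact hω ε hd

lemma L_nonneg (F : Forest p Ω Θ) (μ : Measure Ω) (n : ℕ) (w : Fin (F.M n) → ℝ) (ω : Ω) :
    0 ≤ F.L μ n w ω := by
  unfold Forest.L sqLoss
  exact Finset.sum_nonneg fun _ _ => sq_nonneg _

/-- Off the bad set the loss ratio is within ε of one; on it, the ratio lies between 0 and C + 1, so
its distance from one is at most C + 1. Integrating against the kernel gives the bound. -/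
lemma abs_condRisk_div_sub_one_le (hF : IsSUTForest F μ) {W : Ω → Fin (F.M n) → ℝ}
    (hW : Measurable W) {V C ε : ℝ} {ω : Ω} (hC : 0 < C) (hε : 0 < ε) (h : CondModel F μ V n ω)
    (hξ : 0 < infBiasVarRisk F μ n ω)
    (hle : ∀ᵐ ω' ∂(condExpKernel μ (F.info n) ω),
      (F.L μ n (W ω') ω' - infBiasVarRisk F μ n ω') * (infBiasVarRisk F μ n ω')⁻¹ ≤ C) :
    |F.condRisk μ n W ω / F.xi μ n ω - 1|
      ≤ ε + (C + 1) * (condExpKernel μ (F.info n) ω).real (badSet F μ n W ε) := by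
  rw [h.xi_eq, Forest.condRisk]
  set ν := condExpKernel μ (F.info n) ω
  set ξ := infBiasVarRisk F μ n ω with hξdef
  have hm := hF.measurable_L n hW
  have hB := hF.measurableSet_badSet n hW ε
  have hinf : ∀ᵐ ω' ∂ν, infBiasVarRisk F μ n ω' = ξ := by
    filter_upwards [h.const] with ω' hc
    simp only [hξdef, infBiasVarRisk, biasVarRisk_eq_of_const hc.1 hc.2.1 hc.2.2]
  have hbd : ∀ᵐ ω' ∂ν, F.L μ n (W ω') ω' / ξ ≤ C + 1 := by
    filter_upwards [hinf, hle] with ω' h1 h2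
    rw [h1, sub_mul, mul_inv_cancel₀ hξ.ne', ← div_eq_mul_inv] at h2
    linarith
  have hnn : ∀ ω', 0 ≤ F.L μ n (W ω') ω' / ξ := fun ω' => div_nonneg (L_nonneg F μ n _ _) hξ.le
  have hint : Integrable (fun ω' => F.L μ n (W ω') ω' / ξ) ν := by
    refine (integrable_const (C + 1)).mono' (hm.div_const ξ).aestronglyMeasurable ?_
    filter_upwards [hbd] with ω' h1
    rwa [Real.norm_of_nonneg (hnn ω')]
  have h1 : (∫ ω', F.L μ n (W ω') ω' ∂ν) / ξ - 1 = ∫ ω', (F.L μ n (W ω') ω' / ξ - 1) ∂ν := by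
    rw [integral_sub hint (integrable_const _), integral_div]
    simp
  have hind : Integrable ((badSet F μ n W ε).indicator fun _ => C + 1) ν :=
    (integrable_const _).indicator hB
  rw [h1, ← Real.norm_eq_abs]
  refine (norm_integral_le_of_norm_le ((integrable_const ε).add hind) ?_).trans_eq ?_
  · filter_upwards [hbd, hinf] with ω' h2 h3
    by_cases hω : ω' ∈ badSet F μ n W ε
    · simp only [Pi.add_apply, Set.indicator_of_mem hω, Real.norm_eq_abs]
      have := hnn ω'
      rw [abs_le]
      constructor <;> linarith
    · simp only [Pi.add_apply, Set.indicator_of_notMem hω, Real.norm_eq_abs, add_zero]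
      refine (lt_of_not_ge fun hge => hω (Or.inl (Or.inr ?_))).le
      change ε ≤ |F.L μ n (W ω') ω' / infBiasVarRisk F μ n ω' - 1|
      rwa [h3]
  · simp only [Pi.add_apply]
    rw [integral_add (integrable_const ε) hind, integral_indicator_const _ hB]
    simp [mul_comm]

lemma ae_tendsto_condRisk_div_xi (hF : IsSUTForest F μ) {W : (n : ℕ) → Ω → Fin (F.M n) → ℝ}
    (hW : ∀ n, Measurable (W n)) (h1 : RiskCondition F μ) (h2 : MomentCondition F μ)
    (h : ∀ᵐ ω ∂μ, ∀ ε : ℝ, 0 < ε →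
      Tendsto (fun n => (condExpKernel μ (F.info n) ω).real (badSet F μ n (W n) ε)) atTop (𝓝 0))
    {C : ℝ} (hC : 0 < C)
    (hle : ∀ n, ∀ᵐ ω ∂μ, (F.L μ n (W n ω) ω - F.xi μ n ω) * (F.xi μ n ω)⁻¹ ≤ C) :
    ∀ᵐ ω ∂μ, Tendsto (fun n => F.condRisk μ n (W n) ω / F.xi μ n ω) atTop (𝓝 1) := by
  obtain ⟨V, -, hmod⟩ := ae_condModel hF h2
  -- The bound on the loss ratio is assumed μ-almost surely but is integrated under the conditional
  -- law, so it is transferred there first.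
  have hle' : ∀ᵐ ω ∂μ, ∀ n, ∀ᵐ ω' ∂(condExpKernel μ (F.info n) ω),
      (F.L μ n (W n ω') ω' - infBiasVarRisk F μ n ω') * (infBiasVarRisk F μ n ω')⁻¹ ≤ C := by
    refine ae_all_iff.2 fun n => ae_ae_condExpKernel (hF.info_le n) ?_
    filter_upwards [hmod, hle n] with ω a b
    rwa [(a n).xi_eq] at b
  filter_upwards [hmod, h1, h, hle'] with ω hmod h1 h hle'
  rw [Metric.tendsto_nhds]
  intro ε hε
  have hlim := (h (ε / 2) (half_pos hε)).const_mul (C + 1)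
  rw [mul_zero] at hlim
  filter_upwards [h1.1, hlim.eventually (gt_mem_nhds (half_pos hε))] with n hpos hlt
  rw [(hmod n).xi_eq] at hpos
  have := abs_condRisk_div_sub_one_le hF (hW n) hC (half_pos hε) (hmod n) hpos (hle' n)
  rw [Real.dist_eq]
  linarith

end

end WRF

end

theorem theorem1 {p : ℕ} {Ω Θ : Type*} [MeasurableSpace Ω] [StandardBorelSpace Ω]
    [MeasurableSpace Θ] (μ : Measure Ω) [IsProbabilityMeasure μ] (F : WRF.Forest p Ω Θ)
    (hF : WRF.IsSUTForest F μ)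
    (hM : ∃ k : ℕ, Asymptotics.IsBigO atTop (fun n => (F.M n : ℝ)) fun n => (n : ℝ) ^ k)
    (h1 : WRF.RiskCondition F μ) (h2 : WRF.MomentCondition F μ) (h3 : WRF.LeafCondition F μ)
    (what : (n : ℕ) → Ω → Fin (F.M n) → ℝ)
    (hmeas : ∀ n, Measurable (what n))
    (hmem : ∀ n ω, what n ω ∈ stdSimplex ℝ (Fin (F.M n)))
    (hmin : ∀ n ω, ∀ w ∈ stdSimplex ℝ (Fin (F.M n)), F.C' n (what n ω) ω ≤ F.C' n w ω) :
    -- the loss of the selected weights is asymptotically optimal, in probability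
    TendstoInMeasure μ (fun n ω => F.L μ n (what n ω) ω / F.infL μ n ω) atTop (fun _ => 1) ∧
    ((∃ C : ℝ, 0 < C ∧ ∀ n, ∀ᵐ ω ∂μ,
        (F.L μ n (what n ω) ω - F.xi μ n ω) * (F.xi μ n ω)⁻¹ ≤ C) →
      -- the risk of the estimator with the random weights is asymptotically optimal, almost surely
      (∀ᵐ ω ∂μ, Tendsto (fun n => F.condRisk μ n (what n) ω / F.xi μ n ω) atTop (𝓝 1)) ∧
      -- and so is the risk function evaluated at the random weights, in probability
      TendstoInMeasure μ (fun n ω => F.R μ n (what n ω) ω / F.xi μ n ω) atTop (fun _ => 1)) := by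
  have hbad := WRF.ae_tendsto_condExpKernel_badSet hF hM h1 h2 h3 hmem hmin
  refine ⟨WRF.tendstoInMeasure_of_badSet hF hmeas hbad fun n => ae_of_all _ fun ω ε h =>
    Or.inl (Or.inl h), fun ⟨C, hC, hle⟩ =>
    ⟨WRF.ae_tendsto_condRisk_div_xi hF hmeas h1 h2 hbad hC hle, ?_⟩⟩
  obtain ⟨V, -, hmod⟩ := WRF.ae_condModel hF h2
  refine WRF.tendstoInMeasure_of_badSet hF hmeas hbad fun n => ?_
  filter_upwards [hmod] with ω hω ε h
  rw [(hω n).xi_eq, (hω n).R_eq] at h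
  exact Or.inr h
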